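/- For $l=1,2,\dots$ let $T_l u=-u''+\frac{l(l+1)}{r^2}u$ on $(0,\infty)$, and let $T_l^3$ denote the operator in $L^2(0,\infty)$ (complex-valued functions) acting by the differential expression $\bigl(-\frac{d^2}{dr^2}+\frac{l(l+1)}{r^2}\bigr)^3$ on $$\mathscr W_0^6=\Bigl\{u:\int_0^\infty(|u|^2+|u^{(6)}|^2)\,dr<\infty,\ u(0)=u'(0)=\dots=u^{(5)}(0)=0\Bigr\}.$$ For every $l\ge 1$ this is a well-defined, densely defined symmetric operator with domain $\mathscr W_0^6$. The deficiency indices are the dimensions of $\ker(T_l^3+i)^*$ and $\ker(T_l^3-i)^*$. (a) For $l=1,2$ the deficiency indices of $T_l^3$ are $(2,2)$. Moreover, put $D_lw(r)=r^{l+1}\bigl(\frac1r\frac{d}{dr}\bigr)^l\frac{w(r)}{r}$ and, for $\rho>0$ and a choice of sign, $$q^1_{l\pm}=D_l\Bigl(\exp\{e^{\mp i\frac{3\pi}{4}}\rho r\}+e^{\mp i\frac{2\pi}{3}}\exp\{-e^{\mp i\frac{\pi}{12}}\rho r\}+e^{\pm i\frac{2\pi}{3}}\exp\{-e^{\mp i\frac{5\pi}{12}}\rho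 r\}\Bigr),$$ $$q^2_{l\pm}=D_l\Bigl(e^{\mp i\frac{5\pi}{6}}\exp\{e^{\mp i\frac{3\pi}{4}}\rho r\}+\sqrt3\,\exp\{-e^{\mp i\frac{\pi}{12}}\rho r\}+e^{\pm i\frac{5\pi}{6}}\exp\{-e^{\mp i\frac{5\pi}{12}}\rho r\}\Bigr).$$ Then $q^1_{l\pm},q^2_{l\pm}$ belong to $L^2(0,\infty)$, are linearly independent, and $$\ker(T_l^3\pm i\rho^6)^*=\{\alpha q^1_{l\pm}+\beta q^2_{l\pm}:\alpha,\beta\in\mathbb C\}.$$ (b) For $l=3$ and $l=4$ the deficiency indices of $T_l^3$ are $(1,1)$. (c) For $l\ge 5$ the deficiency indices of $T_l^3$ are $(0,0)$, so that $T_l^3$ is essentially self-adjoint and has no self-adjoint extension other than its closure. -/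

import Mathlib

open Set Filter Topology MeasureTheory
open scoped ComplexConjugate LinearPMap

noncomputable section

/-- Lebesgue measure on the half-line `(0, ∞)`. -/
abbrev halfLineMeasure : Measure ℝ := volume.restrict (Ioi 0)

/-- The Hilbert space `L²(0, ∞)` of complex-valued functions. -/
abbrev HalfLineL2 : Type := Lp ℂ 2 halfLineMeasure

/-- The differential operation `T_l u = -u'' + l(l+1)/r² u`. -/
def radialT (l : ℕ) (u : ℝ → ℂ) : ℝ → ℂ :=
  fun r => -(deriv (deriv u) r) + ((l : ℂ) * (l + 1) / (r : ℂ) ^ 2) * u r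

/-- `f` is square integrable on `(0, ∞)`, it is five times continuously differentiable on `[0, ∞)`,
its fifth derivative is locally absolutely continuous with almost everywhere derivative
`g = f^(6)`, `g` is square integrable, and `f(0) = f'(0) = … = f^(5)(0) = 0`. -/
structure IsW06 (f g : ℝ → ℂ) : Prop where
  contDiffOn : ContDiffOn ℝ 5 f (Ici 0)
  memLp : MemLp f 2 halfLineMeasure
  memLp_sixth : MemLp g 2 halfLineMeasure
  fifth_eq : ∀ r : ℝ, 0 ≤ r →
    iteratedDerivWithin 5 f (Ici 0) r = iteratedDerivWithin 5 f (Ici 0) 0 + ∫ s in (0 : ℝ)..r, g s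
  boundary : ∀ k : ℕ, k ≤ 5 → iteratedDerivWithin k f (Ici 0) 0 = 0

/-- The set `W_0^6` as a set of elements of `L²(0, ∞)`. -/
def sobolevW06 : Set HalfLineL2 :=
  {u | ∃ f g : ℝ → ℂ, IsW06 f g ∧ ⇑u =ᵐ[halfLineMeasure] f}

/-! ### The pointwise expression `T_l³ f` depends linearly on `f ∈ W_0^6` -/

lemma radialT_smul (l : ℕ) (c : ℂ) (f : ℝ → ℂ) : radialT l (c • f) = c • radialT l f := by
  have h1 : deriv (c • f) = c • deriv f := by
    funext r; exact deriv_const_smul_field c f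
  have h2 : deriv (c • deriv f) = c • deriv (deriv f) := by
    funext r; exact deriv_const_smul_field c (deriv f)
  funext r
  simp only [radialT, h1, h2, Pi.smul_apply, smul_eq_mul]
  ring

lemma radialT_congr {l : ℕ} {f g : ℝ → ℂ} (h : EqOn f g (Ioi 0)) :
    EqOn (radialT l f) (radialT l g) (Ioi 0) := by
  intro r hr
  have h0 : f =ᶠ[𝓝 r] g := h.eventuallyEq_of_mem (isOpen_Ioi.mem_nhds hr)
  simp only [radialT, h0.deriv.deriv_eq, h hr]

lemma radialT_iterate_congr {l : ℕ} {f g : ℝ → ℂ} (h : EqOn f g (Ioi 0)) (n : ℕ) :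
    EqOn ((radialT l)^[n] f) ((radialT l)^[n] g) (Ioi 0) := by
  induction n with
  | zero => exact h
  | succ n ih => simp only [Function.iterate_succ_apply']; exact radialT_congr ih

lemma ContDiffOn.deriv_halfLine {m n : ℕ} {f : ℝ → ℂ} (h : ContDiffOn ℝ n f (Ioi 0))
    (hmn : m + 1 ≤ n) : ContDiffOn ℝ m (deriv f) (Ioi 0) :=
  h.deriv_of_isOpen isOpen_Ioi (by exact_mod_cast hmn)

lemma contDiffOn_centrifugal (l : ℕ) {n : ℕ} {f : ℝ → ℂ} (h : ContDiffOn ℝ n f (Ioi 0)) :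
    ContDiffOn ℝ n (fun r : ℝ => ((l : ℂ) * (l + 1) / (r : ℂ) ^ 2) * f r) (Ioi 0) := by
  refine ContDiffOn.mul ?_ h
  simp only [div_eq_mul_inv]
  refine ContDiffOn.mul contDiffOn_const (ContDiffOn.inv ?_ ?_)
  · have h0 : ContDiff ℝ n (fun r : ℝ => (r : ℂ)) := Complex.ofRealCLM.contDiff
    exact (h0.pow 2).contDiffOn
  · intro r hr
    have : (r : ℂ) ≠ 0 := by exact_mod_cast (ne_of_gt hr)
    exact pow_ne_zero 2 this

lemma ContDiffOn.radialT {l m n : ℕ} {f : ℝ → ℂ} (h : ContDiffOn ℝ n f (Ioi 0))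
    (hmn : m + 2 ≤ n) : ContDiffOn ℝ m (radialT l f) (Ioi 0) := by
  have h1 : ContDiffOn ℝ (m + 1 : ℕ) (deriv f) (Ioi 0) := h.deriv_halfLine hmn
  have h2 : ContDiffOn ℝ m (deriv (deriv f)) (Ioi 0) := h1.deriv_halfLine le_rfl
  exact h2.neg.add ((contDiffOn_centrifugal l h).of_le (by exact_mod_cast (by omega : m ≤ n)))

lemma ContDiffOn.deriv_add_halfLine {f g : ℝ → ℂ} (hf : ContDiffOn ℝ 1 f (Ioi 0))
    (hg : ContDiffOn ℝ 1 g (Ioi 0)) : EqOn (deriv (f + g)) (deriv f + deriv g) (Ioi 0) := by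
  intro r hr
  have hr' := isOpen_Ioi.mem_nhds hr
  exact deriv_add ((hf.differentiableOn one_ne_zero).differentiableAt hr')
    ((hg.differentiableOn one_ne_zero).differentiableAt hr')

lemma radialT_add_apply {l : ℕ} {f g : ℝ → ℂ} (hf : ContDiffOn ℝ 1 f (Ioi 0))
    (hg : ContDiffOn ℝ 1 g (Ioi 0)) {r : ℝ} (hr : 0 < r) (hf' : DifferentiableAt ℝ (deriv f) r)
    (hg' : DifferentiableAt ℝ (deriv g) r) :
    radialT l (f + g) r = radialT l f r + radialT l g r := by
  have h0 : deriv (f + g) =ᶠ[𝓝 r] deriv f + deriv g :=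
    (hf.deriv_add_halfLine hg).eventuallyEq_of_mem (isOpen_Ioi.mem_nhds hr)
  simp only [radialT, h0.deriv_eq, deriv_add hf' hg', Pi.add_apply]
  ring

lemma radialT_add_eqOn {l : ℕ} {f g : ℝ → ℂ} (hf : ContDiffOn ℝ (2 : ℕ) f (Ioi 0))
    (hg : ContDiffOn ℝ (2 : ℕ) g (Ioi 0)) :
    EqOn (radialT l (f + g)) (radialT l f + radialT l g) (Ioi 0) := by
  intro r hr
  have key : ∀ {f : ℝ → ℂ}, ContDiffOn ℝ (2 : ℕ) f (Ioi 0) → DifferentiableAt ℝ (deriv f) r := by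
    intro f hf
    have : ContDiffOn ℝ (1 : ℕ) (deriv f) (Ioi 0) := hf.deriv_halfLine (by norm_num)
    exact (this.differentiableOn (by norm_num)).differentiableAt (isOpen_Ioi.mem_nhds hr)
  exact radialT_add_apply (hf.of_le (by norm_num)) (hg.of_le (by norm_num)) hr (key hf) (key hg)

lemma IsW06.contDiffOn_Ioi {f g : ℝ → ℂ} (h : IsW06 f g) : ContDiffOn ℝ (5 : ℕ) f (Ioi 0) :=
  h.contDiffOn.mono Ioi_subset_Ici_self

lemma IsW06.intervalIntegrable {f g : ℝ → ℂ} (h : IsW06 f g) {r : ℝ} (hr : 0 ≤ r) :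
    IntervalIntegrable g volume 0 r := by
  rw [intervalIntegrable_iff_integrableOn_Ioc_of_le hr]
  have h1 : MemLp g 2 (volume.restrict (Ioc 0 r)) :=
    h.memLp_sixth.mono_measure (Measure.restrict_mono Ioc_subset_Ioi_self le_rfl)
  exact h1.integrable (by norm_num)

/-- The second derivative of `T_l² f` exists almost everywhere for `f ∈ W_0^6`. -/
lemma IsW06.ae_differentiableAt {l : ℕ} {f g : ℝ → ℂ} (h : IsW06 f g) :
    ∀ᵐ r ∂halfLineMeasure, DifferentiableAt ℝ (deriv (radialT l (radialT l f))) r := by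
  have hf := h.contDiffOn_Ioi
  set p : ℝ → ℂ := fun r => ((l : ℂ) * (l + 1) / (r : ℂ) ^ 2) * f r with hp
  have hpc : ContDiffOn ℝ (5 : ℕ) p (Ioi 0) := contDiffOn_centrifugal l hf
  have hd1 : ContDiffOn ℝ (4 : ℕ) (deriv f) (Ioi 0) := hf.deriv_halfLine (by norm_num)
  have hd2 : ContDiffOn ℝ (3 : ℕ) (deriv (deriv f)) (Ioi 0) := hd1.deriv_halfLine (by norm_num)
  have hd3 : ContDiffOn ℝ (2 : ℕ) (deriv (deriv (deriv f))) (Ioi 0) :=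
    hd2.deriv_halfLine (by norm_num)
  have hd4 : ContDiffOn ℝ (1 : ℕ) (deriv (deriv (deriv (deriv f)))) (Ioi 0) :=
    hd3.deriv_halfLine (by norm_num)
  have hp1 : ContDiffOn ℝ (4 : ℕ) (deriv p) (Ioi 0) := hpc.deriv_halfLine (by norm_num)
  have hp2 : ContDiffOn ℝ (3 : ℕ) (deriv (deriv p)) (Ioi 0) := hp1.deriv_halfLine (by norm_num)
  have hT : ContDiffOn ℝ (3 : ℕ) (radialT l f) (Ioi 0) := hf.radialT (by norm_num)
  set S : ℝ → ℂ := fun r => -(deriv (deriv p) r) +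
    ((l : ℂ) * (l + 1) / (r : ℂ) ^ 2) * radialT l f r with hS
  have hSc : ContDiffOn ℝ (3 : ℕ) S (Ioi 0) := hp2.neg.add (contDiffOn_centrifugal l hT)
  have e1 : EqOn (deriv (radialT l f)) (-(deriv (deriv (deriv f))) + deriv p) (Ioi 0) := by
    have := ContDiffOn.deriv_add_halfLine (f := -(deriv (deriv f))) (g := p)
      (hd2.neg.of_le (by norm_num)) (hpc.of_le (by norm_num))
    intro r hr
    have h2 := this hr
    rw [Pi.add_apply, deriv.neg'] at h2
    exact h2
  have e2 : EqOn (deriv (deriv (radialT l f)))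
      (-(deriv (deriv (deriv (deriv f)))) + deriv (deriv p)) (Ioi 0) := by
    intro r hr
    have h1 := (e1.eventuallyEq_of_mem (isOpen_Ioi.mem_nhds hr)).deriv_eq
    have h2 := ContDiffOn.deriv_add_halfLine (f := -(deriv (deriv (deriv f)))) (g := deriv p)
      (hd3.neg.of_le (by norm_num)) (hp1.of_le (by norm_num)) hr
    rw [Pi.add_apply, deriv.neg'] at h2
    exact h1.trans h2
  have e3 : EqOn (radialT l (radialT l f)) (deriv (deriv (deriv (deriv f))) + S) (Ioi 0) := by
    intro r hr
    have h2 := e2 hr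
    simp only [Pi.add_apply, Pi.neg_apply] at h2
    simp only [Pi.add_apply, hS]
    conv_lhs => rw [radialT]
    rw [h2]
    ring
  have e4 : EqOn (deriv (radialT l (radialT l f)))
      (deriv (deriv (deriv (deriv (deriv f)))) + deriv S) (Ioi 0) := by
    intro r hr
    have h1 := (e3.eventuallyEq_of_mem (isOpen_Ioi.mem_nhds hr)).deriv_eq
    exact h1.trans (hd4.deriv_add_halfLine (hSc.of_le (by norm_num)) hr)
  have e5 : EqOn (deriv (deriv (deriv (deriv (deriv f)))))
      (fun r => iteratedDerivWithin 5 f (Ici 0) 0 + ∫ s in (0 : ℝ)..r, g s) (Ioi 0) := by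
    intro r hr
    refine Eq.trans ?_ (h.fifth_eq r (le_of_lt hr))
    have hs : (Ici 0 : Set ℝ) =ᶠ[𝓝 r] (univ : Set ℝ) := by
      rw [eventuallyEq_univ]; exact Ici_mem_nhds hr
    have : iteratedDerivWithin 5 f (Ici 0) r = iteratedDeriv 5 f r := by
      rw [iteratedDerivWithin, iteratedFDerivWithin_congr_set hs, ← iteratedDerivWithin,
        iteratedDerivWithin_univ]
    rw [this, iteratedDeriv_eq_iterate]
    rfl
  rw [ae_restrict_iff' measurableSet_Ioi]
  have hae : ∀ n : ℕ, ∀ᵐ r : ℝ, r ∈ uIcc (0 : ℝ) n →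
      HasDerivAt (fun x => ∫ s in (0 : ℝ)..x, g s) (g r) r := by
    intro n
    filter_upwards [(h.intervalIntegrable (Nat.cast_nonneg n)).ae_hasDerivAt_integral] with r hr hrn
    exact hr hrn 0 left_mem_uIcc
  filter_upwards [ae_all_iff.2 hae] with r hr hr0
  have hr0' : (0 : ℝ) < r := hr0
  obtain ⟨n, hn⟩ := exists_nat_ge r
  have hG := hr n (by rw [uIcc_of_le (Nat.cast_nonneg n)]; exact ⟨hr0'.le, hn⟩)
  have hnh := isOpen_Ioi.mem_nhds hr0
  have d5 : DifferentiableAt ℝ (deriv (deriv (deriv (deriv (deriv f))))) r :=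
    (hG.const_add (iteratedDerivWithin 5 f (Ici 0) 0)).differentiableAt.congr_of_eventuallyEq
      (e5.eventuallyEq_of_mem hnh)
  have hS1 : ContDiffOn ℝ (2 : ℕ) (deriv S) (Ioi 0) := hSc.deriv_halfLine (by norm_num)
  have dS : DifferentiableAt ℝ (deriv S) r :=
    (hS1.differentiableOn (by norm_num)).differentiableAt hnh
  exact (d5.add dS).congr_of_eventuallyEq (e4.eventuallyEq_of_mem hnh)

lemma IsW06.radialT_cube_add {l : ℕ} {f₁ g₁ f₂ g₂ : ℝ → ℂ} (h₁ : IsW06 f₁ g₁) (h₂ : IsW06 f₂ g₂) :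
    (radialT l)^[3] (f₁ + f₂) =ᵐ[halfLineMeasure] (radialT l)^[3] f₁ + (radialT l)^[3] f₂ := by
  have c₁ := h₁.contDiffOn_Ioi
  have c₂ := h₂.contDiffOn_Ioi
  have T₁ : ContDiffOn ℝ (3 : ℕ) (radialT l f₁) (Ioi 0) := c₁.radialT (by norm_num)
  have T₂ : ContDiffOn ℝ (3 : ℕ) (radialT l f₂) (Ioi 0) := c₂.radialT (by norm_num)
  have S₁ : ContDiffOn ℝ (1 : ℕ) (radialT l (radialT l f₁)) (Ioi 0) := T₁.radialT (by norm_num)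
  have S₂ : ContDiffOn ℝ (1 : ℕ) (radialT l (radialT l f₂)) (Ioi 0) := T₂.radialT (by norm_num)
  have a1 : EqOn (radialT l (f₁ + f₂)) (radialT l f₁ + radialT l f₂) (Ioi 0) :=
    radialT_add_eqOn (c₁.of_le (by norm_num)) (c₂.of_le (by norm_num))
  have a2 : EqOn (radialT l (radialT l (f₁ + f₂)))
      (radialT l (radialT l f₁) + radialT l (radialT l f₂)) (Ioi 0) :=
    (radialT_congr a1).trans
      (radialT_add_eqOn (T₁.of_le (by norm_num)) (T₂.of_le (by norm_num)))
  filter_upwards [h₁.ae_differentiableAt (l := l), h₂.ae_differentiableAt (l := l),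
    ae_restrict_mem measurableSet_Ioi] with r d₁ d₂ hr
  exact (radialT_congr a2 hr).trans
    (radialT_add_apply (S₁.of_le (by norm_num)) (S₂.of_le (by norm_num)) hr d₁ d₂)

lemma radialT_cube_smul (l : ℕ) (c : ℂ) (f : ℝ → ℂ) :
    (radialT l)^[3] (c • f) = c • (radialT l)^[3] f := by
  simp [radialT_smul]

lemma IsW06.add {f₁ g₁ f₂ g₂ : ℝ → ℂ} (h₁ : IsW06 f₁ g₁) (h₂ : IsW06 f₂ g₂) :
    IsW06 (f₁ + f₂) (g₁ + g₂) := by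
  have key : ∀ k : ℕ, k ≤ 5 → ∀ r : ℝ, 0 ≤ r → iteratedDerivWithin k (f₁ + f₂) (Ici 0) r =
      iteratedDerivWithin k f₁ (Ici 0) r + iteratedDerivWithin k f₂ (Ici 0) r := by
    intro k hk r hr
    have hk' : (k : WithTop ℕ∞) ≤ 5 := by exact_mod_cast hk
    exact iteratedDerivWithin_add hr (uniqueDiffOn_Ici 0)
      ((h₁.contDiffOn.of_le hk') r hr) ((h₂.contDiffOn.of_le hk') r hr)
  refine ⟨h₁.contDiffOn.add h₂.contDiffOn, h₁.memLp.add h₂.memLp,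
    h₁.memLp_sixth.add h₂.memLp_sixth, fun r hr => ?_, fun k hk => ?_⟩
  · rw [key 5 le_rfl r hr, key 5 le_rfl 0 le_rfl, h₁.fifth_eq r hr, h₂.fifth_eq r hr]
    simp only [Pi.add_apply]
    rw [intervalIntegral.integral_add (h₁.intervalIntegrable hr) (h₂.intervalIntegrable hr)]
    ring
  · rw [key k hk 0 le_rfl, h₁.boundary k hk, h₂.boundary k hk, add_zero]

lemma IsW06.smul (c : ℂ) {f g : ℝ → ℂ} (h : IsW06 f g) : IsW06 (c • f) (c • g) := by
  have key : ∀ k : ℕ, k ≤ 5 → ∀ r : ℝ, 0 ≤ r → iteratedDerivWithin k (c • f) (Ici 0) r =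
      c • iteratedDerivWithin k f (Ici 0) r := by
    intro k hk r hr
    have hk' : (k : WithTop ℕ∞) ≤ 5 := by exact_mod_cast hk
    exact iteratedDerivWithin_const_smul hr (uniqueDiffOn_Ici 0) c
      ((h.contDiffOn.of_le hk') r hr)
  refine ⟨h.contDiffOn.const_smul c, h.memLp.const_smul c, h.memLp_sixth.const_smul c,
    fun r hr => ?_, fun k hk => ?_⟩
  · rw [key 5 le_rfl r hr, key 5 le_rfl 0 le_rfl, h.fifth_eq r hr, smul_add]
    congr 1
    exact (intervalIntegral.integral_smul c g).symm
  · rw [key k hk 0 le_rfl, h.boundary k hk, smul_zero]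

lemma isW06_zero : IsW06 0 0 := by
  refine ⟨contDiffOn_const, MemLp.zero, MemLp.zero, fun r _ => ?_, fun k _ => ?_⟩ <;>
  · have : ∀ (k : ℕ) (x : ℝ), iteratedDerivWithin k (0 : ℝ → ℂ) (Ici 0) x = 0 := by
      intro k x
      simp
    simp [this]

/-- The graph of `T_l³` on `W_0^6`: pairs `(u, T_l³ u)` in `L²(0, ∞) × L²(0, ∞)`, where `T_l³ u` is
computed pointwise almost everywhere from the regular representative of `u`. -/
def radialCubeGraph (l : ℕ) : Submodule ℂ (HalfLineL2 × HalfLineL2) where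
  carrier := {p | ∃ f g : ℝ → ℂ, IsW06 f g ∧ ⇑p.1 =ᵐ[halfLineMeasure] f ∧
    ⇑p.2 =ᵐ[halfLineMeasure] (radialT l)^[3] f}
  zero_mem' := by
    refine ⟨0, 0, isW06_zero, Lp.coeFn_zero _ _ _, ?_⟩
    have h0 : (radialT l)^[3] (0 : ℝ → ℂ) = 0 := by
      have := radialT_cube_smul l 0 (0 : ℝ → ℂ)
      rwa [zero_smul, zero_smul] at this
    rw [h0]
    exact Lp.coeFn_zero _ _ _
  add_mem' := by
    rintro p q ⟨f₁, g₁, h₁, u₁, v₁⟩ ⟨f₂, g₂, h₂, u₂, v₂⟩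
    exact ⟨f₁ + f₂, g₁ + g₂, h₁.add h₂, (Lp.coeFn_add _ _).trans (u₁.add u₂),
      (Lp.coeFn_add _ _).trans ((v₁.add v₂).trans (h₁.radialT_cube_add h₂).symm)⟩
  smul_mem' := by
    rintro c p ⟨f, g, h, u, v⟩
    refine ⟨c • f, c • g, h.smul c, (Lp.coeFn_smul _ _).trans (u.const_smul c), ?_⟩
    rw [radialT_cube_smul]
    exact (Lp.coeFn_smul _ _).trans (v.const_smul c)

/-- The operator generated by `T_l³ = (-d²/dr² + l(l+1)/r²)³` on `W_0^6`, as an unbounded operator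
in `L²(0, ∞)`. -/
def radialCube (l : ℕ) : HalfLineL2 →ₗ.[ℂ] HalfLineL2 := (radialCubeGraph l).toLinearPMap

lemma radialCubeGraph_snd_eq_zero (l : ℕ) (p : HalfLineL2 × HalfLineL2)
    (hp : p ∈ radialCubeGraph l) (hp1 : p.1 = 0) : p.2 = 0 := by
  obtain ⟨f, g, h, hu, hv⟩ := hp
  rw [hp1] at hu
  have hf0 : f =ᵐ[volume.restrict (Ioi 0)] (0 : ℝ → ℂ) := hu.symm.trans (Lp.coeFn_zero _ _ _)
  have hf : EqOn f 0 (Ioi 0) :=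
    Measure.eqOn_open_of_ae_eq hf0 isOpen_Ioi h.contDiffOn_Ioi.continuousOn continuousOn_const
  have h0 : (radialT l)^[3] (0 : ℝ → ℂ) = 0 := by
    have := radialT_cube_smul l 0 (0 : ℝ → ℂ)
    rwa [zero_smul, zero_smul] at this
  apply Lp.ext
  refine hv.trans (EventuallyEq.trans ?_ (Lp.coeFn_zero _ _ _).symm)
  filter_upwards [ae_restrict_mem measurableSet_Ioi] with r hr
  rw [radialT_iterate_congr hf 3 hr, h0]

/-- The operator `radialCube l` has the graph it was built from. -/
lemma radialCube_graph (l : ℕ) : (radialCube l).graph = radialCubeGraph l :=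
  Submodule.toLinearPMap_graph_eq _ (radialCubeGraph_snd_eq_zero l)

/-! ### Kernels of adjoints and deficiency indices -/

/-- `ker (A + z)^*`, as a subspace of the whole space. -/
def adjointKernel {H : Type*} [NormedAddCommGroup H] [InnerProductSpace ℂ H] [CompleteSpace H]
    (A : H →ₗ.[ℂ] H) (z : ℂ) : Submodule ℂ H :=
  (((z • (LinearMap.id : H →ₗ[ℂ] H)) +ᵥ A)†).toFun.ker.map
    (((z • (LinearMap.id : H →ₗ[ℂ] H)) +ᵥ A)†).domain.subtype

/-- `A` has deficiency indices `(m, n)`: `dim ker (A + i)^* = m` and `dim ker (A - i)^* = n`. -/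
def HasDeficiencyIndices {H : Type*} [NormedAddCommGroup H] [InnerProductSpace ℂ H]
    [CompleteSpace H] (A : H →ₗ.[ℂ] H) (m n : ℕ) : Prop :=
  Module.rank ℂ (adjointKernel A Complex.I) = m ∧ Module.rank ℂ (adjointKernel A (-Complex.I)) = n

/-! ### The explicit solutions -/

/-- The differential operation `D_l w = r^(l+1) (r⁻¹ d/dr)^l (w / r)`. -/
def besselD (l : ℕ) (w : ℝ → ℂ) : ℝ → ℂ :=
  fun r => (r : ℂ) ^ (l + 1) *
    ((fun (h : ℝ → ℂ) (s : ℝ) => (s : ℂ)⁻¹ * deriv h s)^[l] (fun s : ℝ => w s / s)) r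

/-- The unimodular number `e^{iθ}`. -/
def phase (θ : ℝ) : ℂ := Complex.exp (θ * Complex.I)

/-- The function `q^1_{l±}`; `σ = 1` for the upper and `σ = -1` for the lower sign. -/
def qOne (l : ℕ) (σ ρ : ℝ) : ℝ → ℂ :=
  besselD l fun r =>
    Complex.exp (phase (-σ * (3 * Real.pi / 4)) * ρ * r)
    + phase (-σ * (2 * Real.pi / 3)) * Complex.exp (-phase (-σ * (Real.pi / 12)) * ρ * r)
    + phase (σ * (2 * Real.pi / 3)) * Complex.exp (-phase (-σ * (5 * Real.pi / 12)) * ρ * r)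

/-- The function `q^2_{l±}`; `σ = 1` for the upper and `σ = -1` for the lower sign. -/
def qTwo (l : ℕ) (σ ρ : ℝ) : ℝ → ℂ :=
  besselD l fun r =>
    phase (-σ * (5 * Real.pi / 6)) * Complex.exp (phase (-σ * (3 * Real.pi / 4)) * ρ * r)
    + (Real.sqrt 3 : ℂ) * Complex.exp (-phase (-σ * (Real.pi / 12)) * ρ * r)
    + phase (σ * (5 * Real.pi / 6)) * Complex.exp (-phase (-σ * (5 * Real.pi / 12)) * ρ * r)

end

open scoped ContDiff

/-! ### Absolutely continuous functions with values in a normed space -/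

/-! A vector `u` lies in the kernel of `(T_l³ + w)^*` exactly when it is orthogonal to `T_l³ f + w
f` for every `f` in `W_0^6`. Testing with smooth `f` supported in `(0, ∞)` makes `u` a weak solution
of `T_l³ u = -w̄ u`. The ladder relation `D_{l+1} = (d/dr - (l+1)/r) D_l` gives `T_l D_l e^{μr} =
-μ² D_l e^{μr}`, and the weak solutions are the combinations of the six functions `D_l e^{±μ_j r}`,
where `±μ_j` are the sixth roots of `w̄` (`exists_sum_besselExp_of_weak_solution`).

Square integrability then selects. At infinity the three growing exponentials must be absent, since
the six real parts are distinct and the dominant term cannot be compensated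
(`besselExp_coeff_eq_zero_of_memLp`). At the origin `D_l w = r^{-l} G_l w`, where `G_l` multiplies
the `n`-th Taylor coefficient of `w` by `∏_{k<l} (n - 2k - 1)`. Odd orders below `l` are annihilated
and even orders never are, so `D_l w` is square integrable near `0` exactly when the even Taylor
coefficients of `w` of order below `l` vanish (`exists_besselD_bound`, `moment_eq_zero_of_memLp`).
For `w = ∑ α_j e^{-μ_j r}` this reads `∑ α_j μ_j^n = 0` for even `n < l`: rows of a Vandermonde
system in the three distinct numbers `μ_j²`. There is one equation for `l = 1, 2`, two for `l = 3,
4` and at least three for `l ≥ 5`, which leaves dimensions 2, 1 and 0.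

Conversely, each such solution `q` is in the kernel, because Green's formula against `f` in `W_0^6`
has no boundary terms (`IsJet.green`). Since `f` vanishes to fifth order at `0`, repeated use of
Hardy's inequality puts every `r^{-(6-k)} f^{(k)}` in `L²`. Cutting `f` off by dilations of fixed
functions is then controlled by dominated convergence, and of `q` only `q, T_l³ q ∈ L²` is needed.
The same formula yields the symmetry of `T_l³`. -/

/-- The increments of the primitive of `f` are dominated by those of the primitive of `‖f‖`, so the
real-valued case suffices. -/
lemma AbsolutelyContinuousOnInterval.intervalIntegral_right {f : ℝ → ℂ} {a b : ℝ}
    (h : IntervalIntegrable f volume a b) :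
    AbsolutelyContinuousOnInterval (fun x => ∫ v in a..x, f v) a b := by
  have hn := h.norm.absolutelyContinuousOnInterval_intervalIntegral (c := a) left_mem_uIcc
  rw [absolutelyContinuousOnInterval_iff] at hn ⊢
  intro ε hε
  obtain ⟨δ, hδ, H⟩ := hn ε hε
  refine ⟨δ, hδ, fun E hE hlt => lt_of_le_of_lt (Finset.sum_le_sum fun i hi => ?_) (H E hE hlt)⟩
  have hm := hE.1 i (by simpa using hi)
  have key : ∀ x ∈ uIcc a b, IntervalIntegrable f volume a x := fun x hx =>
    h.mono_set (uIcc_subset_uIcc_left hx)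
  have h1 := key _ hm.1
  have h2 := key _ hm.2
  rw [dist_comm, dist_comm (∫ v in a..(E.2 i).1, ‖f v‖), dist_eq_norm, dist_eq_norm,
    intervalIntegral.integral_interval_sub_left h2 h1,
    intervalIntegral.integral_interval_sub_left h2.norm h1.norm, Real.norm_eq_abs]
  exact intervalIntegral.norm_integral_le_abs_integral_norm

/-- The difference of `f` and the primitive of `f'` is absolutely continuous with derivative zero
almost everywhere, hence constant. -/
lemma AbsolutelyContinuousOnInterval.integral_eq_sub_of_ae_hasDerivAt {f f' : ℝ → ℂ} {a b : ℝ}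
    (hf : AbsolutelyContinuousOnInterval f a b)
    (hd : ∀ᵐ x, x ∈ uIcc a b → HasDerivAt f (f' x) x) (hi : IntervalIntegrable f' volume a b) :
    ∫ x in a..b, f' x = f b - f a := by
  have hg := hf.sub (AbsolutelyContinuousOnInterval.intervalIntegral_right hi)
  have hz : ∀ᵐ x, x ∈ uIcc a b → HasDerivAt (f - fun x => ∫ v in a..x, f' v) 0 x := by
    filter_upwards [hd, hi.ae_hasDerivAt_integral] with x h1 h2 hx
    simpa using (h1 hx).sub (h2 hx a left_mem_uIcc)
  obtain ⟨C, hC⟩ := hg.const_of_ae_hasDerivAt_zero hz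
  have h1 := hC a left_mem_uIcc
  have h2 := hC b right_mem_uIcc
  simp only [Pi.sub_apply, intervalIntegral.integral_same, sub_zero] at h1 h2
  rw [h1, ← h2]
  ring

lemma AbsolutelyContinuousOnInterval.congr {f g : ℝ → ℂ} {a b : ℝ}
    (hf : AbsolutelyContinuousOnInterval f a b) (h : EqOn f g (uIcc a b)) :
    AbsolutelyContinuousOnInterval g a b := by
  rw [absolutelyContinuousOnInterval_iff] at hf ⊢
  intro ε hε
  obtain ⟨δ, hδ, H⟩ := hf ε hε
  refine ⟨δ, hδ, fun E hE hlt => ?_⟩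
  convert! H E hE hlt using 1
  refine Finset.sum_congr rfl fun i hi => ?_
  have hm := hE.1 i (by simpa using hi)
  rw [h hm.1, h hm.2]

lemma AbsolutelyContinuousOnInterval.of_hasDerivAt {f f' : ℝ → ℂ} {a b : ℝ}
    (hd : ∀ x ∈ uIcc a b, HasDerivAt f (f' x) x) (hc : ContinuousOn f' (uIcc a b)) :
    AbsolutelyContinuousOnInterval f a b := by
  have hi : IntervalIntegrable f' volume a b := hc.intervalIntegrable
  have h1 : AbsolutelyContinuousOnInterval (fun _ => f a : ℝ → ℂ) a b :=
    (contDiff_const.contDiffOn).absolutelyContinuousOnInterval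
  refine (h1.add (AbsolutelyContinuousOnInterval.intervalIntegral_right hi)).congr fun x hx => ?_
  have hs : uIcc a x ⊆ uIcc a b := uIcc_subset_uIcc_left hx
  simp only [Pi.add_apply]
  rw [intervalIntegral.integral_eq_sub_of_hasDerivAt (fun y hy => hd y (hs hy))
    (hi.mono_set hs)]
  ring

/-! ### Hardy's inequality -/

lemma lintegral_Ioc_rpow_neg_half {r : ℝ} (hr : 0 < r) :
    ∫⁻ s in Ioc 0 r, ENNReal.ofReal (s ^ (-(1 / 2) : ℝ)) = ENNReal.ofReal (2 * r ^ (1 / 2 : ℝ)) := by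
  rw [← ofReal_integral_eq_lintegral_ofReal]
  · rw [← intervalIntegral.integral_of_le hr.le, integral_rpow (Or.inl (by norm_num))]
    congr 1
    norm_num
    ring
  · have := intervalIntegral.intervalIntegrable_rpow' (a := 0) (b := r) (r := -(1 / 2))
      (by norm_num)
    rwa [intervalIntegrable_iff_integrableOn_Ioc_of_le hr.le] at this
  · filter_upwards [ae_restrict_mem measurableSet_Ioc] with s hs
    exact Real.rpow_nonneg hs.1.le _

lemma lintegral_Ioi_rpow_neg_three_half {s : ℝ} (hs : 0 < s) :
    ∫⁻ r in Ioi s, ENNReal.ofReal (r ^ (-(3 / 2) : ℝ)) =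
      ENNReal.ofReal (2 * s ^ (-(1 / 2) : ℝ)) := by
  rw [← ofReal_integral_eq_lintegral_ofReal]
  · rw [integral_Ioi_rpow_of_lt (by norm_num) hs]
    congr 1
    norm_num
    ring
  · exact integrableOn_Ioi_rpow_of_lt (by norm_num) hs
  · filter_upwards [ae_restrict_mem measurableSet_Ioi] with r hr
    exact Real.rpow_nonneg (hs.le.trans (le_of_lt hr)) _

/-- Cauchy–Schwarz step in Hardy's inequality. -/
lemma sq_lintegral_Ioc_le {k : ℝ → ENNReal} (hk : Measurable k) {r : ℝ} (hr : 0 < r) :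
    (∫⁻ s in Ioc 0 r, k s) ^ 2 ≤ ENNReal.ofReal (2 * r ^ (1 / 2 : ℝ)) *
      ∫⁻ s in Ioc 0 r, k s ^ 2 * ENNReal.ofReal (s ^ (1 / 2 : ℝ)) := by
  -- Split `k = s^{-1/4} · (s^{1/4} k)`. The exponent `1/4` is the Schur weight that yields the
  -- constant 4 in Hardy's inequality.
  have h := ENNReal.lintegral_mul_le_Lp_mul_Lq (volume.restrict (Ioc 0 r))
    (Real.HolderConjugate.two_two) (f := fun s => ENNReal.ofReal (s ^ (-(1 / 4) : ℝ)))
    (g := fun s => k s * ENNReal.ofReal (s ^ (1 / 4 : ℝ))) (by fun_prop) (by fun_prop)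
  have e0 : ∫⁻ s in Ioc 0 r, ((fun s => ENNReal.ofReal (s ^ (-(1 / 4) : ℝ))) *
      (fun s => k s * ENNReal.ofReal (s ^ (1 / 4 : ℝ)))) s = ∫⁻ s in Ioc 0 r, k s := by
    refine setLIntegral_congr_fun measurableSet_Ioc fun s hs => ?_
    have hs0 : 0 < s := hs.1
    simp only [Pi.mul_apply]
    rw [mul_left_comm, ← ENNReal.ofReal_mul (by positivity), ← Real.rpow_add hs0]
    norm_num
  have e1 : ∫⁻ s in Ioc 0 r, ENNReal.ofReal (s ^ (-(1 / 4) : ℝ)) ^ (2 : ℝ) =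
      ENNReal.ofReal (2 * r ^ (1 / 2 : ℝ)) := by
    rw [← lintegral_Ioc_rpow_neg_half hr]
    refine setLIntegral_congr_fun measurableSet_Ioc fun s hs => ?_
    have hs0 : 0 < s := hs.1
    rw [ENNReal.ofReal_rpow_of_pos (by positivity), ← Real.rpow_mul hs0.le]
    norm_num
  have e2 : ∫⁻ s in Ioc 0 r, (k s * ENNReal.ofReal (s ^ (1 / 4 : ℝ))) ^ (2 : ℝ) =
      ∫⁻ s in Ioc 0 r, k s ^ 2 * ENNReal.ofReal (s ^ (1 / 2 : ℝ)) := by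
    refine setLIntegral_congr_fun measurableSet_Ioc fun s hs => ?_
    have hs0 : 0 < s := hs.1
    rw [ENNReal.mul_rpow_of_nonneg _ _ (by norm_num), ENNReal.ofReal_rpow_of_pos (by positivity),
      ← Real.rpow_mul hs0.le]
    norm_num
  rw [e0, e1, e2] at h
  calc (∫⁻ s in Ioc 0 r, k s) ^ 2 ≤ _ := pow_le_pow_left' h 2
    _ = _ := by
      rw [mul_pow, ← ENNReal.rpow_natCast, ← ENNReal.rpow_natCast, ← ENNReal.rpow_mul,
        ← ENNReal.rpow_mul]
      norm_num

/-- **Hardy's inequality** in `L²(0, ∞)`. -/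
lemma lintegral_hardy {k : ℝ → ENNReal} (hk : Measurable k) :
    ∫⁻ r in Ioi 0, (ENNReal.ofReal r⁻¹ * ∫⁻ s in Ioc 0 r, k s) ^ 2 ≤
      4 * ∫⁻ s in Ioi 0, k s ^ 2 := by
  set w : ℝ → ENNReal := fun s => k s ^ 2 * ENNReal.ofReal (s ^ (1 / 2 : ℝ)) with hw
  have hwm : Measurable w := by fun_prop
  -- Here `r^{-2} · 2 r^{1/2} = 2 r^{-3/2}`. The indicator of `s ≤ r` turns the inner integral into
  -- one over a fixed set, ready for Tonelli.
  have step1 : ∀ r ∈ Ioi (0 : ℝ), (ENNReal.ofReal r⁻¹ * ∫⁻ s in Ioc 0 r, k s) ^ 2 ≤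
      ∫⁻ s in Ioi 0, (2 * ENNReal.ofReal (r ^ (-(3 / 2) : ℝ))) * ((Ici s).indicator 1 r * w s) := by
    intro r hr
    have hr0 : 0 < r := hr
    have e : ∫⁻ s in Ioi 0, (Ici s).indicator 1 r * w s = ∫⁻ s in Ioc 0 r, w s := by
      rw [← Ioi_inter_Iic, inter_comm, ← Measure.restrict_restrict measurableSet_Iic,
        ← lintegral_indicator measurableSet_Iic]
      refine lintegral_congr fun s => ?_
      by_cases h : s ≤ r <;> simp [indicator, h]
    rw [lintegral_const_mul, e, mul_pow]
    · refine (mul_le_mul_right (sq_lintegral_Ioc_le hk hr0) _).trans (le_of_eq ?_)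
      rw [← mul_assoc, ← ENNReal.ofReal_pow (by positivity), ← ENNReal.ofReal_mul (by positivity)]
      congr 1
      rw [show (2 : ENNReal) = ENNReal.ofReal 2 by norm_num, ← ENNReal.ofReal_mul (by norm_num)]
      congr 1
      have : (r⁻¹) ^ 2 = r ^ (-2 : ℝ) := by
        rw [Real.rpow_neg hr0.le, inv_pow]
        norm_num
      rw [this, mul_left_comm, ← Real.rpow_add hr0]
      norm_num
    · refine Measurable.mul ?_ hwm
      have : (fun s => (Ici s).indicator (1 : ℝ → ENNReal) r) = (Iic r).indicator 1 := by
        funext s; simp [indicator]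
      rw [this]
      exact measurable_one.indicator measurableSet_Iic
  calc ∫⁻ r in Ioi 0, (ENNReal.ofReal r⁻¹ * ∫⁻ s in Ioc 0 r, k s) ^ 2
      ≤ ∫⁻ r in Ioi (0 : ℝ), ∫⁻ s in Ioi 0,
        (2 * ENNReal.ofReal (r ^ (-(3 / 2) : ℝ))) * ((Ici s).indicator 1 r * w s) :=
        setLIntegral_mono' measurableSet_Ioi step1
    _ = ∫⁻ s in Ioi (0 : ℝ), ∫⁻ r in Ioi (0 : ℝ),
        (2 * ENNReal.ofReal (r ^ (-(3 / 2) : ℝ))) * ((Ici s).indicator 1 r * w s) := by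
        refine lintegral_lintegral_swap (Measurable.aemeasurable ?_)
        refine Measurable.mul (by fun_prop) (Measurable.mul ?_ (by fun_prop))
        have : (fun p : ℝ × ℝ => (Ici p.2).indicator (1 : ℝ → ENNReal) p.1) =
            {p : ℝ × ℝ | p.2 ≤ p.1}.indicator 1 := by
          funext s; simp [indicator]
        change Measurable (fun p : ℝ × ℝ => (Ici p.2).indicator (1 : ℝ → ENNReal) p.1)
        rw [this]
        exact measurable_one.indicator (measurableSet_le measurable_snd measurable_fst)
    -- Integrating `2 r^{-3/2}` over `r > s` gives `4 s^{-1/2}`, which cancels the weight `s^{1/2}`.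
    _ = ∫⁻ s in Ioi (0 : ℝ), 4 * k s ^ 2 := by
        refine setLIntegral_congr_fun measurableSet_Ioi fun s hs => ?_
        have hs0 : 0 < s := hs
        have e1 : ∀ r, (2 * ENNReal.ofReal (r ^ (-(3 / 2) : ℝ))) * ((Ici s).indicator 1 r * w s) =
            2 * w s * (Ici s).indicator (fun r => ENNReal.ofReal (r ^ (-(3 / 2) : ℝ))) r := by
          intro r
          by_cases h : s ≤ r
          · simp [indicator, h]; ring
          · simp [indicator, h]
        simp only [e1]
        rw [lintegral_const_mul _ (Measurable.indicator (by fun_prop) measurableSet_Ici),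
          lintegral_indicator measurableSet_Ici, Measure.restrict_restrict measurableSet_Ici,
          inter_eq_left.2 (show Ici s ⊆ Ioi 0 from fun r hr => lt_of_lt_of_le hs0 hr), setLIntegral_congr Ioi_ae_eq_Ici.symm,
          lintegral_Ioi_rpow_neg_three_half hs0, hw]
        simp only
        rw [show (2 : ENNReal) * (k s ^ 2 * ENNReal.ofReal (s ^ (1 / 2 : ℝ))) *
          ENNReal.ofReal (2 * s ^ (-(1 / 2) : ℝ)) = 2 * k s ^ 2 * (ENNReal.ofReal (s ^ (1 / 2 : ℝ)) *
          ENNReal.ofReal (2 * s ^ (-(1 / 2) : ℝ))) by ring, ← ENNReal.ofReal_mul (by positivity),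
          mul_left_comm, ← Real.rpow_add hs0]
        norm_num
        ring
    _ = 4 * ∫⁻ s in Ioi 0, k s ^ 2 := lintegral_const_mul _ (by fun_prop)


lemma MemLp.hardy {k F : ℝ → ℂ} (hk : MemLp k 2 halfLineMeasure)
    (hF : AEStronglyMeasurable F halfLineMeasure)
    (h : ∀ r : ℝ, 0 < r → ‖F r‖ₑ ≤ ENNReal.ofReal r⁻¹ * ∫⁻ s in Ioc 0 r, ‖k s‖ₑ) :
    MemLp F 2 halfLineMeasure := by
  refine ⟨hF, ?_⟩
  have hk2 := hk.eLpNorm_lt_top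
  rw [eLpNorm_lt_top_iff_lintegral_rpow_enorm_lt_top (by norm_num) (by norm_num)] at hk2 ⊢
  simp only [ENNReal.toReal_ofNat, ENNReal.rpow_ofNat] at hk2 ⊢
  -- `lintegral_hardy` needs genuine measurability, hence the passage to a measurable
  -- representative.
  set k' := hk.1.mk k
  have hk' : k =ᵐ[halfLineMeasure] k' := hk.1.ae_eq_mk
  have hm : Measurable fun s => ‖k' s‖ₑ := hk.1.stronglyMeasurable_mk.measurable.enorm
  have e1 : ∫⁻ s in Ioi 0, ‖k' s‖ₑ ^ 2 = ∫⁻ s in Ioi 0, ‖k s‖ₑ ^ 2 :=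
    lintegral_congr_ae (hk'.mono fun s hs => by simp only [hs])
  refine lt_of_le_of_lt ?_ (ENNReal.mul_lt_top (a := 4) (by norm_num) hk2)
  rw [← e1]
  refine le_trans (setLIntegral_mono' measurableSet_Ioi fun r hr => ?_) (lintegral_hardy hm)
  refine pow_le_pow_left' ((h r hr).trans (le_of_eq ?_)) 2
  congr 1
  refine lintegral_congr_ae ?_
  filter_upwards [ae_mono (Measure.restrict_mono Ioc_subset_Ioi_self le_rfl) hk'] with s hs
  rw [hs]

/-! ### Jets of locally `W^6` functions on the half-line -/

/-- `F j` is the `j`-th derivative of `F 0` on `(0, ∞)` for `j ≤ 5`; `F 5` is locally absolutely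
continuous with almost everywhere derivative `F 6`. -/
structure IsJet (F : ℕ → ℝ → ℂ) : Prop where
  hasDerivAt : ∀ j < 5, ∀ r : ℝ, 0 < r → HasDerivAt (F j) (F (j + 1) r) r
  ac : ∀ a b : ℝ, 0 < a → a ≤ b → AbsolutelyContinuousOnInterval (F 5) a b
  ae_hasDerivAt : ∀ᵐ r ∂halfLineMeasure, HasDerivAt (F 5) (F 6 r) r
  integrable : ∀ a b : ℝ, 0 < a → a ≤ b → IntervalIntegrable (F 6) volume a b

lemma uIcc_subset_Ioi {a b : ℝ} (ha : 0 < a) (hab : a ≤ b) : uIcc a b ⊆ Ioi 0 := by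
  rw [uIcc_of_le hab]
  exact fun x hx => lt_of_lt_of_le ha hx.1

lemma IsJet.continuousOn {F : ℕ → ℝ → ℂ} (h : IsJet F) {j : ℕ} (hj : j ≤ 5) :
    ContinuousOn (F j) (Ioi 0) := by
  rcases hj.lt_or_eq with hj | rfl
  · exact fun r hr => (h.hasDerivAt j hj r hr).continuousAt.continuousWithinAt
  · intro r hr
    have hr0 : (0 : ℝ) < r := hr
    have h1 := (h.ac (r / 2) (2 * r) (by linarith) (by linarith)).continuousOn
    refine (h1.continuousAt ?_).continuousWithinAt
    rw [uIcc_of_le (by linarith)]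
    exact Icc_mem_nhds (by linarith) (by linarith)

lemma IsJet.ac_of_le {F : ℕ → ℝ → ℂ} (h : IsJet F) {j : ℕ} (hj : j ≤ 5) {a b : ℝ} (ha : 0 < a)
    (hab : a ≤ b) : AbsolutelyContinuousOnInterval (F j) a b := by
  rcases hj.lt_or_eq with hj | rfl
  · exact AbsolutelyContinuousOnInterval.of_hasDerivAt
      (fun x hx => h.hasDerivAt j hj x (uIcc_subset_Ioi ha hab hx))
      ((h.continuousOn hj).mono (uIcc_subset_Ioi ha hab))
  · exact h.ac a b ha hab

lemma IsJet.aestronglyMeasurable {F : ℕ → ℝ → ℂ} (h : IsJet F) {j : ℕ} (hj : j ≤ 5) :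
    AEStronglyMeasurable (F j) halfLineMeasure :=
  (h.continuousOn hj).aestronglyMeasurable measurableSet_Ioi

lemma hasDerivAt_ofReal_inv_pow (n : ℕ) {r : ℝ} (hr : 0 < r) :
    HasDerivAt (fun s : ℝ => ((s : ℂ)⁻¹) ^ n) (-(n : ℂ) * ((r : ℂ)⁻¹) ^ (n + 1)) r := by
  have hr' : (r : ℂ) ≠ 0 := by exact_mod_cast hr.ne'
  have h1 : HasDerivAt (fun s : ℝ => (s : ℂ)⁻¹) (-((r : ℂ) ^ 2)⁻¹) r :=
    (hasDerivAt_inv hr').comp_ofReal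
  convert! h1.pow n using 1
  rcases n with _ | n
  · simp
  · push_cast
    simp only [inv_pow]
    field_simp
    ring

lemma continuousOn_ofReal_inv_pow (n : ℕ) : ContinuousOn (fun s : ℝ => ((s : ℂ)⁻¹) ^ n) (Ioi 0) :=
  fun _ hr => (hasDerivAt_ofReal_inv_pow n hr).continuousAt.continuousWithinAt

lemma ac_ofReal_inv_pow (n : ℕ) {a b : ℝ} (ha : 0 < a) (hab : a ≤ b) :
    AbsolutelyContinuousOnInterval (fun s : ℝ => ((s : ℂ)⁻¹) ^ n) a b :=
  AbsolutelyContinuousOnInterval.of_hasDerivAt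
    (fun _ hx => hasDerivAt_ofReal_inv_pow n (uIcc_subset_Ioi ha hab hx))
    ((continuousOn_const.mul (continuousOn_ofReal_inv_pow (n + 1))).mono (uIcc_subset_Ioi ha hab))

lemma AbsolutelyContinuousOnInterval.mul_complex {f g : ℝ → ℂ} {a b : ℝ}
    (hf : AbsolutelyContinuousOnInterval f a b) (hg : AbsolutelyContinuousOnInterval g a b) :
    AbsolutelyContinuousOnInterval (fun r => f r * g r) a b :=
  hf.smul hg

lemma AbsolutelyContinuousOnInterval.sum_complex {ι : Type*} (s : Finset ι) {f : ι → ℝ → ℂ}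
    {a b : ℝ} (hf : ∀ i ∈ s, AbsolutelyContinuousOnInterval (f i) a b) :
    AbsolutelyContinuousOnInterval (fun r => ∑ i ∈ s, f i r) a b := by
  classical
  induction s using Finset.induction_on with
  | empty =>
    simp only [Finset.sum_empty]
    exact (contDiff_const.contDiffOn).absolutelyContinuousOnInterval
  | insert i s hi ih =>
    simp only [Finset.sum_insert hi]
    exact (hf i (Finset.mem_insert_self i s)).add
      (ih fun j hj => hf j (Finset.mem_insert_of_mem hj))

/-! ### Explicit formulas for the powers of `T_l`, and Green's formula on compact intervals -/

/-- The coupling constant `l (l + 1)`. -/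
def coupling (l : ℕ) : ℂ := (l : ℂ) * (l + 1)

/-- `T_l` on jets. -/
noncomputable def jetT (l : ℕ) (F : ℕ → ℝ → ℂ) (r : ℝ) : ℂ :=
  -F 2 r + coupling l * ((r : ℂ)⁻¹ ^ 2 * F 0 r)

/-- The derivative of `T_l` on jets. -/
noncomputable def jetT' (l : ℕ) (F : ℕ → ℝ → ℂ) (r : ℝ) : ℂ :=
  -F 3 r + coupling l * ((r : ℂ)⁻¹ ^ 2 * F 1 r) + -2 * coupling l * ((r : ℂ)⁻¹ ^ 3 * F 0 r)

/-- `T_l²` on jets. -/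
noncomputable def jetTT (l : ℕ) (F : ℕ → ℝ → ℂ) (r : ℝ) : ℂ :=
  F 4 r + -2 * coupling l * ((r : ℂ)⁻¹ ^ 2 * F 2 r) + 4 * coupling l * ((r : ℂ)⁻¹ ^ 3 * F 1 r) +
    (coupling l ^ 2 - 6 * coupling l) * ((r : ℂ)⁻¹ ^ 4 * F 0 r)

/-- The derivative of `T_l²` on jets. -/
noncomputable def jetTT' (l : ℕ) (F : ℕ → ℝ → ℂ) (r : ℝ) : ℂ :=
  F 5 r + -2 * coupling l * ((r : ℂ)⁻¹ ^ 2 * F 3 r) + 8 * coupling l * ((r : ℂ)⁻¹ ^ 3 * F 2 r) +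
    (coupling l ^ 2 - 18 * coupling l) * ((r : ℂ)⁻¹ ^ 4 * F 1 r) +
    (-4 * (coupling l ^ 2 - 6 * coupling l)) * ((r : ℂ)⁻¹ ^ 5 * F 0 r)

/-- `T_l³` on jets. -/
noncomputable def jetTTT (l : ℕ) (F : ℕ → ℝ → ℂ) (r : ℝ) : ℂ :=
  -F 6 r + 3 * coupling l * ((r : ℂ)⁻¹ ^ 2 * F 4 r) + -12 * coupling l * ((r : ℂ)⁻¹ ^ 3 * F 3 r) +
    (42 * coupling l - 3 * coupling l ^ 2) * ((r : ℂ)⁻¹ ^ 4 * F 2 r) +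
    (12 * coupling l ^ 2 - 96 * coupling l) * ((r : ℂ)⁻¹ ^ 5 * F 1 r) +
    (coupling l ^ 3 - 26 * coupling l ^ 2 + 120 * coupling l) * ((r : ℂ)⁻¹ ^ 6 * F 0 r)

section
variable {F G : ℕ → ℝ → ℂ} (l : ℕ)

lemma HasDerivAt.inv_pow_mul_jet {j n : ℕ} {r : ℝ} (hr : 0 < r)
    (h : HasDerivAt (F j) (F (j + 1) r) r) (a : ℂ) :
    HasDerivAt (fun r : ℝ => a * ((r : ℂ)⁻¹ ^ n * F j r))
      (a * (-(n : ℂ) * ((r : ℂ)⁻¹) ^ (n + 1) * F j r + (r : ℂ)⁻¹ ^ n * F (j + 1) r)) r :=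
  ((hasDerivAt_ofReal_inv_pow n hr).mul h).const_mul a

lemma IsJet.hasDerivAt_jetT (h : IsJet F) {r : ℝ} (hr : 0 < r) :
    HasDerivAt (jetT l F) (jetT' l F r) r := by
  have h0 := (h.hasDerivAt 2 (by norm_num) r hr).neg.add
    (HasDerivAt.inv_pow_mul_jet (n := 2) hr (h.hasDerivAt 0 (by norm_num) r hr) (coupling l))
  convert! h0 using 1
  simp only [jetT']
  push_cast
  ring

/-- The derivative is written as `-T(Tu) + l(l+1) r^{-2} Tu`, the definition of `T_l` solved for the
second derivative. This validates the explicit coefficients of `jetTT` and is the form in which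
Green's formula telescopes. -/
lemma IsJet.hasDerivAt_jetT' (h : IsJet F) {r : ℝ} (hr : 0 < r) :
    HasDerivAt (jetT' l F) (-jetTT l F r + coupling l * ((r : ℂ)⁻¹ ^ 2 * jetT l F r)) r := by
  have h0 := ((h.hasDerivAt 3 (by norm_num) r hr).neg.add
    (HasDerivAt.inv_pow_mul_jet (n := 2) hr (h.hasDerivAt 1 (by norm_num) r hr) (coupling l))).add
    (HasDerivAt.inv_pow_mul_jet (n := 3) hr (h.hasDerivAt 0 (by norm_num) r hr) (-2 * coupling l))
  convert! h0 using 1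
  simp only [jetTT, jetT]
  push_cast
  ring

lemma IsJet.hasDerivAt_jetTT (h : IsJet F) {r : ℝ} (hr : 0 < r) :
    HasDerivAt (jetTT l F) (jetTT' l F r) r := by
  have h0 := (((h.hasDerivAt 4 (by norm_num) r hr).add
    (HasDerivAt.inv_pow_mul_jet (n := 2) hr (h.hasDerivAt 2 (by norm_num) r hr)
      (-2 * coupling l))).add
    (HasDerivAt.inv_pow_mul_jet (n := 3) hr (h.hasDerivAt 1 (by norm_num) r hr)
      (4 * coupling l))).add
    (HasDerivAt.inv_pow_mul_jet (n := 4) hr (h.hasDerivAt 0 (by norm_num) r hr)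
      (coupling l ^ 2 - 6 * coupling l))
  convert! h0 using 1
  simp only [jetTT']
  push_cast
  ring

lemma IsJet.hasDerivAt_jetTT' (h : IsJet F) {r : ℝ} (hr : 0 < r)
    (h5 : HasDerivAt (F 5) (F 6 r) r) :
    HasDerivAt (jetTT' l F) (-jetTTT l F r + coupling l * ((r : ℂ)⁻¹ ^ 2 * jetTT l F r)) r := by
  have h0 := (((h5.add
    (HasDerivAt.inv_pow_mul_jet (n := 2) hr (h.hasDerivAt 3 (by norm_num) r hr)
      (-2 * coupling l))).add
    (HasDerivAt.inv_pow_mul_jet (n := 3) hr (h.hasDerivAt 2 (by norm_num) r hr)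
      (8 * coupling l))).add
    (HasDerivAt.inv_pow_mul_jet (n := 4) hr (h.hasDerivAt 1 (by norm_num) r hr)
      (coupling l ^ 2 - 18 * coupling l))).add
    (HasDerivAt.inv_pow_mul_jet (n := 5) hr (h.hasDerivAt 0 (by norm_num) r hr)
      (-4 * (coupling l ^ 2 - 6 * coupling l)))
  convert! h0 using 1
  simp only [jetTTT, jetTT]
  push_cast
  ring

/-- Only one point of differentiability of `u'` is required, so the lemma also serves at the almost
every point where the sixth derivative exists. -/
lemma radialT_apply_of_hasDerivAt {u u' : ℝ → ℂ} {w : ℂ} {r : ℝ} (hr : 0 < r)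
    (h1 : ∀ s : ℝ, 0 < s → HasDerivAt u (u' s) s)
    (h2 : HasDerivAt u' (-w + coupling l * ((r : ℂ)⁻¹ ^ 2 * u r)) r) : radialT l u r = w := by
  have e : deriv u =ᶠ[𝓝 r] u' := by
    filter_upwards [isOpen_Ioi.mem_nhds hr] with s hs using (h1 s hs).deriv
  simp only [radialT, e.deriv_eq, h2.deriv, coupling]
  field_simp
  ring

lemma IsJet.radialT_eqOn (h : IsJet F) : EqOn (radialT l (F 0)) (jetT l F) (Ioi 0) := by
  intro r hr
  refine radialT_apply_of_hasDerivAt l hr (fun s hs => h.hasDerivAt 0 (by norm_num) s hs) ?_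
  convert! h.hasDerivAt 1 (by norm_num) r hr using 1
  simp only [jetT]
  ring

lemma IsJet.radialT_radialT_eqOn (h : IsJet F) :
    EqOn (radialT l (radialT l (F 0))) (jetTT l F) (Ioi 0) := by
  refine (radialT_congr (h.radialT_eqOn l)).trans fun r hr => ?_
  exact radialT_apply_of_hasDerivAt l hr (fun s hs => h.hasDerivAt_jetT l hs)
    (h.hasDerivAt_jetT' l hr)

lemma IsJet.radialT_cube (h : IsJet F) :
    (radialT l)^[3] (F 0) =ᵐ[halfLineMeasure] jetTTT l F := by
  filter_upwards [h.ae_hasDerivAt, ae_restrict_mem measurableSet_Ioi] with r h5 hr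
  refine (radialT_congr (h.radialT_radialT_eqOn l) hr).trans ?_
  exact radialT_apply_of_hasDerivAt l hr (fun s hs => h.hasDerivAt_jetTT l hs)
    (h.hasDerivAt_jetTT' l hr h5)

lemma IsJet.continuousOn_inv_pow_mul (h : IsJet F) {j : ℕ} (hj : j ≤ 5) (a : ℂ) (n : ℕ) :
    ContinuousOn (fun r : ℝ => a * ((r : ℂ)⁻¹ ^ n * F j r)) (Ioi 0) :=
  continuousOn_const.mul ((continuousOn_ofReal_inv_pow n).mul (h.continuousOn hj))

lemma IsJet.ac_inv_pow_mul (h : IsJet F) {j : ℕ} (hj : j ≤ 5) (c : ℂ) (n : ℕ) {a b : ℝ}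
    (ha : 0 < a) (hab : a ≤ b) :
    AbsolutelyContinuousOnInterval (fun r : ℝ => c * ((r : ℂ)⁻¹ ^ n * F j r)) a b :=
  ((ac_ofReal_inv_pow n ha hab).mul_complex (h.ac_of_le hj ha hab)).const_smul c

lemma IsJet.ac_jetT (h : IsJet F) {a b : ℝ} (ha : 0 < a) (hab : a ≤ b) :
    AbsolutelyContinuousOnInterval (jetT l F) a b :=
  (h.ac_of_le (j := 2) (by norm_num) ha hab).neg.add
    (h.ac_inv_pow_mul (by norm_num) _ 2 ha hab)

lemma IsJet.ac_jetT' (h : IsJet F) {a b : ℝ} (ha : 0 < a) (hab : a ≤ b) :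
    AbsolutelyContinuousOnInterval (jetT' l F) a b :=
  ((h.ac_of_le (j := 3) (by norm_num) ha hab).neg.add
    (h.ac_inv_pow_mul (by norm_num) _ 2 ha hab)).add (h.ac_inv_pow_mul (by norm_num) _ 3 ha hab)

lemma IsJet.ac_jetTT (h : IsJet F) {a b : ℝ} (ha : 0 < a) (hab : a ≤ b) :
    AbsolutelyContinuousOnInterval (jetTT l F) a b :=
  (((h.ac_of_le (j := 4) (by norm_num) ha hab).add
    (h.ac_inv_pow_mul (by norm_num) _ 2 ha hab)).add
    (h.ac_inv_pow_mul (by norm_num) _ 3 ha hab)).add (h.ac_inv_pow_mul (by norm_num) _ 4 ha hab)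

lemma IsJet.ac_jetTT' (h : IsJet F) {a b : ℝ} (ha : 0 < a) (hab : a ≤ b) :
    AbsolutelyContinuousOnInterval (jetTT' l F) a b :=
  ((((h.ac_of_le (j := 5) (by norm_num) ha hab).add
    (h.ac_inv_pow_mul (by norm_num) _ 2 ha hab)).add
    (h.ac_inv_pow_mul (by norm_num) _ 3 ha hab)).add
    (h.ac_inv_pow_mul (by norm_num) _ 4 ha hab)).add (h.ac_inv_pow_mul (by norm_num) _ 5 ha hab)

lemma IsJet.intervalIntegrable_jetTTT (h : IsJet F) {a b : ℝ} (ha : 0 < a) (hab : a ≤ b) :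
    IntervalIntegrable (jetTTT l F) volume a b := by
  have key : ∀ (j : ℕ), j ≤ 5 → ∀ (c : ℂ) (n : ℕ),
      IntervalIntegrable (fun r : ℝ => c * ((r : ℂ)⁻¹ ^ n * F j r)) volume a b := fun j hj c n =>
    ((h.continuousOn_inv_pow_mul hj c n).mono (uIcc_subset_Ioi ha hab)).intervalIntegrable
  exact (((((h.integrable a b ha hab).neg.add (key 4 (by norm_num) _ 2)).add
    (key 3 (by norm_num) _ 3)).add (key 2 (by norm_num) _ 4)).add (key 1 (by norm_num) _ 5)).add
    (key 0 (by norm_num) _ 6)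

/-- Green's formula for `T_l³` when the first factor vanishes to fifth order at the end points. -/
lemma IsJet.green_interval (hF : IsJet F) (hG : IsJet G) {a b : ℝ} (ha : 0 < a) (hab : a ≤ b)
    (hFa : ∀ j ≤ 5, F j a = 0) (hFb : ∀ j ≤ 5, F j b = 0) :
    ∫ r in a..b, jetTTT l F r * G 0 r = ∫ r in a..b, F 0 r * jetTTT l G r := by
  have hs := uIcc_subset_Ioi ha hab
  have i1 : IntervalIntegrable (fun r => jetTTT l F r * G 0 r) volume a b :=
    (hF.intervalIntegrable_jetTTT l ha hab).mul_continuousOn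
      ((hG.continuousOn (by norm_num)).mono hs)
  have i2 : IntervalIntegrable (fun r => F 0 r * jetTTT l G r) volume a b :=
    (hG.intervalIntegrable_jetTTT l ha hab).continuousOn_mul
      ((hF.continuousOn (by norm_num)).mono hs)
  -- One Wronskian for each factor `T_l` moved from `F` to `G`. Their derivatives are `T³F·G -
  -- T²F·TG`, `T²F·TG - TF·T²G` and `TF·T²G - F·T³G`: the centrifugal terms cancel within each
  -- bracket and the sum telescopes.
  set B : ℝ → ℂ := fun r => jetTT l F r * G 1 r - jetTT' l F r * G 0 r
    + (jetT l F r * jetT' l G r - jetT' l F r * jetT l G r)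
    + (F 0 r * jetTT' l G r - F 1 r * jetTT l G r) with hB
  have hac : AbsolutelyContinuousOnInterval B a b :=
    ((((hF.ac_jetTT l ha hab).mul_complex (hG.ac_of_le (j := 1) (by norm_num) ha hab)).sub
      ((hF.ac_jetTT' l ha hab).mul_complex (hG.ac_of_le (j := 0) (by norm_num) ha hab))).add
      (((hF.ac_jetT l ha hab).mul_complex (hG.ac_jetT' l ha hab)).sub
      ((hF.ac_jetT' l ha hab).mul_complex (hG.ac_jetT l ha hab)))).add
      (((hF.ac_of_le (j := 0) (by norm_num) ha hab).mul_complex (hG.ac_jetTT' l ha hab)).sub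
      ((hF.ac_of_le (j := 1) (by norm_num) ha hab).mul_complex (hG.ac_jetTT l ha hab)))
  have hd : ∀ᵐ r, r ∈ uIcc a b →
      HasDerivAt B (jetTTT l F r * G 0 r - F 0 r * jetTTT l G r) r := by
    have e1 := (ae_restrict_iff' measurableSet_Ioi).1 hF.ae_hasDerivAt
    have e2 := (ae_restrict_iff' measurableSet_Ioi).1 hG.ae_hasDerivAt
    filter_upwards [e1, e2] with r h1 h2 hr
    have hr0 : 0 < r := hs hr
    convert! ((((hF.hasDerivAt_jetTT l hr0).mul (hG.hasDerivAt 1 (by norm_num) r hr0)).sub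
      ((hF.hasDerivAt_jetTT' l hr0 (h1 hr0)).mul (hG.hasDerivAt 0 (by norm_num) r hr0))).add
      (((hF.hasDerivAt_jetT l hr0).mul (hG.hasDerivAt_jetT' l hr0)).sub
      ((hF.hasDerivAt_jetT' l hr0).mul (hG.hasDerivAt_jetT l hr0)))).add
      (((hF.hasDerivAt 0 (by norm_num) r hr0).mul (hG.hasDerivAt_jetTT' l hr0 (h2 hr0))).sub
      ((hF.hasDerivAt 1 (by norm_num) r hr0).mul (hG.hasDerivAt_jetTT l hr0))) using 1
    simp only [jetT, jetT']
    ring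
  have hz : ∀ r, (∀ j ≤ 5, F j r = 0) → B r = 0 := by
    intro r h0
    have e0 := h0 0 (by norm_num)
    have e1 := h0 1 (by norm_num)
    have e2 := h0 2 (by norm_num)
    have e3 := h0 3 (by norm_num)
    have e4 := h0 4 (by norm_num)
    have e5 := h0 5 (by norm_num)
    simp [hB, jetT, jetT', jetTT, jetTT', e0, e1, e2, e3, e4, e5]
  have hI := hac.integral_eq_sub_of_ae_hasDerivAt hd (i1.sub i2)
  rw [intervalIntegral.integral_sub i1 i2, hz a hFa, hz b hFb, sub_zero] at hI
  exact sub_eq_zero.1 hI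

end

/-! ### Multiplication of jets by smooth cut-off functions -/

/-- The Leibniz product of two sequences of derivatives. -/
noncomputable def jetMul (X F : ℕ → ℝ → ℂ) (k : ℕ) (r : ℝ) : ℂ :=
  ∑ p ∈ Finset.HasAntidiagonal.antidiagonal k, (k.choose p.1 : ℂ) * (X p.1 r * F p.2 r)

section
variable {X F : ℕ → ℝ → ℂ}

lemma hasDerivAt_jetMul (hX : ∀ j r, HasDerivAt (X j) (X (j + 1) r) r) {k : ℕ} {r : ℝ}
    (hF : ∀ j ≤ k, HasDerivAt (F j) (F (j + 1) r) r) :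
    HasDerivAt (jetMul X F k) (jetMul X F (k + 1) r) r := by
  have h : HasDerivAt (fun r => ∑ p ∈ Finset.HasAntidiagonal.antidiagonal k,
      (k.choose p.1 : ℂ) * (X p.1 r * F p.2 r)) (∑ p ∈ Finset.HasAntidiagonal.antidiagonal k,
      (k.choose p.1 : ℂ) * (X (p.1 + 1) r * F p.2 r + X p.1 r * F (p.2 + 1) r)) r := by
    refine HasDerivAt.fun_sum fun p hp => ?_
    have hp2 : p.2 ≤ k := by
      have := Finset.HasAntidiagonal.mem_antidiagonal.1 hp
      omega
    exact ((hX p.1 r).mul (hF p.2 hp2)).const_mul _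
  convert! h using 1
  simp only [jetMul]
  rw [Finset.sum_antidiagonal_choose_succ_mul (fun i j => X i r * F j r), ← Finset.sum_add_distrib]
  refine Finset.sum_congr rfl fun p hp => ?_
  have e : k.choose p.2 = k.choose p.1 := by
    have := Finset.HasAntidiagonal.mem_antidiagonal.1 hp
    exact Nat.choose_symm_of_eq_add (by omega)
  rw [e]
  ring

lemma IsJet.mul_cutoff (hF : IsJet F) (hX : ∀ j r, HasDerivAt (X j) (X (j + 1) r) r) :
    IsJet (jetMul X F) := by
  have hXc : ∀ j, Continuous (X j) := fun j =>
    continuous_iff_continuousAt.2 fun r => (hX j r).continuousAt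
  refine ⟨fun j hj r hr => hasDerivAt_jetMul hX fun i hi => hF.hasDerivAt i (by omega) r hr,
    fun a b ha hab => ?_, ?_, fun a b ha hab => ?_⟩
  · refine AbsolutelyContinuousOnInterval.sum_complex _ fun p hp => ?_
    have hp2 : p.2 ≤ 5 := by
      have := Finset.HasAntidiagonal.mem_antidiagonal.1 hp
      omega
    have h1 : AbsolutelyContinuousOnInterval (X p.1) a b :=
      AbsolutelyContinuousOnInterval.of_hasDerivAt (fun x _ => hX _ x) (hXc _).continuousOn
    exact AbsolutelyContinuousOnInterval.const_smul (Nat.choose 5 p.1 : ℂ)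
      (h1.mul_complex (hF.ac_of_le hp2 ha hab))
  · filter_upwards [hF.ae_hasDerivAt, ae_restrict_mem measurableSet_Ioi] with r h5 hr
    refine hasDerivAt_jetMul hX fun i hi => ?_
    rcases hi.lt_or_eq with hi | rfl
    · exact hF.hasDerivAt i hi r hr
    · exact h5
  · have : ∀ p ∈ Finset.HasAntidiagonal.antidiagonal 6, IntervalIntegrable
        (fun r => (Nat.choose 6 p.1 : ℂ) * (X p.1 r * F p.2 r)) volume a b := by
      intro p hp
      have hp2 : p.2 ≤ 6 := by
        have := Finset.HasAntidiagonal.mem_antidiagonal.1 hp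
        omega
      have hFi : IntervalIntegrable (F p.2) volume a b := by
        rcases hp2.lt_or_eq with hp2 | hp2
        · exact ((hF.continuousOn (by omega : p.2 ≤ 5)).mono
            (uIcc_subset_Ioi ha hab)).intervalIntegrable
        · rw [hp2]
          exact hF.integrable a b ha hab
      exact (hFi.continuousOn_mul (hXc _).continuousOn).const_mul _
    have h := IntervalIntegrable.sum _ this
    convert! h using 1

lemma jetMul_eq_zero {r : ℝ} (hX : ∀ j, X j r = 0) (k : ℕ) : jetMul X F k r = 0 := by
  simp [jetMul, hX]

lemma jetMul_eq_zero_right {r : ℝ} (hF : ∀ j, F j r = 0) (k : ℕ) : jetMul X F k r = 0 := by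
  simp [jetMul, hF]

lemma jetMul_eq_self {r : ℝ} (hX0 : X 0 r = 1) (hX : ∀ j, X (j + 1) r = 0) (k : ℕ) :
    jetMul X F k r = F k r := by
  rw [jetMul, Finset.sum_eq_single (0, k)]
  · simp [hX0]
  · rintro ⟨i, j⟩ hp hne
    rcases i with _ | i
    · simp only [Finset.HasAntidiagonal.mem_antidiagonal] at hp
      exact absurd (by simp; omega) hne
    · simp [hX]
  · simp

/-- The scale-invariant size of a jet. -/
noncomputable def jetSize (F : ℕ → ℝ → ℂ) (r : ℝ) : ℝ :=
  ∑ k ∈ Finset.range 7, ‖F k r‖ * r⁻¹ ^ (6 - k)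

lemma jetSize_nonneg (F : ℕ → ℝ → ℂ) {r : ℝ} (hr : 0 < r) : 0 ≤ jetSize F r :=
  Finset.sum_nonneg fun _ _ => by positivity

lemma norm_mul_le_jetSize (F : ℕ → ℝ → ℂ) {r : ℝ} (hr : 0 < r) {k : ℕ} (hk : k ≤ 6) :
    ‖F k r‖ * r⁻¹ ^ (6 - k) ≤ jetSize F r :=
  Finset.single_le_sum (f := fun k => ‖F k r‖ * r⁻¹ ^ (6 - k)) (fun _ _ => by positivity)
    (Finset.mem_range.2 (by omega))

/-- A Leibniz term `X_i F_j` with `i + j = k` carries the weight `r^{-(6-k)}`, and `r^{-i}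
r^{-(6-k)} = r^{-(6-j)}`, so cut-offs with `|X_i| ≤ M r^{-i}` preserve the size. The factor 7 counts
the orders and `64 = 2^6` bounds the sums of binomial coefficients. -/
lemma jetSize_jetMul_le {M : ℝ} {r : ℝ} (hr : 0 < r)
    (hX : ∀ j ≤ 6, ‖X j r‖ ≤ M * r⁻¹ ^ j) :
    jetSize (jetMul X F) r ≤ 7 * 64 * M * jetSize F r := by
  have hM : 0 ≤ M := by
    have := (norm_nonneg _).trans (hX 0 (by norm_num))
    simpa using this
  have hS := jetSize_nonneg F hr
  have key : ∀ k ∈ Finset.range 7, ‖jetMul X F k r‖ * r⁻¹ ^ (6 - k) ≤ 64 * M * jetSize F r := by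
    intro k hk
    have hk6 : k ≤ 6 := by
      have := Finset.mem_range.1 hk
      omega
    calc ‖jetMul X F k r‖ * r⁻¹ ^ (6 - k)
        ≤ (∑ p ∈ Finset.HasAntidiagonal.antidiagonal k, (k.choose p.1 : ℝ) * (‖X p.1 r‖ * ‖F p.2 r‖)) *
          r⁻¹ ^ (6 - k) := by
          refine mul_le_mul_of_nonneg_right ((norm_sum_le _ _).trans (le_of_eq ?_)) (by positivity)
          refine Finset.sum_congr rfl fun p _ => ?_
          simp
      _ = ∑ p ∈ Finset.HasAntidiagonal.antidiagonal k, (k.choose p.1 : ℝ) * (‖X p.1 r‖ * ‖F p.2 r‖) *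
          r⁻¹ ^ (6 - k) := Finset.sum_mul _ _ _
      _ ≤ ∑ p ∈ Finset.HasAntidiagonal.antidiagonal k, (k.choose p.1 : ℝ) * (M * jetSize F r) := by
          refine Finset.sum_le_sum fun p hp => ?_
          have hpk := Finset.HasAntidiagonal.mem_antidiagonal.1 hp
          rw [mul_assoc]
          refine mul_le_mul_of_nonneg_left ?_ (by positivity)
          calc ‖X p.1 r‖ * ‖F p.2 r‖ * r⁻¹ ^ (6 - k)
              ≤ (M * r⁻¹ ^ p.1) * ‖F p.2 r‖ * r⁻¹ ^ (6 - k) := by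
                gcongr
                exact hX _ (by omega)
            _ = M * (‖F p.2 r‖ * r⁻¹ ^ (6 - p.2)) := by
                rw [show 6 - p.2 = p.1 + (6 - k) by omega, pow_add]
                ring
            _ ≤ M * jetSize F r := by
                gcongr
                exact norm_mul_le_jetSize F hr (by omega)
      _ = (2 ^ k : ℝ) * (M * jetSize F r) := by
          rw [← Finset.sum_mul]
          congr 1
          have h2 := Finset.Nat.sum_antidiagonal_eq_sum_range_succ_mk
            (fun p : ℕ × ℕ => (k.choose p.1 : ℝ)) k
          rw [h2]
          exact_mod_cast Nat.sum_range_choose k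
      _ ≤ (2 ^ 6 : ℝ) * (M * jetSize F r) := by
          gcongr
          norm_num
      _ = 64 * M * jetSize F r := by norm_num; ring
  calc jetSize (jetMul X F) r ≤ ∑ _k ∈ Finset.range 7, 64 * M * jetSize F r :=
        Finset.sum_le_sum key
    _ = _ := by simp; ring

/-- `T_l³` is homogeneous of degree `-6` under dilations: the coefficient of `F k` is a constant
times `r^{-(6-k)}`. -/
lemma exists_norm_jetTTT_le (l : ℕ) : ∃ K : ℝ, ∀ (F : ℕ → ℝ → ℂ) (r : ℝ), 0 < r →
    ‖jetTTT l F r‖ ≤ K * jetSize F r := by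
  refine ⟨1 + ‖3 * coupling l‖ + ‖-12 * coupling l‖ + ‖42 * coupling l - 3 * coupling l ^ 2‖ +
    ‖12 * coupling l ^ 2 - 96 * coupling l‖ +
    ‖coupling l ^ 3 - 26 * coupling l ^ 2 + 120 * coupling l‖, fun F r hr => ?_⟩
  have key : ∀ (c : ℂ) (k : ℕ), k ≤ 6 →
      ‖c * ((r : ℂ)⁻¹ ^ (6 - k) * F k r)‖ ≤ ‖c‖ * jetSize F r := by
    intro c k hk
    rw [norm_mul]
    refine mul_le_mul_of_nonneg_left ?_ (norm_nonneg _)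
    refine le_trans (le_of_eq ?_) (norm_mul_le_jetSize F hr hk)
    rw [norm_mul, norm_pow, norm_inv, Complex.norm_real, Real.norm_of_nonneg hr.le, mul_comm]
  have h6 : ‖-F 6 r‖ ≤ 1 * jetSize F r := by
    simpa using key 1 6 le_rfl
  simp only [add_mul]
  rw [jetTTT]
  refine (norm_add_le _ _).trans (add_le_add ?_ (key _ 0 (by norm_num)))
  refine (norm_add_le _ _).trans (add_le_add ?_ (key _ 1 (by norm_num)))
  refine (norm_add_le _ _).trans (add_le_add ?_ (key _ 2 (by norm_num)))
  refine (norm_add_le _ _).trans (add_le_add ?_ (key _ 3 (by norm_num)))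
  exact (norm_add_le _ _).trans (add_le_add h6 (key _ 4 (by norm_num)))

end

/-! ### Cut-off functions -/

lemma hasDerivAt_iteratedDeriv_of_contDiff {ζ : ℝ → ℂ} (hζ : ContDiff ℝ ∞ ζ) (j : ℕ) (r : ℝ) :
    HasDerivAt (iteratedDeriv j ζ) (iteratedDeriv (j + 1) ζ r) r := by
  rw [iteratedDeriv_succ]
  exact ((hζ.differentiable_iteratedDeriv j (by exact_mod_cast WithTop.coe_lt_top _)) r).hasDerivAt

/-- The derivatives of `r ↦ ζ (t r)`. -/
noncomputable def dilate (ζ : ℝ → ℂ) (t : ℝ) (j : ℕ) (r : ℝ) : ℂ :=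
  (t : ℂ) ^ j * iteratedDeriv j ζ (t * r)

lemma hasDerivAt_dilate {ζ : ℝ → ℂ} (hζ : ContDiff ℝ ∞ ζ) (t : ℝ) (j : ℕ) (r : ℝ) :
    HasDerivAt (dilate ζ t j) (dilate ζ t (j + 1) r) r := by
  have h0 : HasDerivAt (fun r => t * r) t r := by simpa using (hasDerivAt_id r).const_mul t
  have h1 := (hasDerivAt_iteratedDeriv_of_contDiff hζ j (t * r)).scomp r h0
  convert! h1.const_mul ((t : ℂ) ^ j) using 1
  simp only [dilate, Complex.real_smul]
  ring

/-- With `s = t r` one has `t^j ζ^{(j)}(t r) = s^j ζ^{(j)}(s) r^{-j}`, and `s^j ζ^{(j)}(s)` is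
bounded on `[0, ∞)` because `ζ` is constant beyond 2. The bound is therefore uniform in the dilation
`t`. -/
lemma exists_dilate_bound {ζ : ℝ → ℂ} (hζ : ContDiff ℝ ∞ ζ) {c : ℂ} (hc : ∀ s, 2 < s → ζ s = c) :
    ∃ M : ℝ, ∀ t : ℝ, 0 < t → ∀ r : ℝ, 0 < r → ∀ j ≤ 6, ‖dilate ζ t j r‖ ≤ M * r⁻¹ ^ j := by
  have h1 : ∀ j, ∃ M : ℝ, ∀ s : ℝ, 0 ≤ s → ‖(s : ℂ) ^ j * iteratedDeriv j ζ s‖ ≤ M := by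
    intro j
    have hcont : Continuous fun s : ℝ => (s : ℂ) ^ j * iteratedDeriv j ζ s :=
      (Complex.continuous_ofReal.pow j).mul
        (hζ.continuous_iteratedDeriv j (by exact_mod_cast le_top))
    obtain ⟨M, hM⟩ := (isCompact_Icc (a := (0 : ℝ)) (b := 2)).exists_bound_of_continuousOn
      hcont.continuousOn
    refine ⟨max M ‖c‖, fun s hs => ?_⟩
    rcases le_or_gt s 2 with h2 | h2
    · exact (hM s ⟨hs, h2⟩).trans (le_max_left _ _)
    · have he : ζ =ᶠ[𝓝 s] fun _ => c := by
        filter_upwards [isOpen_Ioi.mem_nhds h2] with x hx using hc x hx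
      rw [he.iteratedDeriv_eq j, iteratedDeriv_const]
      split_ifs with hj
      · simp [hj]
      · simp
  choose M hM using h1
  refine ⟨∑ j ∈ Finset.range 7, |M j|, fun t ht r hr j hj => ?_⟩
  have hMj : M j ≤ ∑ j ∈ Finset.range 7, |M j| := (le_abs_self _).trans
    (Finset.single_le_sum (f := fun j => |M j|) (fun _ _ => abs_nonneg _)
      (Finset.mem_range.2 (by omega)))
  have h2 := (hM j (t * r) (by positivity)).trans hMj
  have e : dilate ζ t j r = ((t * r : ℝ) : ℂ) ^ j * iteratedDeriv j ζ (t * r) * (r : ℂ)⁻¹ ^ j := by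
    have : (r : ℂ) ≠ 0 := by exact_mod_cast hr.ne'
    simp only [dilate]
    push_cast
    rw [mul_pow, inv_pow]
    field_simp
  rw [e, norm_mul]
  have e2 : ‖(r : ℂ)⁻¹ ^ j‖ = r⁻¹ ^ j := by
    rw [norm_pow, norm_inv, Complex.norm_real, Real.norm_of_nonneg hr.le]
  rw [e2]
  gcongr

lemma dilate_of_eventuallyEq {ζ : ℝ → ℂ} {t r : ℝ} {c : ℂ} (h : ζ =ᶠ[𝓝 (t * r)] fun _ => c) :
    dilate ζ t 0 r = c ∧ ∀ j, dilate ζ t (j + 1) r = 0 := by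
  simp only [dilate, h.iteratedDeriv_eq, iteratedDeriv_const]
  simp

/-! ### Green's formula on the half-line -/

section
variable {F G : ℕ → ℝ → ℂ}

lemma IsJet.aestronglyMeasurable_six (h : IsJet F) : AEStronglyMeasurable (F 6) halfLineMeasure :=
  (stronglyMeasurable_deriv (F 5)).aestronglyMeasurable.congr
    (h.ae_hasDerivAt.mono fun _ hr => hr.deriv)

lemma aestronglyMeasurable_ofReal_inv_pow (n : ℕ) :
    AEStronglyMeasurable (fun s : ℝ => ((s : ℂ)⁻¹) ^ n) halfLineMeasure :=
  (continuousOn_ofReal_inv_pow n).aestronglyMeasurable measurableSet_Ioi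

lemma IsJet.aestronglyMeasurable_jetTTT (h : IsJet F) (l : ℕ) :
    AEStronglyMeasurable (jetTTT l F) halfLineMeasure := by
  have key : ∀ (j : ℕ), j ≤ 5 → ∀ (c : ℂ) (n : ℕ),
      AEStronglyMeasurable (fun r : ℝ => c * ((r : ℂ)⁻¹ ^ n * F j r)) halfLineMeasure :=
    fun j hj c n => (h.continuousOn_inv_pow_mul hj c n).aestronglyMeasurable measurableSet_Ioi
  exact (((((h.aestronglyMeasurable_six).neg.add (key 4 (by norm_num) _ 2)).add
    (key 3 (by norm_num) _ 3)).add (key 2 (by norm_num) _ 4)).add (key 1 (by norm_num) _ 5)).add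
    (key 0 (by norm_num) _ 6)

lemma IsJet.memLp_jetTTT (h : IsJet F) (l : ℕ) (hS : MemLp (jetSize F) 2 halfLineMeasure) :
    MemLp (jetTTT l F) 2 halfLineMeasure := by
  obtain ⟨K, hK⟩ := exists_norm_jetTTT_le l
  refine (hS.const_mul K).mono (h.aestronglyMeasurable_jetTTT l) ?_
  filter_upwards [ae_restrict_mem measurableSet_Ioi] with r hr
  exact (hK F r hr).trans (le_abs_self _)

/-- Smooth cut-offs, compatible with dilations. -/
lemma exists_cutoff_sequence : ∃ X Y : ℕ → ℕ → ℝ → ℂ, ∃ M : ℝ,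
    (∀ n j r, HasDerivAt (X n j) (X n (j + 1) r) r) ∧
    (∀ n j r, HasDerivAt (Y n j) (Y n (j + 1) r) r) ∧
    (∀ n r, 0 < r → ∀ j ≤ 6, ‖X n j r‖ ≤ M * r⁻¹ ^ j) ∧
    (∀ n r, 0 < r → ∀ j ≤ 6, ‖Y n j r‖ ≤ M * r⁻¹ ^ j) ∧
    (∀ (n : ℕ) (r : ℝ), r ≤ (2 * ((n : ℝ) + 1))⁻¹ → ∀ j, X n j r = 0) ∧
    (∀ (n : ℕ) (r : ℝ), 3 * ((n : ℝ) + 1) ≤ r → ∀ j, Y n j r = 0) ∧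
    (∀ r, 0 < r → ∀ᶠ n in atTop, X n 0 r = 1 ∧ Y n 0 r = 1 ∧ ∀ j, X n (j + 1) r = 0 ∧
      Y n (j + 1) r = 0) := by
  set η : ℝ → ℂ := fun s => (Real.smoothTransition (s - 1) : ℂ) with hη
  set θ : ℝ → ℂ := fun s => (Real.smoothTransition (2 - s) : ℂ) with hθ
  have hηs : ContDiff ℝ ∞ η :=
    Complex.ofRealCLM.contDiff.comp (Real.smoothTransition.contDiff.comp (by fun_prop))
  have hθs : ContDiff ℝ ∞ θ :=
    Complex.ofRealCLM.contDiff.comp (Real.smoothTransition.contDiff.comp (by fun_prop))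
  have η1 : ∀ s, 2 < s → η s = 1 := fun s hs => by
    simp [hη, Real.smoothTransition.one_of_one_le (by linarith : (1 : ℝ) ≤ s - 1)]
  have η0 : ∀ s, s < 1 → η s = 0 := fun s hs => by
    simp [hη, Real.smoothTransition.zero_of_nonpos (by linarith : s - 1 ≤ (0 : ℝ))]
  have θ1 : ∀ s, s < 1 → θ s = 1 := fun s hs => by
    simp [hθ, Real.smoothTransition.one_of_one_le (by linarith : (1 : ℝ) ≤ 2 - s)]
  have θ0 : ∀ s, 2 < s → θ s = 0 := fun s hs => by
    simp [hθ, Real.smoothTransition.zero_of_nonpos (by linarith : 2 - s ≤ (0 : ℝ))]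
  have upper : ∀ {ζ : ℝ → ℂ} {c : ℂ}, (∀ s, 2 < s → ζ s = c) → ∀ {s : ℝ}, 2 < s →
      ζ =ᶠ[𝓝 s] fun _ => c := fun h s hs => by
    filter_upwards [isOpen_Ioi.mem_nhds hs] with x hx using h x hx
  have lower : ∀ {ζ : ℝ → ℂ} {c : ℂ}, (∀ s, s < 1 → ζ s = c) → ∀ {s : ℝ}, s < 1 →
      ζ =ᶠ[𝓝 s] fun _ => c := fun h s hs => by
    filter_upwards [isOpen_Iio.mem_nhds hs] with x hx using h x hx
  have zero : ∀ {ζ : ℝ → ℂ} {t r : ℝ}, (ζ =ᶠ[𝓝 (t * r)] fun _ => 0) →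
      ∀ j, dilate ζ t j r = 0 := fun h j => by
    rcases j with _ | j
    · exact (dilate_of_eventuallyEq h).1
    · exact (dilate_of_eventuallyEq h).2 j
  obtain ⟨M₁, h₁⟩ := exists_dilate_bound hηs η1
  obtain ⟨M₂, h₂⟩ := exists_dilate_bound hθs θ0
  -- `X n` is `η((n+1) r)` and removes the origin; `Y n` is `θ(r/(n+1))` and removes infinity. The
  -- factors 2 and 3 in the stated supports keep the arguments strictly inside the regions where
  -- `η`, `θ` are zero, so that all derivatives vanish at the end points too.
  refine ⟨fun n => dilate η (n + 1), fun n => dilate θ ((n : ℝ) + 1)⁻¹, max M₁ M₂,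
    fun n j r => hasDerivAt_dilate hηs _ j r, fun n j r => hasDerivAt_dilate hθs _ j r,
    fun n r hr j hj => (h₁ _ (by positivity) r hr j hj).trans ?_,
    fun n r hr j hj => (h₂ _ (by positivity) r hr j hj).trans ?_,
    fun n r hr => zero (lower η0 ?_), fun n r hr => zero (upper θ0 ?_), fun r hr => ?_⟩
  · gcongr; exact le_max_left _ _
  · gcongr; exact le_max_right _ _
  · calc ((n : ℝ) + 1) * r ≤ ((n : ℝ) + 1) * (2 * ((n : ℝ) + 1))⁻¹ := by gcongr
      _ < 1 := by field_simp; norm_num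
  · calc (2 : ℝ) < ((n : ℝ) + 1)⁻¹ * (3 * ((n : ℝ) + 1)) := by field_simp; norm_num
      _ ≤ _ := by gcongr
  · obtain ⟨N, hN⟩ := exists_nat_gt (max r (2 / r))
    filter_upwards [eventually_ge_atTop N] with n hn
    have hn' : (N : ℝ) ≤ n := by exact_mod_cast hn
    have a1 : 2 < ((n : ℝ) + 1) * r := by
      have : 2 / r < n + 1 := by linarith [(le_max_right r (2 / r))]
      rwa [div_lt_iff₀ hr] at this
    have a2 : ((n : ℝ) + 1)⁻¹ * r < 1 := by
      rw [inv_mul_lt_iff₀ (by positivity)]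
      linarith [(le_max_left r (2 / r))]
    have b1 := dilate_of_eventuallyEq (upper η1 a1)
    have b2 := dilate_of_eventuallyEq (lower θ1 a2)
    exact ⟨b1.1, b2.1, fun j => ⟨b1.2 j, b2.2 j⟩⟩

/-- Green's formula for `T_l³` on the half-line, without boundary terms. -/
lemma IsJet.green (l : ℕ) (hF : IsJet F) (hG : IsJet G) (hS : MemLp (jetSize F) 2 halfLineMeasure)
    (hF0 : MemLp (F 0) 2 halfLineMeasure) (hG0 : MemLp (G 0) 2 halfLineMeasure)
    (hTG : MemLp (jetTTT l G) 2 halfLineMeasure) :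
    ∫ r in Ioi 0, jetTTT l F r * G 0 r = ∫ r in Ioi 0, F 0 r * jetTTT l G r := by
  obtain ⟨X, Y, M, hX, hY, bX, bY, zX, zY, lim⟩ := exists_cutoff_sequence
  -- Both cut-offs fall on `F`; no derivative of `G` has to be estimated.
  set P : ℕ → ℕ → ℝ → ℂ := fun n => jetMul (X n) (jetMul (Y n) F) with hP
  have hPj : ∀ n, IsJet (P n) := fun n => (hF.mul_cutoff (hY n)).mul_cutoff (hX n)
  obtain ⟨K, hK⟩ := exists_norm_jetTTT_le l
  have hzero : ∀ (n : ℕ) (r : ℝ), r ≤ (2 * ((n : ℝ) + 1))⁻¹ ∨ 3 * ((n : ℝ) + 1) ≤ r → ∀ j, P n j r = 0 := by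
    rintro n r (h | h) j
    · exact jetMul_eq_zero (zX n r h) j
    · exact jetMul_eq_zero_right (jetMul_eq_zero (zY n r h)) j
  have hM : 0 ≤ M := by
    have := (norm_nonneg _).trans (bX 0 1 one_pos 0 (by norm_num))
    simpa using this
  have hK0 : 0 ≤ K * jetSize F 1 := (norm_nonneg _).trans (hK F 1 one_pos)
  have hbound : ∀ n r, 0 < r →
      ‖jetTTT l (P n) r‖ ≤ |K| * ((7 * 64 * M) * ((7 * 64 * M) * jetSize F r)) := by
    intro n r hr
    have s1 := jetSize_jetMul_le (F := F) hr (bY n r hr)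
    have s2 := jetSize_jetMul_le (F := jetMul (Y n) F) hr (bX n r hr)
    have s3 : jetSize (P n) r ≤ (7 * 64 * M) * ((7 * 64 * M) * jetSize F r) :=
      s2.trans (mul_le_mul_of_nonneg_left s1 (by positivity))
    calc ‖jetTTT l (P n) r‖ ≤ K * jetSize (P n) r := hK _ r hr
      _ ≤ |K| * jetSize (P n) r :=
        mul_le_mul_of_nonneg_right (le_abs_self K) (jetSize_nonneg _ hr)
      _ ≤ _ := mul_le_mul_of_nonneg_left s3 (abs_nonneg K)
  have hgreen : ∀ n, ∫ r in Ioi 0, jetTTT l (P n) r * G 0 r =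
      ∫ r in Ioi 0, P n 0 r * jetTTT l G r := by
    intro n
    have ha : (0 : ℝ) < (2 * ((n : ℝ) + 1))⁻¹ := by positivity
    have hab : (2 * ((n : ℝ) + 1))⁻¹ ≤ 3 * ((n : ℝ) + 1) := by
      have h1 : (2 * ((n : ℝ) + 1))⁻¹ ≤ 1 := inv_le_one_of_one_le₀ (by linarith [n.cast_nonneg (α := ℝ)])
      linarith [n.cast_nonneg (α := ℝ)]
    have hsub : Ioc (2 * ((n : ℝ) + 1))⁻¹ (3 * ((n : ℝ) + 1)) ⊆ Ioi 0 :=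
      fun r hr => ha.trans hr.1
    have hout : ∀ r ∈ Ioi (0 : ℝ) \ Ioc (2 * ((n : ℝ) + 1))⁻¹ (3 * ((n : ℝ) + 1)),
        ∀ j, P n j r = 0 := by
      intro r hr
      refine hzero n r ?_
      by_contra hcon
      push Not at hcon
      exact hr.2 ⟨hcon.1, hcon.2.le⟩
    have h := (hPj n).green_interval l hG ha hab (fun j _ => hzero n _ (Or.inl le_rfl) j)
      (fun j _ => hzero n _ (Or.inr le_rfl) j)
    rw [intervalIntegral.integral_of_le hab, intervalIntegral.integral_of_le hab] at h
    rw [setIntegral_eq_of_subset_of_forall_sdiff_eq_zero measurableSet_Ioi hsub, h,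
      setIntegral_eq_of_subset_of_forall_sdiff_eq_zero measurableSet_Ioi hsub]
    · intro r hr
      rw [hout r hr 0, zero_mul]
    · intro r hr
      simp [jetTTT, hout r hr]
  have hev : ∀ r, 0 < r → ∀ᶠ n in atTop, ∀ j, P n j r = F j r := by
    intro r hr
    filter_upwards [lim r hr] with n hn j
    exact (jetMul_eq_self hn.1 (fun j => (hn.2.2 j).1) j).trans
      (jetMul_eq_self hn.2.1 (fun j => (hn.2.2 j).2) j)
  -- At each point the integrand is eventually constant in `n`, and a multiple of `jetSize F · |G
  -- 0|`, a product of two `L²` functions, dominates it.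
  have lim1 : Tendsto (fun n => ∫ r in Ioi 0, jetTTT l (P n) r * G 0 r) atTop
      (𝓝 (∫ r in Ioi 0, jetTTT l F r * G 0 r)) := by
    refine tendsto_integral_of_dominated_convergence
      (fun r => |K| * ((7 * 64 * M) * ((7 * 64 * M) * jetSize F r)) * ‖G 0 r‖)
      (fun n => ((hPj n).aestronglyMeasurable_jetTTT l).mul hG0.1) ?_ (fun n => ?_) ?_
    · exact MemLp.integrable_mul (p := 2) (q := 2)
        (((hS.const_mul _).const_mul _).const_mul _) hG0.norm
    · filter_upwards [ae_restrict_mem measurableSet_Ioi] with r hr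
      rw [norm_mul]
      exact mul_le_mul_of_nonneg_right (hbound n r hr) (norm_nonneg _)
    · filter_upwards [ae_restrict_mem measurableSet_Ioi] with r hr
      refine tendsto_const_nhds.congr' ?_
      filter_upwards [hev r hr] with n hn
      simp [jetTTT, hn]
  have lim2 : Tendsto (fun n => ∫ r in Ioi 0, P n 0 r * jetTTT l G r) atTop
      (𝓝 (∫ r in Ioi 0, F 0 r * jetTTT l G r)) := by
    refine tendsto_integral_of_dominated_convergence
      (fun r => M * (M * ‖F 0 r‖) * ‖jetTTT l G r‖)
      (fun n => ((hPj n).aestronglyMeasurable (by norm_num)).mul hTG.1) ?_ (fun n => ?_) ?_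
    · exact MemLp.integrable_mul (p := 2) (q := 2)
        ((hF0.norm.const_mul _).const_mul _) hTG.norm
    · filter_upwards [ae_restrict_mem measurableSet_Ioi] with r hr
      rw [norm_mul]
      refine mul_le_mul_of_nonneg_right ?_ (norm_nonneg _)
      have e : P n 0 r = X n 0 r * (Y n 0 r * F 0 r) := by simp [hP, jetMul]
      rw [e, norm_mul, norm_mul]
      have b1 : ‖X n 0 r‖ ≤ M := by simpa using bX n r hr 0 (by norm_num)
      have b2 : ‖Y n 0 r‖ ≤ M := by simpa using bY n r hr 0 (by norm_num)
      gcongr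
    · filter_upwards [ae_restrict_mem measurableSet_Ioi] with r hr
      refine tendsto_const_nhds.congr' ?_
      filter_upwards [hev r hr] with n hn
      simp [hn]
  exact tendsto_nhds_unique lim1 (by simpa only [hgreen] using lim2)

end

/-! ### The jet of an element of `W_0^6` -/

/-- The derivatives of `f ∈ W_0^6`. -/
noncomputable def w06Jet (f g : ℝ → ℂ) (k : ℕ) : ℝ → ℂ :=
  if k ≤ 5 then iteratedDerivWithin k f (Ici 0) else g

section
variable {f g : ℝ → ℂ}

lemma w06Jet_zero : w06Jet f g 0 = f := by
  funext r
  simp [w06Jet]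

lemma w06Jet_six : w06Jet f g 6 = g := by simp [w06Jet]

lemma w06Jet_of_le {k : ℕ} (hk : k ≤ 5) : w06Jet f g k = iteratedDerivWithin k f (Ici 0) := by
  simp [w06Jet, hk]

lemma IsW06.continuousOn_jet (h : IsW06 f g) {k : ℕ} (hk : k ≤ 5) :
    ContinuousOn (w06Jet f g k) (Ici 0) := by
  rw [w06Jet_of_le hk]
  exact h.contDiffOn.continuousOn_iteratedDerivWithin (by exact_mod_cast hk) (uniqueDiffOn_Ici 0)

lemma IsW06.jet_five (h : IsW06 f g) {r : ℝ} (hr : 0 ≤ r) :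
    w06Jet f g 5 r = ∫ s in (0 : ℝ)..r, g s := by
  rw [w06Jet_of_le le_rfl, h.fifth_eq r hr, h.boundary 5 le_rfl, zero_add]

lemma IsW06.hasDerivAt_jet (h : IsW06 f g) {k : ℕ} (hk : k < 5) {r : ℝ} (hr : 0 < r) :
    HasDerivAt (w06Jet f g k) (w06Jet f g (k + 1) r) r := by
  rw [w06Jet_of_le (by omega), w06Jet_of_le (by omega), iteratedDerivWithin_succ]
  exact ((h.contDiffOn.differentiableOn_iteratedDerivWithin (by exact_mod_cast hk)
    (uniqueDiffOn_Ici 0)) r hr.le).hasDerivWithinAt.hasDerivAt (Ici_mem_nhds hr)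

lemma IsW06.isJet (h : IsW06 f g) : IsJet (w06Jet f g) := by
  refine ⟨fun j hj r hr => h.hasDerivAt_jet hj hr, fun a b ha hab => ?_, ?_, fun a b ha hab => ?_⟩
  · have hb : 0 ≤ b := ha.le.trans hab
    have h1 := AbsolutelyContinuousOnInterval.intervalIntegral_right (h.intervalIntegrable hb)
    have hs : uIcc a b ⊆ uIcc 0 b := by
      rw [uIcc_of_le hab, uIcc_of_le hb]
      exact Icc_subset_Icc_left ha.le
    exact (h1.mono hs).congr fun r hr => (h.jet_five (uIcc_subset_Ioi ha hab hr).le).symm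
  · rw [ae_restrict_iff' measurableSet_Ioi]
    have hae : ∀ n : ℕ, ∀ᵐ r : ℝ, r ∈ uIcc (0 : ℝ) n →
        HasDerivAt (fun x => ∫ s in (0 : ℝ)..x, g s) (g r) r := by
      intro n
      filter_upwards [(h.intervalIntegrable (Nat.cast_nonneg n)).ae_hasDerivAt_integral] with r hr hrn
      exact hr hrn 0 left_mem_uIcc
    filter_upwards [ae_all_iff.2 hae] with r hr hr0
    obtain ⟨n, hn⟩ := exists_nat_ge r
    have hr0' : (0 : ℝ) < r := hr0
    have hG := hr n (by rw [uIcc_of_le (Nat.cast_nonneg n)]; exact ⟨hr0'.le, hn⟩)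
    rw [w06Jet_six]
    refine hG.congr_of_eventuallyEq ?_
    filter_upwards [isOpen_Ioi.mem_nhds hr0] with s hs using h.jet_five (le_of_lt hs)
  · rw [w06Jet_six]
    have hb : 0 ≤ b := ha.le.trans hab
    refine (h.intervalIntegrable hb).mono_set ?_
    rw [uIcc_of_le hab, uIcc_of_le hb]
    exact Icc_subset_Icc_left ha.le

lemma IsW06.jet_eq_integral (h : IsW06 f g) {k : ℕ} (hk : k ≤ 5) {r : ℝ} (hr : 0 ≤ r) :
    w06Jet f g k r = ∫ s in (0 : ℝ)..r, w06Jet f g (k + 1) s := by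
  rcases hk.lt_or_eq with hk | rfl
  · rw [intervalIntegral.integral_eq_sub_of_hasDerivAt_of_le hr
      ((h.continuousOn_jet (k := k) (by omega)).mono Icc_subset_Ici_self)
      (fun x hx => h.hasDerivAt_jet hk hx.1)
      ((((h.continuousOn_jet (k := k + 1) (by omega)).mono
        (by rw [uIcc_of_le hr]; exact Icc_subset_Ici_self))).intervalIntegrable)]
    have h0 : w06Jet f g k 0 = 0 := by
      rw [w06Jet_of_le (by omega)]
      exact h.boundary k (by omega)
    rw [h0, sub_zero]
  · rw [w06Jet_six]
    exact h.jet_five hr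

/-- Descent from `f^{(6)} ∈ L²`: since `f^{(k)}(0) = 0`, each derivative is the primitive of the
next one, and every application of Hardy's inequality gains one factor `r^{-1}`. -/
lemma IsW06.memLp_inv_pow_mul_jet (h : IsW06 f g) {m k : ℕ} (hmk : k + m = 6) :
    MemLp (fun r : ℝ => (r : ℂ)⁻¹ ^ m * w06Jet f g k r) 2 halfLineMeasure := by
  induction m generalizing k with
  | zero =>
    obtain rfl : k = 6 := by omega
    simpa [w06Jet_six] using h.memLp_sixth
  | succ m ih =>
    refine MemLp.hardy (ih (k := k + 1) (by omega))
      ((aestronglyMeasurable_ofReal_inv_pow _).mul (h.isJet.aestronglyMeasurable (by omega)))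
      fun r hr => ?_
    have hx : ∀ s : ℝ, 0 < s → ‖(s : ℂ)⁻¹‖ₑ = ENNReal.ofReal s⁻¹ := fun s hs => by
      rw [← ofReal_norm, norm_inv, Complex.norm_real, Real.norm_of_nonneg hs.le]
    have h1 : ‖w06Jet f g k r‖ₑ ≤ ∫⁻ s in Ioc 0 r, ‖w06Jet f g (k + 1) s‖ₑ := by
      rw [h.jet_eq_integral (by omega) hr.le, intervalIntegral.integral_of_le hr.le]
      exact enorm_integral_le_lintegral_enorm _
    rw [pow_succ', mul_assoc, enorm_mul, hx r hr]
    gcongr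
    rw [enorm_mul]
    refine (mul_le_mul_right h1 _).trans ?_
    rw [← lintegral_const_mul' _ _ (by simp [enorm_ne_top])]
    -- The weight `r^{-m}` moves under the integral because `r^{-m} ≤ s^{-m}` for `s ≤ r`.
    refine setLIntegral_mono' measurableSet_Ioc fun s hs => ?_
    rw [enorm_mul]
    gcongr ?_ * _
    rw [enorm_pow, enorm_pow, hx r hr, hx s hs.1]
    gcongr
    · exact hs.1
    · exact hs.2

lemma IsW06.memLp_jetSize (h : IsW06 f g) : MemLp (jetSize (w06Jet f g)) 2 halfLineMeasure := by
  have h1 : MemLp (fun r : ℝ => ∑ k ∈ Finset.range 7,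
      ‖(r : ℂ)⁻¹ ^ (6 - k) * w06Jet f g k r‖) 2 halfLineMeasure :=
    memLp_finsetSum _ fun k hk => (h.memLp_inv_pow_mul_jet
      (by have := Finset.mem_range.1 hk; omega)).norm
  refine h1.ae_eq ?_
  filter_upwards [ae_restrict_mem measurableSet_Ioi] with r hr
  refine Finset.sum_congr rfl fun k _ => ?_
  rw [norm_mul, norm_pow, norm_inv, Complex.norm_real, Real.norm_of_nonneg (le_of_lt hr), mul_comm]

lemma IsW06.memLp_radialT_cube (h : IsW06 f g) (l : ℕ) :
    MemLp ((radialT l)^[3] f) 2 halfLineMeasure := by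
  have h1 := h.isJet.radialT_cube l
  rw [w06Jet_zero] at h1
  exact (h.isJet.memLp_jetTTT l h.memLp_jetSize).ae_eq h1.symm

/-- Green's formula for `T_l³` with one factor in `W_0^6`. -/
lemma IsW06.green (h : IsW06 f g) (l : ℕ) {G : ℕ → ℝ → ℂ} (hG : IsJet G)
    (hG0 : MemLp (G 0) 2 halfLineMeasure) (hTG : MemLp (jetTTT l G) 2 halfLineMeasure) :
    ∫ r in Ioi 0, (radialT l)^[3] f r * G 0 r = ∫ r in Ioi 0, f r * jetTTT l G r := by
  have h1 := h.isJet.radialT_cube l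
  rw [w06Jet_zero] at h1
  have h2 := IsJet.green l h.isJet hG h.memLp_jetSize (by rw [w06Jet_zero]; exact h.memLp) hG0 hTG
  rw [w06Jet_zero] at h2
  rw [← h2]
  refine integral_congr_ae ?_
  filter_upwards [h1] with r hr
  rw [hr]

end

/-! ### Test functions on the open half-line -/

/-- Smooth functions with compact support in `(0, ∞)`. -/
structure IsTest (φ : ℝ → ℂ) : Prop where
  contDiff : ContDiff ℝ ∞ φ
  hasCompactSupport : HasCompactSupport φ
  tsupport_subset : tsupport φ ⊆ Ioi 0

section
variable {φ ψ : ℝ → ℂ}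

lemma IsTest.eventuallyEq_zero (h : IsTest φ) {r : ℝ} (hr : r ≤ 0) : φ =ᶠ[𝓝 r] fun _ => 0 :=
  notMem_tsupport_iff_eventuallyEq.1 fun hmem => not_lt.2 hr (h.tsupport_subset hmem)

lemma IsTest.zero : IsTest (0 : ℝ → ℂ) :=
  ⟨contDiff_const, HasCompactSupport.zero, by simp [tsupport]⟩

lemma IsTest.add (h : IsTest φ) (h' : IsTest ψ) : IsTest (φ + ψ) :=
  ⟨h.contDiff.add h'.contDiff, h.hasCompactSupport.add h'.hasCompactSupport,
    (tsupport_add φ ψ).trans (union_subset h.tsupport_subset h'.tsupport_subset)⟩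

lemma IsTest.mul_left (h : IsTest φ) {v : ℝ → ℂ} (hv : ContDiffOn ℝ ∞ v (Ioi 0)) :
    IsTest (fun r => v r * φ r) := by
  refine ⟨contDiff_iff_contDiffAt.2 fun r => ?_, h.hasCompactSupport.mul_left,
    tsupport_mul_subset_right.trans h.tsupport_subset⟩
  rcases lt_or_ge 0 r with hr | hr
  · exact (hv.contDiffAt (isOpen_Ioi.mem_nhds hr)).mul h.contDiff.contDiffAt
  · have : (fun r => v r * φ r) =ᶠ[𝓝 r] fun _ => 0 := by
      filter_upwards [h.eventuallyEq_zero hr] with s hs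
      rw [hs, mul_zero]
    exact contDiffAt_const.congr_of_eventuallyEq this

lemma IsTest.smul (h : IsTest φ) (c : ℂ) : IsTest (c • φ) :=
  h.mul_left contDiffOn_const

lemma IsTest.deriv (h : IsTest φ) : IsTest (deriv φ) :=
  ⟨(contDiff_infty_iff_deriv.1 h.contDiff).2, h.hasCompactSupport.deriv,
    tsupport_deriv_subset.trans h.tsupport_subset⟩

lemma IsTest.conj (h : IsTest φ) : IsTest (fun r => conj (φ r)) := by
  refine ⟨Complex.conjCLE.contDiff.comp h.contDiff, h.hasCompactSupport.comp_left (map_zero _),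
    (closure_mono fun r hr => ?_).trans h.tsupport_subset⟩
  simpa using hr

lemma contDiffOn_ofReal_inv : ContDiffOn ℝ ∞ (fun r : ℝ => (r : ℂ)⁻¹) (Ioi 0) :=
  ContDiffOn.inv Complex.ofRealCLM.contDiff.contDiffOn fun r hr => by
    simpa using (ne_of_gt hr : r ≠ 0)

lemma contDiffOn_centrifugal_coeff (l : ℕ) :
    ContDiffOn ℝ ∞ (fun r : ℝ => (l : ℂ) * (l + 1) / (r : ℂ) ^ 2) (Ioi 0) := by
  simp only [div_eq_mul_inv, ← inv_pow]
  exact contDiffOn_const.mul (contDiffOn_ofReal_inv.pow 2)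

lemma IsTest.radialT (h : IsTest φ) (l : ℕ) : IsTest (radialT l φ) := by
  have h1 := (h.deriv.deriv.smul (-1)).add (h.mul_left (contDiffOn_centrifugal_coeff l))
  convert! h1 using 1
  funext r
  simp [_root_.radialT]

lemma IsTest.iteratedDeriv (h : IsTest φ) (n : ℕ) : IsTest (iteratedDeriv n φ) := by
  induction n with
  | zero => simpa using h
  | succ n ih =>
    rw [iteratedDeriv_succ]
    exact ih.deriv

lemma IsTest.memLp (h : IsTest φ) : MemLp φ 2 halfLineMeasure :=
  (h.contDiff.continuous.memLp_of_hasCompactSupport h.hasCompactSupport).restrict _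

lemma IsTest.isW06 (h : IsTest φ) : IsW06 φ (_root_.iteratedDeriv 6 φ) := by
  have e : ∀ k : ℕ, ∀ r : ℝ, 0 ≤ r →
      iteratedDerivWithin k φ (Ici 0) r = _root_.iteratedDeriv k φ r := fun k r hr =>
    iteratedDerivWithin_eq_iteratedDeriv (uniqueDiffOn_Ici 0)
      (h.contDiff.contDiffAt.of_le (by exact_mod_cast le_top)) hr
  refine ⟨(contDiff_infty.1 h.contDiff 5).contDiffOn, h.memLp,
    (h.iteratedDeriv 6).memLp, fun r hr => ?_, fun k _ => ?_⟩
  · rw [e 5 r hr, e 5 0 le_rfl, intervalIntegral.integral_eq_sub_of_hasDerivAt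
      (fun x _ => hasDerivAt_iteratedDeriv_of_contDiff h.contDiff 5 x)
      ((h.iteratedDeriv 6).contDiff.continuous.intervalIntegrable _ _)]
    ring
  · rw [e k 0 le_rfl]
    exact (h.iteratedDeriv k).eventuallyEq_zero le_rfl |>.self_of_nhds

lemma isJet_iteratedDeriv {q : ℝ → ℂ} (hq : ContDiffOn ℝ ∞ q (Ioi 0)) :
    IsJet (fun k => iteratedDeriv k q) := by
  have hc : ∀ k, ContDiffOn ℝ ∞ (iteratedDeriv k q) (Ioi 0) := by
    intro k
    induction k with
    | zero => simpa using hq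
    | succ k ih =>
      rw [iteratedDeriv_succ]
      exact ih.deriv_of_isOpen isOpen_Ioi (by simp)
  have hd : ∀ k, ∀ r : ℝ, 0 < r → HasDerivAt (iteratedDeriv k q) (iteratedDeriv (k + 1) q r) r := by
    intro k r hr
    rw [iteratedDeriv_succ]
    exact (((hc k).differentiableOn (by simp)).differentiableAt (isOpen_Ioi.mem_nhds hr)).hasDerivAt
  refine ⟨fun j _ => hd j, fun a b ha hab => ?_, ?_, fun a b ha hab => ?_⟩
  · exact AbsolutelyContinuousOnInterval.of_hasDerivAt
      (fun x hx => hd 5 x (uIcc_subset_Ioi ha hab hx))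
      ((hc 6).continuousOn.mono (uIcc_subset_Ioi ha hab))
  · filter_upwards [ae_restrict_mem measurableSet_Ioi] with r hr using hd 5 r hr
  · exact ((hc 6).continuousOn.mono (uIcc_subset_Ioi ha hab)).intervalIntegrable

end

/-! ### Functions that annihilate all test functions -/

lemma MemLp.locallyIntegrableOn_halfLine {u : ℝ → ℂ} (hu : MemLp u 2 halfLineMeasure) :
    LocallyIntegrableOn u (Ioi 0) := by
  rw [locallyIntegrableOn_iff isOpen_Ioi.isLocallyClosed]
  intro k hk hkc
  have : MemLp u 2 (volume.restrict k) :=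
    hu.mono_measure (Measure.restrict_mono hk le_rfl)
  have : IsFiniteMeasure (volume.restrict k) := ⟨by simpa using hkc.measure_lt_top⟩
  exact MemLp.integrable (by norm_num) ‹MemLp u 2 (volume.restrict k)›

lemma ae_eq_zero_of_forall_isTest {u : ℝ → ℂ} (hu : LocallyIntegrableOn u (Ioi 0))
    (h : ∀ φ, IsTest φ → ∫ r in Ioi 0, u r * φ r = 0) : u =ᵐ[halfLineMeasure] 0 := by
  have h1 := isOpen_Ioi.ae_eq_zero_of_integral_contDiff_smul_eq_zero hu fun g hg hgc hgs => by
    have hT : IsTest (fun r => (g r : ℂ)) := by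
      refine ⟨Complex.ofRealCLM.contDiff.comp hg, hgc.comp_left Complex.ofReal_zero,
        (closure_mono fun r hr => ?_).trans hgs⟩
      simpa using hr
    rw [← h _ hT, ← setIntegral_eq_integral_of_forall_compl_eq_zero (s := Ioi 0)]
    · refine integral_congr_ae (Eventually.of_forall fun r => ?_)
      simp [mul_comm]
    · intro r hr
      have : r ∉ tsupport g := fun hmem => hr (hgs hmem)
      rw [image_eq_zero_of_notMem_tsupport this, zero_smul]
  rw [EventuallyEq, ae_restrict_iff' measurableSet_Ioi]
  exact h1

lemma halfLineL2_inner (x y : HalfLineL2) :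
    inner ℂ x y = ∫ r in Ioi 0, conj (x r) * y r := by
  rw [L2.inner_def]
  refine integral_congr_ae (Eventually.of_forall fun r => ?_)
  simp only [RCLike.inner_apply']

/-! ### The operator `T_l³` -/

section
variable (l : ℕ)

lemma exists_isW06_of_mem_domain (x : (radialCube l).domain) : ∃ f g : ℝ → ℂ, IsW06 f g ∧
    ⇑(x : HalfLineL2) =ᵐ[halfLineMeasure] f ∧
    ⇑(radialCube l x) =ᵐ[halfLineMeasure] (radialT l)^[3] f := by
  have h := (radialCube l).mem_graph x
  rw [radialCube_graph] at h
  exact h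

lemma IsW06.exists_mem_domain {f g : ℝ → ℂ} (h : IsW06 f g) : ∃ x : (radialCube l).domain,
    ⇑(x : HalfLineL2) =ᵐ[halfLineMeasure] f ∧
    ⇑(radialCube l x) =ᵐ[halfLineMeasure] (radialT l)^[3] f := by
  have hg : (h.memLp.toLp f, (h.memLp_radialT_cube l).toLp _) ∈ (radialCube l).graph := by
    rw [radialCube_graph]
    exact ⟨f, g, h, h.memLp.coeFn_toLp, (h.memLp_radialT_cube l).coeFn_toLp⟩
  obtain ⟨x, hx1, hx2⟩ := (LinearPMap.mem_graph_iff _).1 hg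
  refine ⟨x, ?_, ?_⟩
  · rw [hx1]; exact h.memLp.coeFn_toLp
  · rw [hx2]; exact (h.memLp_radialT_cube l).coeFn_toLp

lemma radialCube_domain : ((radialCube l).domain : Set HalfLineL2) = sobolevW06 := by
  ext u
  constructor
  · intro hu
    obtain ⟨f, g, h, hf, -⟩ := exists_isW06_of_mem_domain l ⟨u, hu⟩
    exact ⟨f, g, h, hf⟩
  · rintro ⟨f, g, h, hf⟩
    obtain ⟨x, hx, -⟩ := h.exists_mem_domain l
    have : u = x := Lp.ext (hf.trans hx.symm)
    rw [this]
    exact x.2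

/-- The domain contains all test functions, and only zero is orthogonal to these. -/
lemma radialCube_dense : Dense ((radialCube l).domain : Set HalfLineL2) := by
  rw [Submodule.dense_iff_topologicalClosure_eq_top, Submodule.topologicalClosure_eq_top_iff,
    Submodule.eq_bot_iff]
  intro u hu
  rw [Submodule.mem_orthogonal] at hu
  have h0 : ⇑u =ᵐ[halfLineMeasure] 0 := by
    refine ae_eq_zero_of_forall_isTest (MemLp.locallyIntegrableOn_halfLine (Lp.memLp u)) fun φ hφ => ?_
    obtain ⟨x, hx, -⟩ := hφ.conj.isW06.exists_mem_domain l
    have h1 := hu x x.2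
    rw [halfLineL2_inner] at h1
    rw [← h1]
    refine integral_congr_ae ?_
    filter_upwards [hx] with r hr
    rw [hr, Complex.conj_conj, mul_comm]
  exact Lp.ext (h0.trans (Lp.coeFn_zero _ _ _).symm)

/-- Green's formula is bilinear while the inner product is sesquilinear; conjugation of jets links
the two, the coefficients of `T_l³` being real. -/
lemma IsJet.conj {F : ℕ → ℝ → ℂ} (h : IsJet F) : IsJet (fun k r => conj (F k r)) := by
  have hd : ∀ {u : ℝ → ℂ} {u' : ℂ} {r : ℝ}, HasDerivAt u u' r →
      HasDerivAt (fun r => conj (u r)) (conj u') r := fun hu => hu.star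
  refine ⟨fun j hj r hr => hd (h.hasDerivAt j hj r hr), fun a b ha hab => ?_, ?_,
    fun a b ha hab => ?_⟩
  · have := h.ac a b ha hab
    rw [absolutelyContinuousOnInterval_iff] at this ⊢
    simpa only [Complex.dist_conj_conj] using this
  · filter_upwards [h.ae_hasDerivAt] with r hr using hd hr
  · have := h.integrable a b ha hab
    exact ⟨Complex.conjCLE.toContinuousLinearMap.integrable_comp this.1,
      Complex.conjCLE.toContinuousLinearMap.integrable_comp this.2⟩

lemma jetTTT_conj (F : ℕ → ℝ → ℂ) (r : ℝ) :
    jetTTT l (fun k r => conj (F k r)) r = conj (jetTTT l F r) := by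
  have hc : conj (coupling l) = coupling l := by simp [coupling]
  simp only [jetTTT, map_add, map_mul, map_neg, map_sub, map_pow, map_inv₀, Complex.conj_ofReal,
    hc, map_ofNat]

/-- Green's formula for `T_l³` with one smooth factor. -/
lemma IsW06.green_smooth {f g : ℝ → ℂ} (h : IsW06 f g) {q : ℝ → ℂ}
    (hq : ContDiffOn ℝ ∞ q (Ioi 0)) (hq2 : MemLp q 2 halfLineMeasure)
    (hTq : MemLp ((radialT l)^[3] q) 2 halfLineMeasure) :
    ∫ r in Ioi 0, (radialT l)^[3] f r * conj (q r) =
      ∫ r in Ioi 0, f r * conj ((radialT l)^[3] q r) := by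
  have hJ := isJet_iteratedDeriv hq
  have hT := hJ.radialT_cube l
  simp only [iteratedDeriv_zero] at hT
  have hT' : (fun r => conj ((radialT l)^[3] q r)) =ᵐ[halfLineMeasure]
      jetTTT l (fun k r => conj (iteratedDeriv k q r)) := by
    filter_upwards [hT] with r hr
    rw [jetTTT_conj, hr]
  have h2 := h.green l hJ.conj (by simp only [iteratedDeriv_zero]; exact hq2.star)
    (MemLp.ae_eq hT' hTq.star)
  simp only [iteratedDeriv_zero] at h2
  rw [h2]
  refine integral_congr_ae ?_
  filter_upwards [hT'] with r hr
  rw [← hr]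

lemma radialCube_isFormalAdjoint : (radialCube l).IsFormalAdjoint (radialCube l) := by
  intro x y
  obtain ⟨f₁, g₁, h₁, a₁, b₁⟩ := exists_isW06_of_mem_domain l x
  obtain ⟨f₂, g₂, h₂, a₂, b₂⟩ := exists_isW06_of_mem_domain l y
  have hT := h₁.isJet.radialT_cube l
  rw [w06Jet_zero] at hT
  have hconj : ∀ {u : ℝ → ℂ}, MemLp u 2 halfLineMeasure →
      MemLp (fun r => conj (u r)) 2 halfLineMeasure := fun hu => hu.star
  have key := h₂.green l h₁.isJet.conj (by rw [w06Jet_zero]; exact hconj h₁.memLp) (by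
    have : jetTTT l (fun k r => conj (w06Jet f₁ g₁ k r)) =
        fun r => conj (jetTTT l (w06Jet f₁ g₁) r) := funext fun r => jetTTT_conj l _ r
    rw [this]
    exact hconj (h₁.isJet.memLp_jetTTT l h₁.memLp_jetSize))
  rw [w06Jet_zero] at key
  rw [halfLineL2_inner, halfLineL2_inner]
  calc ∫ r in Ioi 0, conj (radialCube l x r) * (y : HalfLineL2) r
      = ∫ r in Ioi 0, f₂ r * jetTTT l (fun k r => conj (w06Jet f₁ g₁ k r)) r := by
        refine integral_congr_ae ?_
        filter_upwards [b₁, a₂, hT] with r h1 h2 h3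
        rw [h1, h2, h3, jetTTT_conj, mul_comm]
    _ = ∫ r in Ioi 0, (radialT l)^[3] f₂ r * conj (f₁ r) := key.symm
    _ = _ := by
        refine integral_congr_ae ?_
        filter_upwards [a₁, b₂] with r h1 h2
        rw [h1, h2, mul_comm]

end

/-! ### Kernels of adjoints -/

/-- The kernel of the adjoint is the orthogonal complement of the range. Density of the domain makes
the adjoint single-valued. -/
lemma mem_adjointKernel_iff {H : Type*} [NormedAddCommGroup H] [InnerProductSpace ℂ H]
    [CompleteSpace H] {A : H →ₗ.[ℂ] H} (hA : Dense (A.domain : Set H)) (z : ℂ) (u : H) :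
    u ∈ adjointKernel A z ↔ ∀ x : A.domain, inner ℂ u (A x + z • (x : H)) = 0 := by
  set B : H →ₗ.[ℂ] H := (z • (LinearMap.id : H →ₗ[ℂ] H)) +ᵥ A with hB
  have hBd : Dense (B.domain : Set H) := hA
  have hBx : ∀ x : A.domain, B x = A x + z • (x : H) := fun x =>
    (LinearPMap.vadd_apply (z • (LinearMap.id : H →ₗ[ℂ] H)) A x).trans (by simp [add_comm])
  simp only [adjointKernel, Submodule.mem_map, LinearMap.mem_ker]
  constructor
  · rintro ⟨y, hy, rfl⟩ x
    have h := LinearPMap.adjoint_isFormalAdjoint hBd y x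
    rw [← hBx x]
    refine h.symm.trans ?_
    have hy' : B† y = 0 := hy
    rw [hy', inner_zero_left]
  · intro h
    have h' : ∀ x : B.domain, inner ℂ (0 : H) (x : H) = inner ℂ u (B x) := fun x => by
      rw [inner_zero_left, hBx x, h x]
    exact ⟨⟨u, LinearPMap.mem_adjoint_domain_of_exists u ⟨0, h'⟩⟩,
      LinearPMap.adjoint_apply_eq hBd _ h', rfl⟩

lemma mem_adjointKernel_radialCube_iff (l : ℕ) (z : ℂ) (u : HalfLineL2) :
    u ∈ adjointKernel (radialCube l) z ↔ ∀ f g : ℝ → ℂ, IsW06 f g →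
      ∫ r in Ioi 0, conj (u r) * ((radialT l)^[3] f r + z * f r) = 0 := by
  have key : ∀ (x : (radialCube l).domain) (f : ℝ → ℂ),
      ⇑(x : HalfLineL2) =ᵐ[halfLineMeasure] f →
      ⇑(radialCube l x) =ᵐ[halfLineMeasure] (radialT l)^[3] f →
      inner ℂ u (radialCube l x + z • (x : HalfLineL2)) =
        ∫ r in Ioi 0, conj (u r) * ((radialT l)^[3] f r + z * f r) := by
    intro x f h1 h2
    rw [halfLineL2_inner]
    refine integral_congr_ae ?_
    filter_upwards [h1, h2, Lp.coeFn_add (radialCube l x) (z • (x : HalfLineL2)),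
      Lp.coeFn_smul z (x : HalfLineL2)] with r a b c d
    rw [c, Pi.add_apply, d, Pi.smul_apply, a, b, smul_eq_mul]
  rw [mem_adjointKernel_iff (radialCube_dense l)]
  constructor
  · intro h f g hfg
    obtain ⟨x, h1, h2⟩ := hfg.exists_mem_domain l
    rw [← key x f h1 h2, h x]
  · intro h x
    obtain ⟨f, g, hfg, h1, h2⟩ := exists_isW06_of_mem_domain l x
    rw [key x f h1 h2, h f g hfg]

/-! ### The operation `D_l` -/

/-- The regular factor of `D_l w`: `D_l w = r^(-l) G_l w` with `G_{l+1} = r G_l' - (2 l + 1) G_l`. -/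
noncomputable def besselG : ℕ → (ℝ → ℂ) → ℝ → ℂ
  | 0, w => w
  | l + 1, w => fun r => (r : ℂ) * deriv (besselG l w) r - (2 * l + 1) * besselG l w r

section
variable {w : ℝ → ℂ}

lemma contDiff_ofReal : ContDiff ℝ ∞ (fun r : ℝ => (r : ℂ)) := Complex.ofRealCLM.contDiff

lemma contDiff_besselG (hw : ContDiff ℝ ∞ w) (l : ℕ) : ContDiff ℝ ∞ (besselG l w) := by
  induction l with
  | zero => exact hw
  | succ l ih =>
    exact (contDiff_ofReal.mul (contDiff_infty_iff_deriv.1 ih).2).sub (contDiff_const.mul ih)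

lemma besselD_zero_eqOn (w : ℝ → ℂ) : EqOn (besselD 0 w) w (Ioi 0) := by
  intro r hr
  have : (r : ℂ) ≠ 0 := by exact_mod_cast (ne_of_gt hr)
  simp only [besselD, Function.iterate_zero, id]
  field_simp
  ring

/-- By induction the `l`-fold iterate of `r⁻¹ d/dr` on `w / r` equals `r^{-(2l+1)} G_l w`.
Differentiating the power produces the term `-(2l+1) G_l` of the recursion, and the prefactor
`r^{l+1}` leaves `r^{-l}`. -/
lemma besselD_eqOn_mul_besselG (hw : ContDiff ℝ ∞ w) (l : ℕ) :
    EqOn (besselD l w) (fun r => (r : ℂ)⁻¹ ^ l * besselG l w r) (Ioi 0) := by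
  have key : ∀ l, EqOn ((fun (h : ℝ → ℂ) (s : ℝ) => (s : ℂ)⁻¹ * deriv h s)^[l]
      (fun s : ℝ => w s / s)) (fun r => (r : ℂ)⁻¹ ^ (2 * l + 1) * besselG l w r) (Ioi 0) := by
    intro l
    induction l with
    | zero =>
      intro r _
      simp [besselG, div_eq_mul_inv, mul_comm]
    | succ l ih =>
      intro r hr
      have hr' : (r : ℂ) ≠ 0 := by exact_mod_cast (ne_of_gt hr)
      rw [Function.iterate_succ_apply']
      have e := (ih.eventuallyEq_of_mem (isOpen_Ioi.mem_nhds hr)).deriv_eq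
      have hG : HasDerivAt (besselG l w) (deriv (besselG l w) r) r :=
        (((contDiff_besselG hw l).differentiable (by simp)) r).hasDerivAt
      have h2 := ((hasDerivAt_ofReal_inv_pow (2 * l + 1) hr).mul hG).deriv
      simp only [e]
      rw [show (fun r : ℝ => (r : ℂ)⁻¹ ^ (2 * l + 1) * besselG l w r) =
        (fun r : ℝ => (r : ℂ)⁻¹ ^ (2 * l + 1)) * besselG l w from rfl, h2]
      simp only [besselG, show 2 * (l + 1) + 1 = 2 * l + 1 + 1 + 1 by ring, pow_succ]
      push_cast
      field_simp
      ring
  intro r hr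
  have hr' : (r : ℂ) ≠ 0 := by exact_mod_cast (ne_of_gt hr)
  simp only [besselD]
  rw [key l hr]
  simp only [inv_pow]
  field_simp
  ring

lemma contDiffOn_besselD (hw : ContDiff ℝ ∞ w) (l : ℕ) :
    ContDiffOn ℝ ∞ (besselD l w) (Ioi 0) :=
  ((contDiffOn_ofReal_inv.pow l).mul (contDiff_besselG hw l).contDiffOn).congr
    (besselD_eqOn_mul_besselG hw l)

lemma hasDerivAt_besselD (hw : ContDiff ℝ ∞ w) (l : ℕ) {r : ℝ} (hr : 0 < r) :
    HasDerivAt (besselD l w) (deriv (besselD l w) r) r :=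
  (((contDiffOn_besselD hw l).differentiableOn (by simp)).differentiableAt
    (isOpen_Ioi.mem_nhds hr)).hasDerivAt

/-- With `A = d/dr - (l+1)/r` and `A^* = -d/dr - (l+1)/r` one has `T_l = A^* A` and `T_{l+1} = A
A^*`. This ladder carries solutions from `l` to `l + 1`. -/
lemma besselD_succ (hw : ContDiff ℝ ∞ w) (l : ℕ) {r : ℝ} (hr : 0 < r) :
    besselD (l + 1) w r = deriv (besselD l w) r - (l + 1) * (r : ℂ)⁻¹ * besselD l w r := by
  have hr' : (r : ℂ) ≠ 0 := by exact_mod_cast hr.ne'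
  have hG : HasDerivAt (besselG l w) (deriv (besselG l w) r) r :=
    (((contDiff_besselG hw l).differentiable (by simp)) r).hasDerivAt
  have h2 := ((hasDerivAt_ofReal_inv_pow l hr).mul hG).deriv
  have e := ((besselD_eqOn_mul_besselG hw l).eventuallyEq_of_mem (isOpen_Ioi.mem_nhds hr)).deriv_eq
  rw [e, besselD_eqOn_mul_besselG hw (l + 1) hr, besselD_eqOn_mul_besselG hw l hr]
  rw [show (fun r : ℝ => (r : ℂ)⁻¹ ^ l * besselG l w r) =
    (fun r : ℝ => (r : ℂ)⁻¹ ^ l) * besselG l w from rfl, h2]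
  simp only [besselG, pow_succ, Pi.mul_apply]
  field_simp
  ring

lemma besselG_sum {ι : Type*} (s : Finset ι) (c : ι → ℂ) {v : ι → ℝ → ℂ}
    (hv : ∀ i, ContDiff ℝ ∞ (v i)) (l : ℕ) :
    besselG l (fun r => ∑ i ∈ s, c i * v i r) = fun r => ∑ i ∈ s, c i * besselG l (v i) r := by
  induction l with
  | zero => rfl
  | succ l ih =>
    funext r
    have hd : HasDerivAt (fun r => ∑ i ∈ s, c i * besselG l (v i) r)
        (∑ i ∈ s, c i * deriv (besselG l (v i)) r) r :=
      HasDerivAt.fun_sum fun i _ =>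
        ((((contDiff_besselG (hv i) l).differentiable (by simp)) r).hasDerivAt).const_mul _
    simp only [besselG, ih, hd.deriv, Finset.mul_sum, ← Finset.sum_sub_distrib]
    exact Finset.sum_congr rfl fun i _ => by ring

lemma besselD_sum {ι : Type*} (s : Finset ι) (c : ι → ℂ) {v : ι → ℝ → ℂ}
    (hv : ∀ i, ContDiff ℝ ∞ (v i)) (l : ℕ) :
    EqOn (besselD l (fun r => ∑ i ∈ s, c i * v i r)) (fun r => ∑ i ∈ s, c i * besselD l (v i) r)
      (Ioi 0) := by
  intro r hr
  have hs : ContDiff ℝ ∞ (fun r => ∑ i ∈ s, c i * v i r) :=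
    ContDiff.sum fun i _ => contDiff_const.mul (hv i)
  simp only [besselD_eqOn_mul_besselG hs l hr, besselG_sum s c hv l, Finset.mul_sum]
  exact Finset.sum_congr rfl fun i _ => by rw [besselD_eqOn_mul_besselG (hv i) l hr]; ring

/-- The coefficient of `D_l` on `r^n`. -/
noncomputable def besselCoeff (l n : ℕ) : ℂ := ∏ k ∈ Finset.range l, ((n : ℂ) - (2 * k + 1))

lemma besselCoeff_ne_zero (l : ℕ) {n : ℕ} (hn : Even n) : besselCoeff l n ≠ 0 := by
  refine Finset.prod_ne_zero_iff.2 fun k _ h => ?_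
  have h1 : (n : ℂ) = ((2 * k + 1 : ℕ) : ℂ) := by
    push_cast
    exact sub_eq_zero.1 h
  have h2 : n = 2 * k + 1 := by exact_mod_cast h1
  obtain ⟨m, rfl⟩ := hn
  omega

lemma besselCoeff_eq_zero {l n : ℕ} (hnl : n < l) (hn : ¬Even n) : besselCoeff l n = 0 := by
  obtain ⟨k, rfl⟩ := Nat.not_even_iff_odd.1 hn
  refine Finset.prod_eq_zero (i := k) (Finset.mem_range.2 (by omega)) ?_
  push_cast
  ring

lemma iteratedDeriv_ofReal_mul_deriv {G : ℝ → ℂ} (hG : ContDiff ℝ ∞ G) (n : ℕ) :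
    iteratedDeriv n (fun r : ℝ => (r : ℂ) * deriv G r) =
      fun r : ℝ => (r : ℂ) * iteratedDeriv (n + 1) G r + n * iteratedDeriv n G r := by
  induction n with
  | zero => funext r; simp [iteratedDeriv_one]
  | succ n ih =>
    funext r
    have h1 := hasDerivAt_iteratedDeriv_of_contDiff hG (n + 1) r
    have h2 := hasDerivAt_iteratedDeriv_of_contDiff hG n r
    have h3 : HasDerivAt (fun r : ℝ => (r : ℂ)) 1 r := Complex.ofRealCLM.hasDerivAt
    have h4 := (h3.mul h1).add (h2.const_mul (n : ℂ))
    rw [iteratedDeriv_succ, ih]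
    refine h4.deriv.trans ?_
    push_cast
    ring

/-- The Euler operator `r d/dr` multiplies the `n`-th Taylor coefficient at `0` by `n`, so the step
from `G_l` to `G_{l+1}` multiplies it by `n - (2l+1)`. -/
lemma iteratedDeriv_besselG_zero (hw : ContDiff ℝ ∞ w) (l n : ℕ) :
    iteratedDeriv n (besselG l w) 0 = besselCoeff l n * iteratedDeriv n w 0 := by
  induction l with
  | zero => simp [besselG, besselCoeff]
  | succ l ih =>
    have hG := contDiff_besselG hw l
    have h1 : ContDiff ℝ n (fun r : ℝ => (r : ℂ) * deriv (besselG l w) r) :=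
      contDiff_infty.1 (contDiff_ofReal.mul (contDiff_infty_iff_deriv.1 hG).2) n
    have h2 : ContDiff ℝ n (fun r : ℝ => (2 * l + 1 : ℂ) * besselG l w r) :=
      contDiff_infty.1 (contDiff_const.mul hG) n
    have e : besselG (l + 1) w = (fun r : ℝ => (r : ℂ) * deriv (besselG l w) r) -
      (fun r : ℝ => (2 * l + 1 : ℂ) * besselG l w r) := rfl
    rw [e, iteratedDeriv_sub h1.contDiffAt h2.contDiffAt, iteratedDeriv_ofReal_mul_deriv hG,
      iteratedDeriv_const_mul_field, ih, besselCoeff, besselCoeff, Finset.prod_range_succ]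
    simp only [Complex.ofReal_zero, zero_mul, zero_add, ih, besselCoeff]
    ring

end

/-! ### Behaviour at the origin -/

lemma exists_taylor_bound {G : ℝ → ℂ} (hG : ContDiff ℝ ∞ G) (n : ℕ) : ∃ C : ℝ, ∀ r ∈ Icc (0 : ℝ) 1,
    ‖G r - ∑ k ∈ Finset.range (n + 1), ((k.factorial : ℝ)⁻¹ * r ^ k) • iteratedDeriv k G 0‖ ≤
      C * r ^ (n + 1) := by
  obtain ⟨C, hC⟩ := exists_taylor_mean_remainder_bound (f := G) (n := n) (zero_le_one (α := ℝ))
    ((contDiff_infty.1 hG (n + 1)).contDiffOn)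
  refine ⟨C, fun r hr => ?_⟩
  have h := hC r hr
  rw [taylor_within_apply, sub_zero] at h
  convert! h using 5 with k hk
  exact (iteratedDerivWithin_eq_iteratedDeriv (uniqueDiffOn_Icc zero_lt_one)
    (contDiff_infty.1 hG _).contDiffAt (by simp)).symm

section
variable {w : ℝ → ℂ}

/-- Odd orders below `l` are annihilated by `G_l` and even ones by hypothesis, so `G_l w = O(r^l)`,
which compensates the factor `r^{-l}`. -/
lemma exists_besselD_bound (hw : ContDiff ℝ ∞ w) (l : ℕ)
    (h0 : ∀ n < l, Even n → iteratedDeriv n w 0 = 0) :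
    ∃ C : ℝ, ∀ r ∈ Ioc (0 : ℝ) 1, ‖besselD l w r‖ ≤ C := by
  have hz : ∀ n < l, iteratedDeriv n (besselG l w) 0 = 0 := by
    intro n hn
    rw [iteratedDeriv_besselG_zero hw]
    by_cases he : Even n
    · rw [h0 n hn he, mul_zero]
    · rw [besselCoeff_eq_zero hn he, zero_mul]
  have key : ∃ C : ℝ, ∀ r ∈ Icc (0 : ℝ) 1, ‖besselG l w r‖ ≤ C * r ^ l := by
    -- The Taylor polynomial in use has degree `l - 1`, so `l = 0` is separate.
    rcases l with _ | n
    · obtain ⟨C, hC⟩ := (isCompact_Icc (a := (0 : ℝ)) (b := 1)).exists_bound_of_continuousOn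
        (contDiff_besselG hw 0).continuous.continuousOn
      exact ⟨C, by simpa using hC⟩
    · obtain ⟨C, hC⟩ := exists_taylor_bound (contDiff_besselG hw (n + 1)) n
      refine ⟨C, fun r hr => ?_⟩
      have h := hC r hr
      rwa [Finset.sum_eq_zero, sub_zero] at h
      intro k hk
      rw [hz k (Finset.mem_range.1 hk), smul_zero]
  obtain ⟨C, hC⟩ := key
  refine ⟨C, fun r hr => ?_⟩
  have hr0 : 0 < r := hr.1
  rw [besselD_eqOn_mul_besselG hw l hr.1, norm_mul, norm_pow, norm_inv, Complex.norm_real,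
    Real.norm_of_nonneg hr0.le]
  calc r⁻¹ ^ l * ‖besselG l w r‖ ≤ r⁻¹ ^ l * (C * r ^ l) := by
        gcongr
        exact hC r ⟨hr0.le, hr.2⟩
    _ = C := by
        rw [inv_pow]
        field_simp

lemma not_memLp_inv {δ : ℝ} (hδ : 0 < δ) :
    ¬MemLp (fun r : ℝ => r⁻¹) 2 (volume.restrict (Ioo 0 δ)) := by
  intro h
  have h1 := h.integrable_sq
  have h2 : IntegrableOn (fun r : ℝ => r ^ (-2 : ℝ)) (Ioo 0 δ) := by
    refine h1.congr ?_
    filter_upwards [ae_restrict_mem measurableSet_Ioo] with r hr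
    rw [Real.rpow_neg hr.1.le, inv_pow]
    norm_num
  rw [intervalIntegral.integrableOn_Ioo_rpow_iff hδ] at h2
  norm_num at h2

/-- If `n < l` is the first order at which `G_l w` has a nonzero derivative at `0`, then `|D_l w| ≥
c r^{n-l} ≥ c r^{-1}` near `0`, which is not square integrable. The coefficient of `D_l` at even
orders is nonzero, so the vanishing passes from `G_l w` to `w`. -/
lemma iteratedDeriv_eq_zero_of_memLp_besselD (hw : ContDiff ℝ ∞ w) (l : ℕ)
    (h2 : MemLp (besselD l w) 2 halfLineMeasure) {n : ℕ} (hn : n < l) (he : Even n) :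
    iteratedDeriv n w 0 = 0 := by
  have hG := contDiff_besselG hw l
  have key : ∀ n < l, iteratedDeriv n (besselG l w) 0 = 0 := by
    intro n
    induction n using Nat.strong_induction_on with
    | _ n ih =>
    intro hn
    by_contra hne
    set g := iteratedDeriv n (besselG l w) 0 with hg
    obtain ⟨C, hC⟩ := exists_taylor_bound hG n
    set a : ℝ := (n.factorial : ℝ)⁻¹ * ‖g‖ with ha
    have ha0 : 0 < a := by
      have := norm_pos_iff.2 hne
      positivity
    -- For `r < δ` the remainder `C r^{n+1}` is at most half of the leading term `a r^n`; the `+ 1`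
    -- covers `C = 0`.
    set δ : ℝ := min 1 (a / (2 * (|C| + 1))) with hδ
    have hδ0 : 0 < δ := lt_min one_pos (by positivity)
    have hlow : ∀ r ∈ Ioo 0 δ, a / 2 * r⁻¹ ≤ ‖besselD l w r‖ := by
      intro r hr
      have hr0 : 0 < r := hr.1
      have hr1 : r ≤ 1 := hr.2.le.trans (min_le_left _ _)
      have h := hC r ⟨hr0.le, hr1⟩
      rw [Finset.sum_range_succ, Finset.sum_eq_zero, zero_add] at h
      swap
      · intro k hk
        have hk' := Finset.mem_range.1 hk
        rw [ih k hk' (hk'.trans hn), smul_zero]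
      have e1 : ‖((n.factorial : ℝ)⁻¹ * r ^ n) • g‖ = a * r ^ n := by
        rw [norm_smul, Real.norm_of_nonneg (by positivity), ha]
        ring
      have h3 : a * r ^ n - ‖besselG l w r‖ ≤ C * r ^ (n + 1) := by
        rw [← e1]
        refine le_trans ?_ h
        rw [norm_sub_rev]
        exact norm_sub_norm_le _ _
      have h4 : C * r ^ (n + 1) ≤ a / 2 * r ^ n := by
        have h5 : (|C| + 1) * r ≤ a / 2 := by
          have := hr.2.le.trans (min_le_right _ _)
          rw [le_div_iff₀ (by positivity)] at this
          linarith
        calc C * r ^ (n + 1) ≤ (|C| + 1) * r ^ (n + 1) := by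
              gcongr
              linarith [le_abs_self C]
          _ = (|C| + 1) * r * r ^ n := by ring
          _ ≤ _ := by gcongr
      have h6 : a / 2 * r ^ n ≤ ‖besselG l w r‖ := by linarith
      rw [besselD_eqOn_mul_besselG hw l hr0, norm_mul, norm_pow, norm_inv, Complex.norm_real,
        Real.norm_of_nonneg hr0.le]
      calc a / 2 * r⁻¹ = a / 2 * r⁻¹ ^ 1 := by rw [pow_one]
        _ ≤ a / 2 * r⁻¹ ^ (l - n) := by
          gcongr
          · exact (one_le_inv₀ hr0).2 hr1
          · omega
        _ = r⁻¹ ^ l * (a / 2 * r ^ n) := by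
          rw [show l = (l - n) + n by omega, Nat.add_sub_cancel, pow_add, inv_pow, inv_pow]
          field_simp
        _ ≤ _ := by gcongr
    refine not_memLp_inv hδ0 ?_
    have hm : MemLp (besselD l w) 2 (volume.restrict (Ioo 0 δ)) :=
      h2.mono_measure (Measure.restrict_mono Ioo_subset_Ioi_self le_rfl)
    refine (hm.norm.const_mul (2 / a)).mono measurable_inv.aestronglyMeasurable ?_
    filter_upwards [ae_restrict_mem measurableSet_Ioo] with r hr
    have hr0 : 0 < r := hr.1
    rw [Real.norm_of_nonneg (by positivity), Real.norm_of_nonneg (by positivity)]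
    calc r⁻¹ = 2 / a * (a / 2 * r⁻¹) := by field_simp
      _ ≤ _ := by
        gcongr
        exact hlow r hr
  have h := key n hn
  rw [iteratedDeriv_besselG_zero hw] at h
  exact (mul_eq_zero.1 h).resolve_left (besselCoeff_ne_zero l he)

end

/-! ### Exponential solutions -/

/-- The solution `D_l e^{μ r}` of `T_l u = -μ² u`. -/
noncomputable def besselExp (l : ℕ) (μ : ℂ) : ℝ → ℂ := besselD l fun r => Complex.exp (μ * r)

section
variable (l : ℕ) (μ : ℂ)

lemma hasDerivAt_exp_mul_ofReal (r : ℝ) :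
    HasDerivAt (fun r : ℝ => Complex.exp (μ * r)) (μ * Complex.exp (μ * r)) r := by
  have h1 : HasDerivAt (fun z : ℂ => Complex.exp (μ * z)) (Complex.exp (μ * r) * (μ * 1)) (r : ℂ) :=
    ((hasDerivAt_id (r : ℂ)).const_mul μ).cexp
  convert! h1.comp_ofReal using 1
  ring

lemma contDiff_exp_mul_ofReal : ContDiff ℝ ∞ (fun r : ℝ => Complex.exp (μ * r)) :=
  (contDiff_const.mul contDiff_ofReal).cexp

lemma contDiffOn_besselExp : ContDiffOn ℝ ∞ (besselExp l μ) (Ioi 0) :=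
  contDiffOn_besselD (contDiff_exp_mul_ofReal μ) l

lemma hasDerivAt_besselExp {r : ℝ} (hr : 0 < r) :
    HasDerivAt (besselExp l μ) (deriv (besselExp l μ) r) r :=
  hasDerivAt_besselD (contDiff_exp_mul_ofReal μ) l hr

lemma besselExp_succ {r : ℝ} (hr : 0 < r) :
    besselExp (l + 1) μ r =
      deriv (besselExp l μ) r - (l + 1) * (r : ℂ)⁻¹ ^ 1 * besselExp l μ r := by
  rw [pow_one]
  exact besselD_succ (contDiff_exp_mul_ofReal μ) l hr

lemma besselExp_zero_eqOn : EqOn (besselExp 0 μ) (fun r => Complex.exp (μ * r)) (Ioi 0) :=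
  besselD_zero_eqOn _

/-- The lowering half of the ladder: applying `A^*` to `D_{l+1} e^{μr} = A D_l e^{μr}` gives `T_l
D_l e^{μr} = -μ² D_l e^{μr}`. -/
lemma deriv_besselExp_succ_of_ode {r : ℝ} (hr : 0 < r)
    (h : HasDerivAt (deriv (besselExp l μ))
      ((coupling l * (r : ℂ)⁻¹ ^ 2 + μ ^ 2) * besselExp l μ r) r) :
    HasDerivAt (besselExp (l + 1) μ)
      (μ ^ 2 * besselExp l μ r - (l + 1) * (r : ℂ)⁻¹ ^ 1 * besselExp (l + 1) μ r) r := by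
  have h1 := h.sub (((hasDerivAt_ofReal_inv_pow 1 hr).const_mul ((l : ℂ) + 1)).mul
    (hasDerivAt_besselExp l μ hr))
  have e : besselExp (l + 1) μ =ᶠ[𝓝 r] deriv (besselExp l μ) -
      (fun s : ℝ => ((l : ℂ) + 1) * (s : ℂ)⁻¹ ^ 1) * besselExp l μ := by
    filter_upwards [isOpen_Ioi.mem_nhds hr] with s hs using besselExp_succ l μ hs
  convert! h1.congr_of_eventuallyEq e using 1
  rw [besselExp_succ l μ hr, coupling]
  push_cast
  ring

lemma hasDerivAt_deriv_besselExp {r : ℝ} (hr : 0 < r) :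
    HasDerivAt (deriv (besselExp l μ))
      ((coupling l * (r : ℂ)⁻¹ ^ 2 + μ ^ 2) * besselExp l μ r) r := by
  induction l generalizing r with
  | zero =>
    have e0 : ∀ {s : ℝ}, 0 < s → besselExp 0 μ =ᶠ[𝓝 s] fun r => Complex.exp (μ * r) := fun hs =>
      (besselExp_zero_eqOn μ).eventuallyEq_of_mem (isOpen_Ioi.mem_nhds hs)
    have e1 : deriv (besselExp 0 μ) =ᶠ[𝓝 r] fun r => μ * Complex.exp (μ * r) := by
      filter_upwards [isOpen_Ioi.mem_nhds hr] with s hs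
      rw [(e0 hs).deriv_eq, (hasDerivAt_exp_mul_ofReal μ s).deriv]
    convert! ((hasDerivAt_exp_mul_ofReal μ r).const_mul μ).congr_of_eventuallyEq e1 using 1
    rw [besselExp_zero_eqOn μ hr, coupling]
    push_cast
    ring
  | succ l ih =>
    have e : deriv (besselExp (l + 1) μ) =ᶠ[𝓝 r] (fun s => μ ^ 2 * besselExp l μ s) -
        (fun s : ℝ => ((l : ℂ) + 1) * (s : ℂ)⁻¹ ^ 1) * besselExp (l + 1) μ := by
      filter_upwards [isOpen_Ioi.mem_nhds hr] with s hs
      exact (deriv_besselExp_succ_of_ode l μ hs (ih hs)).deriv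
    have h1 := ((hasDerivAt_besselExp l μ hr).const_mul (μ ^ 2)).sub
      (((hasDerivAt_ofReal_inv_pow 1 hr).const_mul ((l : ℂ) + 1)).mul
        (deriv_besselExp_succ_of_ode l μ hr (ih hr)))
    convert! h1.congr_of_eventuallyEq e using 1
    have e2 : deriv (besselExp l μ) r =
        besselExp (l + 1) μ r + (l + 1) * (r : ℂ)⁻¹ ^ 1 * besselExp l μ r := by
      rw [besselExp_succ l μ hr]
      ring
    rw [e2, coupling]
    push_cast
    ring

/-- The Wronskian of `D_l e^{μ r}` and `D_l e^{-μ r}`. -/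
lemma besselExp_wronskian {r : ℝ} (hr : 0 < r) :
    besselExp l μ r * deriv (besselExp l (-μ)) r - deriv (besselExp l μ) r * besselExp l (-μ) r =
      (-μ ^ 2) ^ l * (-2 * μ) := by
  induction l with
  | zero =>
    have e : ∀ ν : ℂ, deriv (besselExp 0 ν) r = ν * Complex.exp (ν * r) := fun ν => by
      rw [((besselExp_zero_eqOn ν).eventuallyEq_of_mem (isOpen_Ioi.mem_nhds hr)).deriv_eq,
        (hasDerivAt_exp_mul_ofReal ν r).deriv]
    rw [e, e, besselExp_zero_eqOn μ hr, besselExp_zero_eqOn (-μ) hr]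
    have h1 : Complex.exp (μ * r) * Complex.exp (-μ * r) = 1 := by
      rw [← Complex.exp_add]
      simp
    simp only [pow_zero, one_mul]
    linear_combination (-2 * μ) * h1
  | succ l ih =>
    have e : ∀ ν : ℂ, deriv (besselExp (l + 1) ν) r =
        ν ^ 2 * besselExp l ν r - (l + 1) * (r : ℂ)⁻¹ ^ 1 * besselExp (l + 1) ν r := fun ν =>
      (deriv_besselExp_succ_of_ode l ν hr (hasDerivAt_deriv_besselExp l ν hr)).deriv
    rw [e, e, besselExp_succ l μ hr, besselExp_succ l (-μ) hr, pow_succ]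
    -- The two ladder relations express the Wronskian at `l + 1` as `-μ²` times the one at `l`; both
    -- `±μ` have the same square.
    linear_combination (-μ ^ 2) * ih

/-- The polynomials `Q_l` with `D_l e^{μ r} = e^{μ r} Q_l(1/r)`. -/
noncomputable def besselQ (μ : ℂ) : ℕ → Polynomial ℂ
  | 0 => 1
  | l + 1 => Polynomial.C μ * besselQ μ l - Polynomial.X ^ 2 * (besselQ μ l).derivative -
      Polynomial.C (l + 1 : ℂ) * Polynomial.X * besselQ μ l

lemma besselQ_eval_zero : (besselQ μ l).eval 0 = μ ^ l := by
  induction l with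
  | zero => simp [besselQ]
  | succ l ih => simp [besselQ, ih, pow_succ, mul_comm]

lemma besselExp_eqOn : EqOn (besselExp l μ)
    (fun r => Complex.exp (μ * r) * (besselQ μ l).eval (r : ℂ)⁻¹) (Ioi 0) := by
  induction l with
  | zero =>
    intro r hr
    simp [besselExp_zero_eqOn μ hr, besselQ]
  | succ l ih =>
    intro r hr
    have hr' : (r : ℂ) ≠ 0 := by exact_mod_cast (ne_of_gt hr)
    have h1 : HasDerivAt (fun r : ℝ => (besselQ μ l).eval (r : ℂ)⁻¹)
        ((besselQ μ l).derivative.eval (r : ℂ)⁻¹ * -((r : ℂ) ^ 2)⁻¹) r :=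
      (((besselQ μ l).hasDerivAt _).comp (r : ℂ) (hasDerivAt_inv hr')).comp_ofReal
    have h2 := ((hasDerivAt_exp_mul_ofReal μ r).mul h1).deriv
    rw [besselExp_succ l μ hr, (ih.eventuallyEq_of_mem (isOpen_Ioi.mem_nhds hr)).deriv_eq, ih hr]
    refine (congrArg₂ _ h2 rfl).trans ?_
    simp only [besselQ, Polynomial.eval_sub, Polynomial.eval_mul, Polynomial.eval_C,
      Polynomial.eval_X, Polynomial.eval_pow, inv_pow]
    ring

lemma tendsto_besselExp_mul_exp :
    Tendsto (fun r : ℝ => besselExp l μ r * Complex.exp (-μ * r)) atTop (𝓝 (μ ^ l)) := by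
  have h1 : Tendsto (fun r : ℝ => (r : ℂ)⁻¹) atTop (𝓝 0) := by
    have := (Complex.continuous_ofReal.tendsto 0).comp tendsto_inv_atTop_zero
    simpa [Function.comp_def] using this
  have h2 := ((besselQ μ l).continuous.tendsto 0).comp h1
  rw [besselQ_eval_zero] at h2
  refine h2.congr' ?_
  filter_upwards [eventually_gt_atTop 0] with r hr
  rw [besselExp_eqOn l μ hr, mul_right_comm, ← Complex.exp_add]
  simp

lemma exists_besselExp_bound :
    ∃ C : ℝ, ∀ r : ℝ, 1 ≤ r → ‖besselExp l μ r‖ ≤ C * Real.exp (μ.re * r) := by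
  obtain ⟨C, hC⟩ := (isCompact_closedBall (0 : ℂ) 1).exists_bound_of_continuousOn
    (besselQ μ l).continuous.continuousOn
  refine ⟨C, fun r hr => ?_⟩
  have hr0 : 0 < r := by linarith
  rw [besselExp_eqOn l μ hr0, norm_mul, Complex.norm_exp, mul_comm]
  have e : (μ * r).re = μ.re * r := by simp
  rw [e]
  gcongr
  refine hC _ ?_
  rw [mem_closedBall_zero_iff, norm_inv, Complex.norm_real, Real.norm_of_nonneg hr0.le]
  exact inv_le_one_of_one_le₀ hr

end

/-! ### Linear combinations of exponential solutions -/

section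
variable {ι : Type*} (s : Finset ι) (l : ℕ) (c μ : ι → ℂ)

lemma contDiffOn_sum_besselExp :
    ContDiffOn ℝ ∞ (fun r => ∑ i ∈ s, c i * besselExp l (μ i) r) (Ioi 0) :=
  ContDiffOn.sum fun i _ => contDiffOn_const.mul (contDiffOn_besselExp l (μ i))

lemma radialT_sum_besselExp :
    EqOn (radialT l (fun r => ∑ i ∈ s, c i * besselExp l (μ i) r))
      (fun r => ∑ i ∈ s, (c i * -μ i ^ 2) * besselExp l (μ i) r) (Ioi 0) := by
  intro r hr
  refine radialT_apply_of_hasDerivAt l hr (u' := fun r => ∑ i ∈ s, c i * deriv (besselExp l (μ i)) r)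
    (fun t ht => HasDerivAt.fun_sum fun i _ => (hasDerivAt_besselExp l (μ i) ht).const_mul _) ?_
  convert! HasDerivAt.fun_sum fun i (_ : i ∈ s) =>
    (hasDerivAt_deriv_besselExp l (μ i) hr).const_mul (c i) using 1
  rw [Finset.mul_sum, Finset.mul_sum, ← Finset.sum_neg_distrib, ← Finset.sum_add_distrib]
  exact Finset.sum_congr rfl fun i _ => by ring

lemma radialT_cube_sum_besselExp :
    EqOn ((radialT l)^[3] (fun r => ∑ i ∈ s, c i * besselExp l (μ i) r))
      (fun r => ∑ i ∈ s, (c i * -μ i ^ 6) * besselExp l (μ i) r) (Ioi 0) := by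
  have h1 := radialT_congr (l := l) (radialT_sum_besselExp s l c μ)
  have h2 := h1.trans (radialT_sum_besselExp s l _ μ)
  refine ((radialT_congr (l := l) h2).trans (radialT_sum_besselExp s l _ μ)).trans fun r _ => ?_
  exact Finset.sum_congr rfl fun i _ => by ring

variable {s l c μ}

/-- The dominant behaviour at infinity. -/
lemma exists_dominant_besselExp (hinj : Set.InjOn (fun i => (μ i).re) s)
    (hc : ∃ i ∈ s, c i ≠ 0) : ∃ i ∈ s, c i ≠ 0 ∧ (∀ j ∈ s, c j ≠ 0 → (μ j).re ≤ (μ i).re) ∧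
      Tendsto (fun r : ℝ => (∑ j ∈ s, c j * besselExp l (μ j) r) * Complex.exp (-μ i * r)) atTop
        (𝓝 (c i * μ i ^ l)) := by
  classical
  obtain ⟨i, hi, hmax⟩ := (s.filter fun i => c i ≠ 0).exists_max_image (fun i => (μ i).re) (by
    obtain ⟨i, hi, hci⟩ := hc
    exact ⟨i, Finset.mem_filter.2 ⟨hi, hci⟩⟩)
  obtain ⟨his, hci⟩ := Finset.mem_filter.1 hi
  have hmax' : ∀ j ∈ s, c j ≠ 0 → (μ j).re ≤ (μ i).re := fun j hj hcj =>
    hmax j (Finset.mem_filter.2 ⟨hj, hcj⟩)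
  refine ⟨i, his, hci, hmax', ?_⟩
  have key : ∀ j ∈ s, Tendsto (fun r : ℝ => c j * besselExp l (μ j) r * Complex.exp (-μ i * r)) atTop
      (𝓝 (if j = i then c i * μ i ^ l else 0)) := by
    intro j hj
    split_ifs with hji
    · subst hji
      simpa only [mul_assoc] using (tendsto_besselExp_mul_exp l (μ j)).const_mul (c j)
    · by_cases hcj : c j = 0
      · simp [hcj]
      · have hlt : (μ j).re < (μ i).re :=
          lt_of_le_of_ne (hmax' j hj hcj) fun h => hji (hinj hj his h)
        have h1 : Tendsto (fun r : ℝ => Complex.exp ((μ j - μ i) * r)) atTop (𝓝 0) := by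
          rw [tendsto_zero_iff_norm_tendsto_zero]
          have e : ∀ r : ℝ, ‖Complex.exp ((μ j - μ i) * r)‖ =
              Real.exp (-(((μ i).re - (μ j).re) * r)) := fun r => by
            rw [Complex.norm_exp]
            congr 1
            simp
            ring
          simp only [e]
          exact Real.tendsto_exp_neg_atTop_nhds_zero.comp
            (tendsto_id.const_mul_atTop (sub_pos.2 hlt))
        have h2 := ((tendsto_besselExp_mul_exp l (μ j)).const_mul (c j)).mul h1
        rw [mul_zero] at h2
        refine h2.congr fun r => ?_
        rw [mul_assoc, mul_assoc, mul_assoc, ← Complex.exp_add]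
        congr 3
        ring
  have h := tendsto_finsetSum s key
  simp only [Finset.sum_ite_eq', his, if_true] at h
  refine h.congr fun r => ?_
  rw [Finset.sum_mul]

lemma besselExp_coeff_eq_zero_of_ae_eq_zero (hinj : Set.InjOn (fun i => (μ i).re) s)
    (hμ : ∀ i ∈ s, μ i ≠ 0)
    (h : (fun r => ∑ i ∈ s, c i * besselExp l (μ i) r) =ᵐ[halfLineMeasure] 0) :
    ∀ i ∈ s, c i = 0 := by
  by_contra hcon
  push Not at hcon
  obtain ⟨i, hi, hci, -, hlim⟩ := exists_dominant_besselExp (l := l) hinj hcon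
  have h0 : EqOn (fun r => ∑ i ∈ s, c i * besselExp l (μ i) r) 0 (Ioi 0) :=
    Measure.eqOn_open_of_ae_eq h isOpen_Ioi (contDiffOn_sum_besselExp s l c μ).continuousOn
      continuousOn_const
  have h1 : Tendsto (fun r : ℝ => (∑ j ∈ s, c j * besselExp l (μ j) r) * Complex.exp (-μ i * r))
      atTop (𝓝 0) := by
    refine tendsto_const_nhds.congr' ?_
    filter_upwards [eventually_gt_atTop 0] with r hr
    have := h0 hr
    simp only [Pi.zero_apply] at this
    rw [this, zero_mul]
  exact mul_ne_zero hci (pow_ne_zero l (hμ i hi)) (tendsto_nhds_unique hlim h1)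

/-- A nonzero coefficient at an exponent with positive real part forces the dominant exponent to
have positive real part as well; the sum then stays bounded away from zero near infinity. -/
lemma besselExp_coeff_eq_zero_of_memLp (hinj : Set.InjOn (fun i => (μ i).re) s)
    (h : MemLp (fun r => ∑ i ∈ s, c i * besselExp l (μ i) r) 2 halfLineMeasure) :
    ∀ i ∈ s, 0 < (μ i).re → c i = 0 := by
  intro k hk hkre
  by_contra hck
  obtain ⟨i, hi, hci, hmax, hlim⟩ := exists_dominant_besselExp (l := l) hinj ⟨k, hk, hck⟩
  have hire : 0 < (μ i).re := hkre.trans_le (hmax k hk hck)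
  have hμi : μ i ≠ 0 := fun h0 => by simp [h0] at hire
  set a := ‖c i * μ i ^ l‖ with ha
  have ha0 : 0 < a := norm_pos_iff.2 (mul_ne_zero hci (pow_ne_zero l hμi))
  have hev := hlim.norm.eventually (lt_mem_nhds (half_lt_self ha0))
  obtain ⟨R, hR⟩ := eventually_atTop.1 hev
  set R' := max R 0
  have hm : MemLp (fun r => ∑ i ∈ s, c i * besselExp l (μ i) r) 2 (volume.restrict (Ioi R')) :=
    h.mono_measure (Measure.restrict_mono (Ioi_subset_Ioi (le_max_right _ _)) le_rfl)
  have hconst : MemLp (fun _ : ℝ => a / 2) 2 (volume.restrict (Ioi R')) := by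
    refine hm.mono aestronglyMeasurable_const ?_
    filter_upwards [ae_restrict_mem measurableSet_Ioi] with r hr
    have hr1 : R < r := (le_max_left _ _).trans_lt hr
    have hr0 : 0 < r := (le_max_right _ _).trans_lt hr
    rw [Real.norm_of_nonneg (by positivity)]
    refine (hR r hr1.le).le.trans ?_
    rw [norm_mul]
    refine mul_le_of_le_one_right (norm_nonneg _) ?_
    rw [Complex.norm_exp, Real.exp_le_one_iff]
    have e : (-μ i * r).re = -((μ i).re * r) := by simp
    rw [e]
    nlinarith
  rw [memLp_const_iff (by norm_num) (by norm_num)] at hconst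
  rcases hconst with h0 | h0
  · linarith
  · simp at h0

lemma iteratedDeriv_sum_exp_zero (n : ℕ) :
    iteratedDeriv n (fun r : ℝ => ∑ i ∈ s, c i * Complex.exp (μ i * r)) 0 =
      ∑ i ∈ s, c i * μ i ^ n := by
  have h : iteratedDeriv n (fun r : ℝ => ∑ i ∈ s, c i * Complex.exp (μ i * r)) =
      fun r : ℝ => ∑ i ∈ s, (c i * μ i ^ n) * Complex.exp (μ i * r) := by
    induction n with
    | zero => funext r; simp
    | succ n ih =>
      funext r
      rw [iteratedDeriv_succ, ih, (HasDerivAt.fun_sum fun i _ =>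
        (hasDerivAt_exp_mul_ofReal (μ i) r).const_mul (c i * μ i ^ n)).deriv]
      exact Finset.sum_congr rfl fun i _ => by ring
  rw [h]
  simp

lemma memLp_exp_neg {δ : ℝ} (hδ : 0 < δ) :
    MemLp (fun r : ℝ => Real.exp (-δ * r)) 2 halfLineMeasure := by
  rw [memLp_two_iff_integrable_sq (by fun_prop)]
  have h := integrableOn_exp_mul_Ioi (a := -(2 * δ)) (by linarith) 0
  refine h.congr (Eventually.of_forall fun r => ?_)
  simp only
  rw [← Real.exp_nat_mul]
  congr 1
  push_cast
  ring

lemma memLp_sum_besselExp {δ : ℝ} (hδ : 0 < δ) (hμ : ∀ i ∈ s, (μ i).re ≤ -δ)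
    (h0 : ∀ n < l, Even n → ∑ i ∈ s, c i * μ i ^ n = 0) :
    MemLp (fun r => ∑ i ∈ s, c i * besselExp l (μ i) r) 2 halfLineMeasure := by
  have hw : ContDiff ℝ ∞ (fun r : ℝ => ∑ i ∈ s, c i * Complex.exp (μ i * r)) :=
    ContDiff.sum fun i _ => contDiff_const.mul (contDiff_exp_mul_ofReal (μ i))
  have e := besselD_sum s c (fun i => contDiff_exp_mul_ofReal (μ i)) l
  obtain ⟨C₀, hC₀⟩ := exists_besselD_bound hw l fun n hn he => by
    rw [iteratedDeriv_sum_exp_zero, h0 n hn he]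
  choose C hC using fun i => exists_besselExp_bound l (μ i)
  -- The factor `e^δ` turns the constant bound on `(0, 1]` into a multiple of `e^{-δ r}`, so one
  -- majorant serves on both pieces.
  set K := |C₀| * Real.exp δ + ∑ i ∈ s, ‖c i‖ * |C i| with hK
  have hs0 : 0 ≤ ∑ i ∈ s, ‖c i‖ * |C i| := Finset.sum_nonneg fun _ _ => by positivity
  refine ((memLp_exp_neg hδ).const_mul K).mono
    ((contDiffOn_sum_besselExp s l c μ).continuousOn.aestronglyMeasurable measurableSet_Ioi) ?_
  filter_upwards [ae_restrict_mem measurableSet_Ioi] with r hr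
  have hr0 : 0 < r := hr
  rw [Real.norm_of_nonneg (by positivity)]
  rcases le_or_gt r 1 with h1 | h1
  · have h2 := hC₀ r ⟨hr0, h1⟩
    rw [e hr] at h2
    refine h2.trans ?_
    calc C₀ ≤ |C₀| * 1 := by rw [mul_one]; exact le_abs_self _
      _ ≤ |C₀| * (Real.exp δ * Real.exp (-δ * r)) := by
        gcongr
        rw [← Real.exp_add]
        exact Real.one_le_exp (by nlinarith)
      _ = |C₀| * Real.exp δ * Real.exp (-δ * r) := by ring
      _ ≤ _ := by
        gcongr
        linarith
  · calc ‖∑ i ∈ s, c i * besselExp l (μ i) r‖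
        ≤ ∑ i ∈ s, ‖c i‖ * |C i| * Real.exp (-δ * r) := by
          refine (norm_sum_le _ _).trans (Finset.sum_le_sum fun i hi => ?_)
          rw [norm_mul, mul_assoc]
          refine mul_le_mul_of_nonneg_left ((hC i r h1.le).trans ?_) (norm_nonneg _)
          gcongr
          · exact le_abs_self _
          · exact hμ i hi
      _ = (∑ i ∈ s, ‖c i‖ * |C i|) * Real.exp (-δ * r) := by rw [Finset.sum_mul]
      _ ≤ _ := by
          gcongr
          have : 0 ≤ |C₀| * Real.exp δ := by positivity
          linarith

/-- Square integrability at the origin forces the even moments of the coefficients to vanish. -/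
lemma moment_eq_zero_of_memLp
    (h : MemLp (fun r => ∑ i ∈ s, c i * besselExp l (μ i) r) 2 halfLineMeasure) {n : ℕ} (hn : n < l)
    (he : Even n) : ∑ i ∈ s, c i * μ i ^ n = 0 := by
  have hw : ContDiff ℝ ∞ (fun r : ℝ => ∑ i ∈ s, c i * Complex.exp (μ i * r)) :=
    ContDiff.sum fun i _ => contDiff_const.mul (contDiff_exp_mul_ofReal (μ i))
  have e := besselD_sum s c (fun i => contDiff_exp_mul_ofReal (μ i)) l
  rw [← iteratedDeriv_sum_exp_zero]
  refine iteratedDeriv_eq_zero_of_memLp_besselD hw l (h.ae_eq ?_) hn he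
  filter_upwards [ae_restrict_mem measurableSet_Ioi] with r hr using (e hr).symm

end

/-! ### Solving `(T_l + μ²) φ = h` in test functions -/

section
variable {φ ψ : ℝ → ℂ}

lemma IsTest.eq_zero_of_nonpos (h : IsTest φ) {r : ℝ} (hr : r ≤ 0) : φ r = 0 :=
  (h.eventuallyEq_zero hr).self_of_nhds

lemma IsTest.exists_interval (h : IsTest φ) :
    ∃ a b : ℝ, 0 < a ∧ a ≤ b ∧ ∀ r, r ∉ Icc a b → φ r = 0 := by
  obtain ⟨ε, hε, hball⟩ := Metric.eventually_nhds_iff.1 (h.eventuallyEq_zero le_rfl)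
  obtain ⟨R, -, hR⟩ := h.hasCompactSupport.exists_pos_le_norm
  refine ⟨ε, max ε R, hε, le_max_left _ _, fun r hr => ?_⟩
  rcases le_or_gt r 0 with h0 | h0
  · exact h.eq_zero_of_nonpos h0
  rcases lt_or_ge r ε with h1 | h1
  · refine hball ?_
    rw [Real.dist_eq, sub_zero, abs_of_pos h0]
    exact h1
  · refine hR r ?_
    rw [Real.norm_of_nonneg h0.le]
    by_contra hcon
    exact hr ⟨h1, (not_le.1 hcon).le.trans (le_max_right _ _)⟩

lemma isTest_of_eq_zero (hφ : ContDiff ℝ ∞ φ) {a b : ℝ} (ha : 0 < a)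
    (h0 : ∀ r, r ∉ Icc a b → φ r = 0) : IsTest φ := by
  refine ⟨hφ, HasCompactSupport.intro isCompact_Icc h0, ?_⟩
  have : tsupport φ ⊆ Icc a b := closure_minimal (fun r hr => by
    by_contra hcon
    exact hr (h0 r hcon)) isClosed_Icc
  exact this.trans fun r hr => ha.trans_le hr.1

lemma IsTest.setIntegral_eq (h : IsTest φ) : ∫ r in Ioi 0, φ r = ∫ r, φ r :=
  setIntegral_eq_integral_of_forall_compl_eq_zero fun _ hr => h.eq_zero_of_nonpos (not_lt.1 hr)

lemma IsTest.integrable (h : IsTest φ) : Integrable φ :=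
  h.contDiff.continuous.integrable_of_hasCompactSupport h.hasCompactSupport

lemma IsTest.integral_deriv_eq_zero (h : IsTest φ) : ∫ r in Ioi 0, _root_.deriv φ r = 0 := by
  rw [h.deriv.setIntegral_eq]
  exact integral_eq_zero_of_hasDerivAt_of_integrable
    (fun r => ((h.contDiff.differentiable (by simp)) r).hasDerivAt) h.deriv.integrable h.integrable

/-- The primitive from `0` vanishes to the left of the support, and to its right because the total
integral is zero. -/
lemma IsTest.primitive (h : IsTest φ) (h0 : ∫ r in Ioi 0, φ r = 0) :
    IsTest (fun r => ∫ s in (0 : ℝ)..r, φ s) := by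
  obtain ⟨a, b, ha, hab, hz⟩ := h.exists_interval
  have hd : ∀ r, HasDerivAt (fun r => ∫ s in (0 : ℝ)..r, φ s) (φ r) r := fun r =>
    h.contDiff.continuous.integral_hasStrictDerivAt 0 r |>.hasDerivAt
  refine isTest_of_eq_zero (contDiff_infty_iff_deriv.2 ⟨fun r => (hd r).differentiableAt, ?_⟩) ha
    (b := b) fun r hr => ?_
  · have : _root_.deriv (fun r => ∫ s in (0 : ℝ)..r, φ s) = φ := funext fun r => (hd r).deriv
    rw [this]
    exact h.contDiff
  · rcases lt_or_ge r a with h1 | h1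
    · refine intervalIntegral.integral_zero_ae (Eventually.of_forall fun s hs => hz s fun hs' => ?_)
      have := (uIoc_subset_uIcc hs : s ∈ uIcc 0 r)
      rw [mem_uIcc] at this
      have := hs'.1
      rcases ‹_ ∨ _› with h2 | h2 <;> linarith [h2.1, h2.2]
    · have hbr : b < r := by
        by_contra hcon
        exact hr ⟨h1, not_lt.1 hcon⟩
      have hr0 : 0 ≤ r := by linarith
      rw [← h0, intervalIntegral.integral_of_le hr0]
      refine (setIntegral_eq_of_subset_of_forall_sdiff_eq_zero measurableSet_Ioi Ioc_subset_Ioi_self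
        fun s hs => hz s fun hs' => hs.2 ⟨hs.1, hs'.2.trans hbr.le⟩).symm

lemma IsTest.hasDerivAt (h : IsTest φ) (r : ℝ) : HasDerivAt φ (_root_.deriv φ r) r :=
  ((h.contDiff.differentiable (by simp)) r).hasDerivAt

/-- Integration by parts: the integrand difference is the derivative of a Wronskian with compact
support, since `D_l e^{νr}` satisfies `T_l v = -ν² v`. -/
lemma IsTest.integral_mul_besselExp (h : IsTest φ) (l : ℕ) (ν : ℂ) :
    ∫ r in Ioi 0, besselExp l ν r * _root_.radialT l φ r =
      -ν ^ 2 * ∫ r in Ioi 0, besselExp l ν r * φ r := by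
  set v := besselExp l ν with hv
  have hvs := contDiffOn_besselExp l ν
  have hv's : ContDiffOn ℝ ∞ (_root_.deriv v) (Ioi 0) := hvs.deriv_of_isOpen isOpen_Ioi (by simp)
  have t1 := h.deriv.mul_left hvs
  have t2 := (h.mul_left hv's).smul (-1)
  have t := t1.add t2
  have key : ∀ r, 0 < r → v r * _root_.radialT l φ r - -ν ^ 2 * (v r * φ r) =
      -_root_.deriv ((fun r => v r * _root_.deriv φ r) +
        (-1 : ℂ) • fun r => _root_.deriv v r * φ r) r := by
    intro r hr
    have e1 := ((hasDerivAt_besselExp l ν hr).mul (h.deriv.hasDerivAt r)).add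
      (((hasDerivAt_deriv_besselExp l ν hr).mul (h.hasDerivAt r)).const_smul (-1 : ℂ))
    refine Eq.trans ?_ (congrArg Neg.neg e1.deriv.symm)
    simp only [_root_.radialT, coupling, smul_eq_mul, ← hv]
    have hr' : (r : ℂ) ≠ 0 := by exact_mod_cast hr.ne'
    field_simp
    ring
  have i1 : IntegrableOn (fun r => v r * _root_.radialT l φ r) (Ioi 0) :=
    ((h.radialT l).mul_left hvs).integrable.integrableOn
  have i2 : IntegrableOn (fun r => -ν ^ 2 * (v r * φ r)) (Ioi 0) :=
    (h.mul_left hvs).integrable.integrableOn.const_mul _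
  have hz := t.integral_deriv_eq_zero
  rw [← integral_const_mul, ← sub_eq_zero, ← integral_sub i1 i2,
    setIntegral_congr_fun measurableSet_Ioi key, integral_neg, hz, neg_zero]

/-- Variation of constants. The two orthogonality relations are exactly what makes the coefficient
functions compactly supported in `(0, ∞)`. -/
lemma IsTest.exists_radialT_add_eq (h : IsTest φ) (l : ℕ) {μ : ℂ} (hμ : μ ≠ 0)
    (h1 : ∫ r in Ioi 0, besselExp l μ r * φ r = 0)
    (h2 : ∫ r in Ioi 0, besselExp l (-μ) r * φ r = 0) :
    ∃ ψ, IsTest ψ ∧ EqOn (_root_.radialT l ψ + μ ^ 2 • ψ) φ (Ioi 0) := by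
  set v := besselExp l μ with hv
  set y := besselExp l (-μ) with hy
  have tv := h.mul_left (contDiffOn_besselExp l μ)
  have ty := h.mul_left (contDiffOn_besselExp l (-μ))
  set B : ℝ → ℂ := fun r => ∫ s in (0 : ℝ)..r, v s * φ s with hB
  set A : ℝ → ℂ := fun r => ∫ s in (0 : ℝ)..r, y s * φ s with hA
  have tB : IsTest B := tv.primitive h1
  have tA : IsTest A := ty.primitive h2
  have dA : ∀ r, HasDerivAt A (y r * φ r) r := fun r =>
    (ty.contDiff.continuous.integral_hasStrictDerivAt 0 r).hasDerivAt
  have dB : ∀ r, HasDerivAt B (v r * φ r) r := fun r =>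
    (tv.contDiff.continuous.integral_hasStrictDerivAt 0 r).hasDerivAt
  set K : ℂ := (-μ ^ 2) ^ l * (-2 * μ) with hK
  have hK0 : K ≠ 0 :=
    mul_ne_zero (pow_ne_zero _ (neg_ne_zero.2 (pow_ne_zero _ hμ))) (mul_ne_zero (by norm_num) hμ)
  set ψ : ℝ → ℂ := K⁻¹ • ((fun r => v r * A r) + (-1 : ℂ) • fun r => y r * B r) with hψ
  have tψ : IsTest ψ := ((tA.mul_left (contDiffOn_besselExp l μ)).add
    ((tB.mul_left (contDiffOn_besselExp l (-μ))).smul (-1))).smul K⁻¹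
  -- The contributions of `A'` and `B'` cancel: `v · (y φ) - y · (v φ) = 0`.
  set ψ' : ℝ → ℂ := fun r => K⁻¹ * (_root_.deriv v r * A r - _root_.deriv y r * B r) with hψ'
  have d1 : ∀ r : ℝ, 0 < r → HasDerivAt ψ (ψ' r) r := by
    intro r hr
    have := (((hasDerivAt_besselExp l μ hr).mul (dA r)).add
      (((hasDerivAt_besselExp l (-μ) hr).mul (dB r)).const_smul (-1 : ℂ))).const_smul K⁻¹
    convert! this using 1
    simp only [hψ', smul_eq_mul, ← hv, ← hy]
    ring
  refine ⟨ψ, tψ, fun r hr => ?_⟩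
  have hr0 : 0 < r := hr
  have hT : _root_.radialT l ψ r = φ r - μ ^ 2 * ψ r := by
    refine radialT_apply_of_hasDerivAt l hr0 d1 ?_
    have := (((hasDerivAt_deriv_besselExp l μ hr0).mul (dA r)).sub
      ((hasDerivAt_deriv_besselExp l (-μ) hr0).mul (dB r))).const_mul K⁻¹
    convert! this using 1
    have hW : v r * _root_.deriv y r - _root_.deriv v r * y r = K := besselExp_wronskian l μ hr0
    have hKK : K⁻¹ * (v r * _root_.deriv y r - _root_.deriv v r * y r) = 1 := by
      rw [hW, inv_mul_cancel₀ hK0]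
    simp only [hψ, Pi.smul_apply, Pi.add_apply, smul_eq_mul, ← hv, ← hy]
    linear_combination (φ r) * hKK
  simp only [Pi.add_apply, Pi.smul_apply, smul_eq_mul, hT]
  ring

lemma IsTest.radialT_add_smul_eqOn (h : IsTest φ) (h' : IsTest ψ) (l : ℕ) (c : ℂ) :
    EqOn (_root_.radialT l (φ + c • ψ)) (_root_.radialT l φ + c • _root_.radialT l ψ) (Ioi 0) := by
  have e := radialT_add_eqOn (l := l) (contDiff_infty.1 h.contDiff 2).contDiffOn
    (contDiff_infty.1 (h'.smul c).contDiff 2).contDiffOn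
  rwa [radialT_smul] at e

/-- A test function orthogonal to the six exponential solutions is in the range of
`(T_l + μ₀²) (T_l + μ₁²) (T_l + μ₂²)` on test functions. -/
lemma IsTest.exists_radialT_cube_add_eq (h : IsTest φ) (l : ℕ) {μ : Fin 3 → ℂ}
    (hμ : ∀ i, μ i ≠ 0) (hinj : Function.Injective fun i => μ i ^ 2)
    (h1 : ∀ i, ∫ r in Ioi 0, besselExp l (μ i) r * φ r = 0)
    (h2 : ∀ i, ∫ r in Ioi 0, besselExp l (-μ i) r * φ r = 0)
    (e1 : μ 0 ^ 2 + μ 1 ^ 2 + μ 2 ^ 2 = 0)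
    (e2 : μ 0 ^ 2 * μ 1 ^ 2 + μ 0 ^ 2 * μ 2 ^ 2 + μ 1 ^ 2 * μ 2 ^ 2 = 0) :
    ∃ ψ, IsTest ψ ∧ EqOn ((_root_.radialT l)^[3] ψ + (μ 0 ^ 2 * μ 1 ^ 2 * μ 2 ^ 2) • ψ) φ
      (Ioi 0) := by
  -- Orthogonality survives division by a factor: if `φ = (T_l + a) ψ`, then `∫ v φ = (a - ν²) ∫ v
  -- ψ` for `v = D_l e^{νr}`. Distinct squares keep `a - ν²` nonzero.
  have pass : ∀ {φ ψ : ℝ → ℂ} {a ν : ℂ}, IsTest ψ → EqOn (_root_.radialT l ψ + a • ψ) φ (Ioi 0) →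
      a ≠ ν ^ 2 → ∫ r in Ioi 0, besselExp l ν r * φ r = 0 →
      ∫ r in Ioi 0, besselExp l ν r * ψ r = 0 := by
    intro φ ψ a ν hψ heq hne h0
    have hvs := contDiffOn_besselExp l ν
    have e : ∫ r in Ioi 0, besselExp l ν r * φ r =
        (a - ν ^ 2) * ∫ r in Ioi 0, besselExp l ν r * ψ r := by
      have e' : ∀ r ∈ Ioi (0 : ℝ), besselExp l ν r * φ r =
          besselExp l ν r * _root_.radialT l ψ r + a * (besselExp l ν r * ψ r) := by
        intro r hr
        rw [← heq hr]
        simp only [Pi.add_apply, Pi.smul_apply, smul_eq_mul]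
        ring
      rw [setIntegral_congr_fun measurableSet_Ioi e', integral_add
        ((hψ.radialT l).mul_left hvs).integrable.integrableOn
        ((hψ.mul_left hvs).integrable.integrableOn.const_mul _), hψ.integral_mul_besselExp,
        integral_const_mul]
      ring
    rw [h0] at e
    exact (mul_eq_zero.1 e.symm).resolve_left (sub_ne_zero.2 hne)
  have hne : ∀ i j, i ≠ j → μ i ^ 2 ≠ μ j ^ 2 := fun i j hij => hinj.ne hij
  have hne' : ∀ i j, i ≠ j → μ i ^ 2 ≠ (-μ j) ^ 2 := fun i j hij => by
    rw [neg_sq]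
    exact hinj.ne hij
  obtain ⟨φ₁, t₁, q₁⟩ := h.exists_radialT_add_eq l (hμ 0) (h1 0) (h2 0)
  obtain ⟨φ₂, t₂, q₂⟩ := t₁.exists_radialT_add_eq l (hμ 1)
    (pass t₁ q₁ (hne 0 1 (by decide)) (h1 1)) (pass t₁ q₁ (hne' 0 1 (by decide)) (h2 1))
  obtain ⟨φ₃, t₃, q₃⟩ := t₂.exists_radialT_add_eq l (hμ 2)
    (pass t₂ q₂ (hne 1 2 (by decide)) (pass t₁ q₁ (hne 0 2 (by decide)) (h1 2)))
    (pass t₂ q₂ (hne' 1 2 (by decide)) (pass t₁ q₁ (hne' 0 2 (by decide)) (h2 2)))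
  refine ⟨φ₃, t₃, fun r hr => ?_⟩
  have tT := t₃.radialT l
  have tTT := tT.radialT l
  -- successive elimination of the intermediate test functions
  have a1 : EqOn (_root_.radialT l φ₂) (_root_.radialT l (_root_.radialT l φ₃) +
      μ 2 ^ 2 • _root_.radialT l φ₃) (Ioi 0) :=
    (radialT_congr q₃.symm).trans (tT.radialT_add_smul_eqOn t₃ l _)
  have a2 : EqOn φ₁ (_root_.radialT l (_root_.radialT l φ₃) +
      ((μ 2 ^ 2 + μ 1 ^ 2) • _root_.radialT l φ₃ + (μ 1 ^ 2 * μ 2 ^ 2) • φ₃)) (Ioi 0) := by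
    intro s hs
    have b1 := q₂ hs
    have b2 := q₃ hs
    have b3 := a1 hs
    simp only [Pi.add_apply, Pi.smul_apply, smul_eq_mul] at b1 b2 b3 ⊢
    rw [← b1, b3, ← b2]
    ring
  have a3 : EqOn (_root_.radialT l φ₁) ((_root_.radialT l)^[3] φ₃ +
      ((μ 2 ^ 2 + μ 1 ^ 2) • _root_.radialT l (_root_.radialT l φ₃) +
        (μ 1 ^ 2 * μ 2 ^ 2) • _root_.radialT l φ₃)) (Ioi 0) := by
    intro s hs
    have b0 := radialT_congr (l := l) a2 hs
    have b1 := tTT.radialT_add_smul_eqOn ((tT.smul (μ 2 ^ 2 + μ 1 ^ 2)).add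
      (t₃.smul (μ 1 ^ 2 * μ 2 ^ 2))) l 1 hs
    have b2 := (tT.smul (μ 2 ^ 2 + μ 1 ^ 2)).radialT_add_smul_eqOn t₃ l (μ 1 ^ 2 * μ 2 ^ 2) hs
    rw [radialT_smul] at b2
    rw [one_smul, one_smul] at b1
    rw [b0, b1, Pi.add_apply, b2]
    rfl
  have c1 := q₁ hr
  have c2 := a2 hr
  have c3 := a3 hr
  simp only [Pi.add_apply, Pi.smul_apply, smul_eq_mul] at c1 c2 c3 ⊢
  rw [← c1, c3, c2]
  -- In the expanded product the coefficients of `T_l²` and `T_l` are the first two elementary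
  -- symmetric functions of the `μ_j²`, both zero.
  linear_combination (-_root_.radialT l (_root_.radialT l φ₃) r) * e1 -
    (_root_.radialT l φ₃ r) * e2

end

/-! ### Weak solutions -/

/-- The space of test functions. -/
def testSpace : Submodule ℂ (ℝ → ℂ) where
  carrier := {φ | IsTest φ}
  zero_mem' := IsTest.zero
  add_mem' := fun h h' => h.add h'
  smul_mem' := fun c _ h => h.smul c

lemma IsTest.integrableOn_mul {φ u : ℝ → ℂ} (h : IsTest φ) (hu : LocallyIntegrableOn u (Ioi 0)) :
    IntegrableOn (fun r => u r * φ r) (Ioi 0) := by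
  obtain ⟨a, b, ha, -, hz⟩ := h.exists_interval
  have h1 : IntegrableOn u (Icc a b) :=
    hu.integrableOn_compact_subset (fun r hr => ha.trans_le hr.1) isCompact_Icc
  refine (h1.mul_continuousOn h.contDiff.continuous.continuousOn isCompact_Icc).of_forall_sdiff_eq_zero
    measurableSet_Ioi fun r hr => ?_
  rw [hz r hr.2, mul_zero]

/-- Integration against a locally integrable function. -/
noncomputable def testFunctional {u : ℝ → ℂ} (hu : LocallyIntegrableOn u (Ioi 0)) :
    testSpace →ₗ[ℂ] ℂ where
  toFun φ := ∫ r in Ioi 0, u r * (φ : ℝ → ℂ) r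
  map_add' φ ψ := by
    rw [← integral_add (IsTest.integrableOn_mul φ.2 hu) (IsTest.integrableOn_mul ψ.2 hu)]
    refine integral_congr_ae (Eventually.of_forall fun r => ?_)
    simp [mul_add]
  map_smul' c φ := by
    rw [RingHom.id_apply, smul_eq_mul, ← integral_const_mul]
    refine integral_congr_ae (Eventually.of_forall fun r => ?_)
    simp
    ring

lemma locallyIntegrableOn_besselExp (l : ℕ) (μ : ℂ) :
    LocallyIntegrableOn (besselExp l μ) (Ioi 0) :=
  (contDiffOn_besselExp l μ).continuousOn.locallyIntegrableOn measurableSet_Ioi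

/-- Weak solutions of `T_l³ u + μ₀² μ₁² μ₂² u = 0` on `(0, ∞)` are classical. -/
lemma exists_sum_besselExp_of_weak_solution (l : ℕ) {μ : Fin 3 → ℂ} (hμ : ∀ i, μ i ≠ 0)
    (hinj : Function.Injective fun i => μ i ^ 2) (e1 : μ 0 ^ 2 + μ 1 ^ 2 + μ 2 ^ 2 = 0)
    (e2 : μ 0 ^ 2 * μ 1 ^ 2 + μ 0 ^ 2 * μ 2 ^ 2 + μ 1 ^ 2 * μ 2 ^ 2 = 0) {u : ℝ → ℂ}
    (hu : LocallyIntegrableOn u (Ioi 0)) (h : ∀ φ, IsTest φ →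
      ∫ r in Ioi 0, u r * ((radialT l)^[3] φ r + (μ 0 ^ 2 * μ 1 ^ 2 * μ 2 ^ 2) * φ r) = 0) :
    ∃ c : Fin 3 ⊕ Fin 3 → ℂ, u =ᵐ[halfLineMeasure]
      fun r => ∑ i, c i * besselExp l (Sum.elim μ (-μ) i) r := by
  set ν : Fin 3 ⊕ Fin 3 → ℂ := Sum.elim μ (-μ) with hν
  set L : Fin 3 ⊕ Fin 3 → testSpace →ₗ[ℂ] ℂ := fun i =>
    testFunctional (locallyIntegrableOn_besselExp l (ν i)) with hL
  -- Pure linear algebra: a functional vanishing on the common kernel of finitely many functionals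
  -- is a combination of them, and test functions in that kernel are of the form `(T_l³ + μ₀²μ₁²μ₂²)
  -- ψ`.
  have hspan : testFunctional hu ∈ Submodule.span ℂ (Set.range L) := by
    refine mem_span_of_iInf_ker_le_ker fun φ hφ => ?_
    rw [Submodule.mem_iInf] at hφ
    have hφT : IsTest (φ : ℝ → ℂ) := φ.2
    obtain ⟨ψ, hψ, heq⟩ := hφT.exists_radialT_cube_add_eq l hμ hinj
      (fun i => hφ (Sum.inl i)) (fun i => hφ (Sum.inr i)) e1 e2
    refine Eq.trans (setIntegral_congr_fun measurableSet_Ioi fun r hr => ?_) (h ψ hψ)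
    rw [← heq hr]
    rfl
  obtain ⟨c, hc⟩ := (Submodule.mem_span_range_iff_exists_fun ℂ).1 hspan
  refine ⟨c, ?_⟩
  have hsum : LocallyIntegrableOn (fun r => ∑ i, c i * besselExp l (ν i) r) (Ioi 0) :=
    (contDiffOn_sum_besselExp _ l c ν).continuousOn.locallyIntegrableOn measurableSet_Ioi
  have h0 : (fun r => u r - ∑ i, c i * besselExp l (ν i) r) =ᵐ[halfLineMeasure] 0 := by
    refine ae_eq_zero_of_forall_isTest (hu.sub hsum) fun φ hφ => ?_
    have h1 : (∑ i, c i • L i) ⟨φ, hφ⟩ = testFunctional hu ⟨φ, hφ⟩ := by rw [hc]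
    have h2 : (∑ i, c i • L i) ⟨φ, hφ⟩ = ∑ i, ∫ r in Ioi 0, c i * (besselExp l (ν i) r * φ r) := by
      rw [LinearMap.sum_apply]
      refine Finset.sum_congr rfl fun i _ => ?_
      rw [integral_const_mul]
      rfl
    have h3 : testFunctional hu ⟨φ, hφ⟩ = ∫ r in Ioi 0, u r * φ r := rfl
    have hi : ∀ i ∈ Finset.univ, IntegrableOn (fun r => c i * (besselExp l (ν i) r * φ r)) (Ioi 0) :=
      fun i _ => (hφ.integrableOn_mul (locallyIntegrableOn_besselExp l (ν i))).const_mul _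
    rw [h2, h3, ← integral_finsetSum _ hi] at h1
    have e : ∀ r, (u r - ∑ i, c i * besselExp l (ν i) r) * φ r =
        u r * φ r - ∑ i, c i * (besselExp l (ν i) r * φ r) := fun r => by
      rw [sub_mul, Finset.sum_mul]
      simp only [mul_assoc]
    simp only [e]
    rw [integral_sub (hφ.integrableOn_mul hu) (integrable_finsetSum _ hi), h1, sub_self]
  filter_upwards [h0] with r hr using sub_eq_zero.1 hr

/-! ### The kernel in terms of characteristic exponents -/

lemma radialT_conj (l : ℕ) (f : ℝ → ℂ) :
    radialT l (fun r => conj (f r)) = fun r => conj (radialT l f r) := by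
  have h : ∀ f : ℝ → ℂ, deriv (fun r => conj (f r)) = fun r => conj (deriv f r) := fun f =>
    funext fun r => deriv.star (f := f) (x := r)
  funext r
  simp only [radialT, h, map_add, map_neg, map_mul, map_div₀, map_pow, map_natCast, map_one,
    Complex.conj_ofReal]

lemma radialT_cube_conj (l : ℕ) (f : ℝ → ℂ) :
    (radialT l)^[3] (fun r => conj (f r)) = fun r => conj ((radialT l)^[3] f r) := by
  simp only [Function.iterate_succ_apply, Function.iterate_zero, id_eq, radialT_conj]

/-- The numbers `± μ j` are the six solutions of `ν ^ 6 = z`, the `μ j` having positive and distinct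
real parts. -/
structure IsExponentTriple (μ : Fin 3 → ℂ) (z : ℂ) : Prop where
  re_pos : ∀ j, 0 < (μ j).re
  re_injective : Function.Injective fun j => (μ j).re
  sum_sq : μ 0 ^ 2 + μ 1 ^ 2 + μ 2 ^ 2 = 0
  sum_mul_sq : μ 0 ^ 2 * μ 1 ^ 2 + μ 0 ^ 2 * μ 2 ^ 2 + μ 1 ^ 2 * μ 2 ^ 2 = 0
  prod_sq : μ 0 ^ 2 * μ 1 ^ 2 * μ 2 ^ 2 = z

namespace IsExponentTriple
variable {μ : Fin 3 → ℂ} {z : ℂ}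

lemma ne_zero (h : IsExponentTriple μ z) (j : Fin 3) : μ j ≠ 0 := fun h0 => by
  have := h.re_pos j
  rw [h0, Complex.zero_re] at this
  exact lt_irrefl _ this

lemma sq_injective (h : IsExponentTriple μ z) : Function.Injective fun j => μ j ^ 2 := by
  intro i j hij
  rcases sq_eq_sq_iff_eq_or_eq_neg.1 hij with h1 | h1
  · exact h.re_injective (congrArg Complex.re h1)
  · have h2 := congrArg Complex.re h1
    rw [Complex.neg_re] at h2
    linarith [h.re_pos i, h.re_pos j]

/-- By Vieta the `μ j ^ 2` are the roots of `X³ - z`. -/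
lemma pow_six (h : IsExponentTriple μ z) (j : Fin 3) : μ j ^ 6 = z := by
  have e : (μ j ^ 2 - μ 0 ^ 2) * (μ j ^ 2 - μ 1 ^ 2) * (μ j ^ 2 - μ 2 ^ 2) = 0 := by
    fin_cases j <;> simp
  linear_combination e + μ j ^ 4 * h.sum_sq - μ j ^ 2 * h.sum_mul_sq + h.prod_sq

lemma re_sumElim_injective (h : IsExponentTriple μ z) :
    Function.Injective fun i => (Sum.elim μ (-μ) i).re := by
  rintro (i | i) (j | j) hij <;>
    simp only [Sum.elim_inl, Sum.elim_inr, Pi.neg_apply, Complex.neg_re, neg_inj] at hij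
  · rw [h.re_injective hij]
  · linarith [h.re_pos i, h.re_pos j]
  · linarith [h.re_pos i, h.re_pos j]
  · rw [h.re_injective hij]

lemma re_neg_injOn (h : IsExponentTriple μ z) :
    Set.InjOn (fun j => ((-μ) j).re) ((Finset.univ : Finset (Fin 3)) : Set (Fin 3)) :=
  fun i _ j _ hij => h.re_injective (neg_injective (by simpa using hij))

lemma memLp (h : IsExponentTriple μ z) {l : ℕ} {α : Fin 3 → ℂ}
    (hα : ∀ n < l, Even n → ∑ j, α j * μ j ^ n = 0) :
    MemLp (fun r => ∑ j, α j * besselExp l ((-μ) j) r) 2 halfLineMeasure := by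
  obtain ⟨k, hk⟩ := Finite.exists_min fun j => (μ j).re
  refine memLp_sum_besselExp (h.re_pos k) (fun j _ => ?_) fun n hn he => ?_
  · rw [Pi.neg_apply, Complex.neg_re]
    exact neg_le_neg (hk j)
  · rw [← hα n hn he]
    exact Finset.sum_congr rfl fun j _ => by rw [Pi.neg_apply, he.neg_pow]

/-- The conjugate of `w` enters because the adjoint equation is `T_l³ u = -w̄ u`. The moment
conditions involve even powers only, so they are the same for `μ j` and `-μ j`. -/
lemma mem_adjointKernel_iff {w : ℂ} (h : IsExponentTriple μ (conj w)) (l : ℕ) (u : HalfLineL2) :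
    u ∈ adjointKernel (radialCube l) w ↔ ∃ α : Fin 3 → ℂ,
      (∀ n < l, Even n → ∑ j, α j * μ j ^ n = 0) ∧
      u =ᵐ[halfLineMeasure] fun r => ∑ j, α j * besselExp l ((-μ) j) r := by
  rw [mem_adjointKernel_radialCube_iff]
  constructor
  · intro hu
    obtain ⟨c, hc⟩ := exists_sum_besselExp_of_weak_solution l h.ne_zero h.sq_injective h.sum_sq
      h.sum_mul_sq (MemLp.locallyIntegrableOn_halfLine (Lp.memLp u)) (fun φ hφ => by
        -- Testing against the conjugate of `φ` and conjugating the identity removes the conjugation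
        -- from `u`.
        have h1 := congrArg conj (hu _ _ hφ.conj.isW06)
        rw [← integral_conj, map_zero, radialT_cube_conj] at h1
        rw [← h1]
        refine integral_congr_ae (Eventually.of_forall fun r => ?_)
        simp only [map_mul, map_add, Complex.conj_conj, h.prod_sq])
    have hmem := (memLp_congr_ae hc).1 (Lp.memLp u)
    have hgrow := besselExp_coeff_eq_zero_of_memLp (h.re_sumElim_injective.injOn) hmem
    have hsum : (fun r => ∑ i, c i * besselExp l (Sum.elim μ (-μ) i) r) =
        fun r => ∑ j, c (Sum.inr j) * besselExp l ((-μ) j) r := by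
      funext r
      rw [Fintype.sum_sum_type, Finset.sum_eq_zero, zero_add]
      · rfl
      · intro j _
        rw [hgrow (Sum.inl j) (Finset.mem_univ _) (h.re_pos j), zero_mul]
    rw [hsum] at hc hmem
    refine ⟨fun j => c (Sum.inr j), fun n hn he => ?_, hc⟩
    rw [← moment_eq_zero_of_memLp hmem hn he]
    exact Finset.sum_congr rfl fun j _ => by rw [Pi.neg_apply, he.neg_pow]
  · rintro ⟨α, hα, hu⟩ f g hfg
    set q : ℝ → ℂ := fun r => ∑ j, α j * besselExp l ((-μ) j) r with hq
    have hqm : MemLp q 2 halfLineMeasure := h.memLp hα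
    -- For the converse, `q` is an `L²` eigenfunction of the expression `T_l³`, hence `T_l³ q ∈ L²`
    -- and Green's formula applies.
    have hT : EqOn ((radialT l)^[3] q) (fun r => -conj w * q r) (Ioi 0) := by
      intro r hr
      refine (radialT_cube_sum_besselExp _ _ _ _ hr).trans ?_
      simp only [hq, Finset.mul_sum]
      refine Finset.sum_congr rfl fun j _ => ?_
      rw [Pi.neg_apply, Even.neg_pow (by decide), h.pow_six]
      ring
    have hTae : (radialT l)^[3] q =ᵐ[halfLineMeasure] fun r => -conj w * q r :=
      (ae_restrict_mem measurableSet_Ioi).mono fun r hr => hT hr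
    have hTm : MemLp ((radialT l)^[3] q) 2 halfLineMeasure :=
      (memLp_congr_ae hTae).2 (hqm.const_mul _)
    have hqc : ContDiffOn ℝ ∞ q (Ioi 0) := contDiffOn_sum_besselExp _ l α _
    have hg := hfg.green_smooth l hqc hqm hTm
    have hTint : ∫ r in Ioi 0, f r * conj ((radialT l)^[3] q r) =
        -w * ∫ r in Ioi 0, f r * conj (q r) := by
      rw [← integral_const_mul]
      refine integral_congr_ae (hTae.mono fun r hr => ?_)
      simp only [hr, map_mul, map_neg, Complex.conj_conj]
      ring
    have i1 : Integrable (fun r => (radialT l)^[3] f r * conj (q r)) halfLineMeasure :=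
      hqm.star.integrable_mul (hfg.memLp_radialT_cube l) |>.congr
        (Eventually.of_forall fun r => mul_comm _ _)
    have i2 : Integrable (fun r => f r * conj (q r)) halfLineMeasure :=
      hqm.star.integrable_mul hfg.memLp |>.congr (Eventually.of_forall fun r => mul_comm _ _)
    calc ∫ r in Ioi 0, conj (u r) * ((radialT l)^[3] f r + w * f r)
        = ∫ r in Ioi 0, ((radialT l)^[3] f r * conj (q r) + w * (f r * conj (q r))) := by
          refine integral_congr_ae (hu.mono fun r hr => ?_)
          simp only [hr]
          ring
      _ = (∫ r in Ioi 0, (radialT l)^[3] f r * conj (q r)) +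
            w * ∫ r in Ioi 0, f r * conj (q r) := by
          rw [integral_add i1 (i2.const_mul w), integral_const_mul]
      _ = 0 := by
          rw [hg, hTint]
          ring

end IsExponentTriple

/-! ### The moment equations and the dimension of the kernel -/

/-- The coefficients `α` for which `∑ j, α j * exp (-μ j * r)` has vanishing even derivatives of
order less than `l` at the origin. -/
def momentSpace (μ : Fin 3 → ℂ) (l : ℕ) : Submodule ℂ (Fin 3 → ℂ) where
  carrier := {α | ∀ n < l, Even n → ∑ j, α j * μ j ^ n = 0}
  zero_mem' := fun n _ _ => by simp
  add_mem' := fun {α β} hα hβ n hn he => by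
    simp only [Pi.add_apply, add_mul, Finset.sum_add_distrib, hα n hn he, hβ n hn he, add_zero]
  smul_mem' := fun c α hα n hn he => by
    simp only [Pi.smul_apply, smul_eq_mul, mul_assoc, ← Finset.mul_sum, hα n hn he, mul_zero]

lemma mem_momentSpace {μ α : Fin 3 → ℂ} {l : ℕ} :
    α ∈ momentSpace μ l ↔ ∀ n < l, Even n → ∑ j, α j * μ j ^ n = 0 := Iff.rfl

namespace IsExponentTriple
variable {μ : Fin 3 → ℂ} {z : ℂ}

/-- The square integrable solution with coefficients in `momentSpace μ l`. -/
noncomputable def solutionMap (h : IsExponentTriple μ z) (l : ℕ) :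
    momentSpace μ l →ₗ[ℂ] HalfLineL2 where
  toFun α := (h.memLp (l := l) α.2).toLp _
  map_add' α β := by
    rw [← MemLp.toLp_add]
    congr 1
    funext r
    simp only [Submodule.coe_add, Pi.add_apply, add_mul, Finset.sum_add_distrib]
  map_smul' c α := by
    rw [RingHom.id_apply, ← MemLp.toLp_const_smul]
    congr 1
    funext r
    simp only [Submodule.coe_smul, Pi.smul_apply, smul_eq_mul, mul_assoc, Finset.mul_sum]

lemma coeFn_solutionMap (h : IsExponentTriple μ z) (l : ℕ) (α : momentSpace μ l) :
    h.solutionMap l α =ᵐ[halfLineMeasure]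
      fun r => ∑ j, (α : Fin 3 → ℂ) j * besselExp l ((-μ) j) r :=
  (h.memLp (l := l) α.2).coeFn_toLp

lemma solutionMap_injective (h : IsExponentTriple μ z) (l : ℕ) :
    Function.Injective (h.solutionMap l) := by
  rw [injective_iff_map_eq_zero]
  intro α hα
  have h1 := h.coeFn_solutionMap l α
  rw [hα] at h1
  have h2 := besselExp_coeff_eq_zero_of_ae_eq_zero h.re_neg_injOn
    (fun j _ => neg_ne_zero.2 (h.ne_zero j)) (h1.symm.trans (Lp.coeFn_zero _ _ _))
  exact Subtype.ext (funext fun j => h2 j (Finset.mem_univ j))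

lemma range_solutionMap {w : ℂ} (h : IsExponentTriple μ (conj w)) (l : ℕ) :
    LinearMap.range (h.solutionMap l) = adjointKernel (radialCube l) w := by
  ext u
  rw [h.mem_adjointKernel_iff, LinearMap.mem_range]
  constructor
  · rintro ⟨α, rfl⟩
    exact ⟨α, α.2, h.coeFn_solutionMap l α⟩
  · rintro ⟨α, hα, hu⟩
    exact ⟨⟨α, hα⟩, Lp.ext ((h.coeFn_solutionMap l ⟨α, hα⟩).trans hu.symm)⟩

lemma rank_adjointKernel {w : ℂ} (h : IsExponentTriple μ (conj w)) (l : ℕ) :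
    Module.rank ℂ (adjointKernel (radialCube l) w) = Module.rank ℂ (momentSpace μ l) := by
  rw [← h.range_solutionMap l]
  exact (LinearEquiv.ofInjective _ (h.solutionMap_injective l)).rank_eq.symm

/-- The equations are those for `n = 0` and `n = 2`; the generator is the cross product, up to sign,
of `(1, 1, 1)` and `(μ₀², μ₁², μ₂²)`. -/
lemma momentSpace_eq_span_singleton (h : IsExponentTriple μ z) {l : ℕ} (hl : l = 3 ∨ l = 4) :
    momentSpace μ l =
      ℂ ∙ ![μ 1 ^ 2 - μ 2 ^ 2, μ 2 ^ 2 - μ 0 ^ 2, μ 0 ^ 2 - μ 1 ^ 2] := by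
  have h12 : μ 1 ^ 2 - μ 2 ^ 2 ≠ 0 := sub_ne_zero.2 fun e => absurd (h.sq_injective e) (by decide)
  ext α
  rw [mem_momentSpace, Submodule.mem_span_singleton]
  constructor
  · intro hα
    have h0 := hα 0 (by omega) (by decide)
    have h2 := hα 2 (by omega) (by decide)
    simp only [Fin.sum_univ_three, pow_zero, mul_one] at h0 h2
    refine ⟨α 0 / (μ 1 ^ 2 - μ 2 ^ 2), funext fun j => ?_⟩
    fin_cases j <;> simp <;> field_simp
    · linear_combination μ 2 ^ 2 * h0 - h2
    · linear_combination h2 - μ 1 ^ 2 * h0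
  · rintro ⟨c, rfl⟩ n hn he
    obtain rfl | rfl : n = 0 ∨ n = 2 := by
      obtain ⟨k, rfl⟩ := he
      omega
    · simp [Fin.sum_univ_three]
      ring
    · simp [Fin.sum_univ_three]
      ring

lemma momentSpace_eq_bot (h : IsExponentTriple μ z) {l : ℕ} (hl : 5 ≤ l) :
    momentSpace μ l = ⊥ := by
  rw [eq_bot_iff]
  intro α hα
  have h0 := hα 0 (by omega) (by decide)
  have h2 := hα 2 (by omega) (by decide)
  have h4 := hα 4 (by omega) (by decide)
  simp only [Fin.sum_univ_three, pow_zero, mul_one] at h0 h2 h4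
  have hne : ∀ i j, i ≠ j → μ i ^ 2 - μ j ^ 2 ≠ 0 := fun i j hij =>
    sub_ne_zero.2 fun e => hij (h.sq_injective e)
  -- Lagrange interpolation inverts the Vandermonde system: the polynomial `(X - μ₁²)(X - μ₂²)` at
  -- `X = μ_j²`, summed against `α`, retains only `α 0`.
  have e0 : α 0 * ((μ 0 ^ 2 - μ 1 ^ 2) * (μ 0 ^ 2 - μ 2 ^ 2)) = 0 := by
    linear_combination h4 - (μ 1 ^ 2 + μ 2 ^ 2) * h2 + μ 1 ^ 2 * μ 2 ^ 2 * h0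
  have e1 : α 1 * ((μ 1 ^ 2 - μ 0 ^ 2) * (μ 1 ^ 2 - μ 2 ^ 2)) = 0 := by
    linear_combination h4 - (μ 0 ^ 2 + μ 2 ^ 2) * h2 + μ 0 ^ 2 * μ 2 ^ 2 * h0
  have e2 : α 2 * ((μ 2 ^ 2 - μ 0 ^ 2) * (μ 2 ^ 2 - μ 1 ^ 2)) = 0 := by
    linear_combination h4 - (μ 0 ^ 2 + μ 1 ^ 2) * h2 + μ 0 ^ 2 * μ 1 ^ 2 * h0
  rw [Submodule.mem_bot]
  funext j
  fin_cases j
  · exact (mul_eq_zero.1 e0).resolve_right (mul_ne_zero (hne _ _ (by decide)) (hne _ _ (by decide)))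
  · exact (mul_eq_zero.1 e1).resolve_right (mul_ne_zero (hne _ _ (by decide)) (hne _ _ (by decide)))
  · exact (mul_eq_zero.1 e2).resolve_right (mul_ne_zero (hne _ _ (by decide)) (hne _ _ (by decide)))

lemma rank_adjointKernel_eq_one {w : ℂ} (h : IsExponentTriple μ (conj w)) {l : ℕ}
    (hl : l = 3 ∨ l = 4) : Module.rank ℂ (adjointKernel (radialCube l) w) = 1 := by
  have h12 : μ 1 ^ 2 - μ 2 ^ 2 ≠ 0 := sub_ne_zero.2 fun e => absurd (h.sq_injective e) (by decide)
  rw [h.rank_adjointKernel, h.momentSpace_eq_span_singleton hl]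
  have h0 : ![μ 1 ^ 2 - μ 2 ^ 2, μ 2 ^ 2 - μ 0 ^ 2, μ 0 ^ 2 - μ 1 ^ 2] ≠ 0 := fun e =>
    h12 (congrFun e 0)
  rw [← Module.finrank_eq_rank, finrank_span_singleton h0, Nat.cast_one]

lemma rank_adjointKernel_eq_zero {w : ℂ} (h : IsExponentTriple μ (conj w)) {l : ℕ}
    (hl : 5 ≤ l) : Module.rank ℂ (adjointKernel (radialCube l) w) = 0 := by
  rw [h.rank_adjointKernel, h.momentSpace_eq_bot hl, rank_bot]

end IsExponentTriple

/-! ### The explicit exponents -/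

/-- The exponents in `qOne` and `qTwo`, up to sign. -/
noncomputable def cubeExponent (σ ρ : ℝ) : Fin 3 → ℂ :=
  ![-phase (-σ * (3 * Real.pi / 4)) * ρ, phase (-σ * (Real.pi / 12)) * ρ,
    phase (-σ * (5 * Real.pi / 12)) * ρ]

lemma phase_sign_mul {σ : ℝ} (hσ : σ = 1 ∨ σ = -1) (θ : ℝ) :
    phase (σ * θ) = (Real.cos θ : ℂ) + σ * (Real.sin θ : ℂ) * Complex.I := by
  rw [phase, Complex.ofReal_mul]
  rcases hσ with rfl | rfl
  · simp [Complex.exp_mul_I]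
  · rw [Complex.ofReal_neg, neg_mul, Complex.exp_mul_I]
    simp

lemma phase_sq (θ : ℝ) : phase θ ^ 2 = phase (2 * θ) := by
  rw [phase, phase, ← Complex.exp_nat_mul]
  congr 1
  push_cast
  ring

lemma neg_sign {σ : ℝ} (hσ : σ = 1 ∨ σ = -1) : -σ = 1 ∨ -σ = -1 := by
  rcases hσ with rfl | rfl <;> simp

lemma ofReal_sign_sq {σ : ℝ} (hσ : σ = 1 ∨ σ = -1) : (σ : ℂ) ^ 2 = 1 := by
  rcases hσ with rfl | rfl <;> simp

lemma ofReal_sqrt_three_sq : (Real.sqrt 3 : ℂ) ^ 2 = 3 := by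
  rw [← Complex.ofReal_pow, Real.sq_sqrt (by norm_num)]
  norm_num

lemma phase_pi_div_six {σ : ℝ} (hσ : σ = 1 ∨ σ = -1) :
    phase (σ * (Real.pi / 6)) = (Real.sqrt 3 : ℂ) / 2 + σ * Complex.I / 2 := by
  rw [phase_sign_mul hσ, Real.cos_pi_div_six, Real.sin_pi_div_six]
  push_cast
  ring

lemma phase_five_pi_div_six {σ : ℝ} (hσ : σ = 1 ∨ σ = -1) :
    phase (σ * (5 * Real.pi / 6)) = -(Real.sqrt 3 : ℂ) / 2 + σ * Complex.I / 2 := by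
  rw [phase_sign_mul hσ, show 5 * Real.pi / 6 = Real.pi - Real.pi / 6 by ring, Real.cos_pi_sub,
    Real.sin_pi_sub, Real.cos_pi_div_six, Real.sin_pi_div_six]
  push_cast
  ring

lemma phase_two_pi_div_three {σ : ℝ} (hσ : σ = 1 ∨ σ = -1) :
    phase (σ * (2 * Real.pi / 3)) = -1 / 2 + σ * (Real.sqrt 3 : ℂ) * Complex.I / 2 := by
  rw [phase_sign_mul hσ, show 2 * Real.pi / 3 = Real.pi - Real.pi / 3 by ring, Real.cos_pi_sub,
    Real.sin_pi_sub, Real.cos_pi_div_three, Real.sin_pi_div_three]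
  push_cast
  ring

lemma phase_three_pi_div_two {σ : ℝ} (hσ : σ = 1 ∨ σ = -1) :
    phase (σ * (3 * Real.pi / 2)) = -(σ * Complex.I) := by
  rw [phase_sign_mul hσ, show 3 * Real.pi / 2 = Real.pi / 2 + Real.pi by ring, Real.cos_add_pi,
    Real.sin_add_pi, Real.cos_pi_div_two, Real.sin_pi_div_two]
  push_cast
  ring

lemma phase_sign_mul_re {σ : ℝ} (hσ : σ = 1 ∨ σ = -1) (θ : ℝ) :
    (phase (σ * θ)).re = Real.cos θ := by
  rw [phase_sign_mul hσ]
  simp [-Complex.ofReal_cos, -Complex.ofReal_sin]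

/-- The squares are `σ i ρ²` times the three cube roots of unity. The real parts are `ρ` times the
cosines of `π/4`, `π/12` and `5π/12`, and are ordered by monotonicity of the cosine on `[0, π]`. -/
lemma isExponentTriple_cubeExponent {σ ρ : ℝ} (hσ : σ = 1 ∨ σ = -1) (hρ : 0 < ρ) :
    IsExponentTriple (cubeExponent σ ρ) (conj (σ * (Complex.I * (ρ : ℂ) ^ 6))) := by
  have hn := neg_sign hσ
  have hs := ofReal_sign_sq hσ
  have h3 := ofReal_sqrt_three_sq
  have hI := Complex.I_sq
  have hpi := Real.pi_pos
  have s0 : cubeExponent σ ρ 0 ^ 2 = σ * Complex.I * ρ ^ 2 := by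
    have h : phase (-σ * (3 * Real.pi / 4)) ^ 2 = σ * Complex.I := by
      rw [phase_sq, show 2 * (-σ * (3 * Real.pi / 4)) = -σ * (3 * Real.pi / 2) by ring,
        phase_three_pi_div_two hn]
      push_cast
      ring
    rw [← h]
    simp [cubeExponent, mul_pow]
  have s1 : cubeExponent σ ρ 1 ^ 2 =
      ((Real.sqrt 3 : ℂ) / 2 - σ * Complex.I / 2) * ρ ^ 2 := by
    have h : phase (-σ * (Real.pi / 12)) ^ 2 = (Real.sqrt 3 : ℂ) / 2 - σ * Complex.I / 2 := by
      rw [phase_sq, show 2 * (-σ * (Real.pi / 12)) = -σ * (Real.pi / 6) by ring,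
        phase_pi_div_six hn]
      push_cast
      ring
    rw [← h]
    simp [cubeExponent, mul_pow]
  have s2 : cubeExponent σ ρ 2 ^ 2 =
      (-(Real.sqrt 3 : ℂ) / 2 - σ * Complex.I / 2) * ρ ^ 2 := by
    have h : phase (-σ * (5 * Real.pi / 12)) ^ 2 = -(Real.sqrt 3 : ℂ) / 2 - σ * Complex.I / 2 := by
      rw [phase_sq, show 2 * (-σ * (5 * Real.pi / 12)) = -σ * (5 * Real.pi / 6) by ring,
        phase_five_pi_div_six hn]
      push_cast
      ring
    rw [← h]
    simp [cubeExponent, mul_pow]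
  have r0 : (cubeExponent σ ρ 0).re = Real.cos (Real.pi / 4) * ρ := by
    have h := phase_sign_mul_re hn (3 * Real.pi / 4)
    change (-phase (-σ * (3 * Real.pi / 4)) * (ρ : ℂ)).re = _
    rw [Complex.re_mul_ofReal, Complex.neg_re, h,
      show 3 * Real.pi / 4 = Real.pi - Real.pi / 4 by ring, Real.cos_pi_sub, neg_neg]
  have r1 : (cubeExponent σ ρ 1).re = Real.cos (Real.pi / 12) * ρ := by
    change (phase (-σ * (Real.pi / 12)) * (ρ : ℂ)).re = _
    rw [Complex.re_mul_ofReal, phase_sign_mul_re hn]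
  have r2 : (cubeExponent σ ρ 2).re = Real.cos (5 * Real.pi / 12) * ρ := by
    change (phase (-σ * (5 * Real.pi / 12)) * (ρ : ℂ)).re = _
    rw [Complex.re_mul_ofReal, phase_sign_mul_re hn]
  have p2 : 0 < (cubeExponent σ ρ 2).re := by
    rw [r2]
    exact mul_pos (Real.cos_pos_of_mem_Ioo ⟨by linarith, by linarith⟩) hρ
  have p20 : (cubeExponent σ ρ 2).re < (cubeExponent σ ρ 0).re := by
    rw [r2, r0]
    exact mul_lt_mul_of_pos_right
      (Real.cos_lt_cos_of_nonneg_of_le_pi (by linarith) (by linarith) (by linarith)) hρ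
  have p01 : (cubeExponent σ ρ 0).re < (cubeExponent σ ρ 1).re := by
    rw [r0, r1]
    exact mul_lt_mul_of_pos_right
      (Real.cos_lt_cos_of_nonneg_of_le_pi (by linarith) (by linarith) (by linarith)) hρ
  refine ⟨fun j => ?_, fun i j hij => ?_, ?_, ?_, ?_⟩
  · fin_cases j
    · exact p2.trans p20
    · exact p2.trans (p20.trans p01)
    · exact p2
  · fin_cases i <;> fin_cases j <;> simp at hij ⊢ <;> linarith
  · rw [s0, s1, s2]
    ring
  · rw [s0, s1, s2]
    linear_combination (-(1 / 4) * (ρ : ℂ) ^ 4) * h3 - (3 / 4 * (ρ : ℂ) ^ 4 * Complex.I ^ 2) * hs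
      - 3 / 4 * (ρ : ℂ) ^ 4 * hI
  · rw [s0, s1, s2]
    simp only [map_mul, map_pow, Complex.conj_ofReal, Complex.conj_I]
    linear_combination (-(1 / 4) * σ * Complex.I * (ρ : ℂ) ^ 6) * h3 +
      (1 / 4 * σ * Complex.I ^ 3 * (ρ : ℂ) ^ 6) * hs + 1 / 4 * σ * Complex.I * (ρ : ℂ) ^ 6 * hI

/-! ### The explicit basis of the kernel for `l = 1, 2` -/

/-- The coefficients of the exponentials in `qOne`. -/
noncomputable def qOneCoeff (σ : ℝ) : Fin 3 → ℂ :=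
  ![1, phase (-σ * (2 * Real.pi / 3)), phase (σ * (2 * Real.pi / 3))]

/-- The coefficients of the exponentials in `qTwo`. -/
noncomputable def qTwoCoeff (σ : ℝ) : Fin 3 → ℂ :=
  ![phase (-σ * (5 * Real.pi / 6)), (Real.sqrt 3 : ℂ), phase (σ * (5 * Real.pi / 6))]

lemma besselD_eqOn_sum_cubeExponent (l : ℕ) (σ ρ : ℝ) (c : Fin 3 → ℂ) :
    EqOn (besselD l fun r => ∑ j, c j * Complex.exp ((-cubeExponent σ ρ) j * r))
      (fun r => ∑ j, c j * besselExp l ((-cubeExponent σ ρ) j) r) (Ioi 0) :=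
  besselD_sum Finset.univ c (fun _ => contDiff_exp_mul_ofReal _) l

lemma qOne_eqOn (l : ℕ) (σ ρ : ℝ) : EqOn (qOne l σ ρ)
    (fun r => ∑ j, qOneCoeff σ j * besselExp l ((-cubeExponent σ ρ) j) r) (Ioi 0) := by
  convert! besselD_eqOn_sum_cubeExponent l σ ρ (qOneCoeff σ) using 1
  rw [qOne]
  congr 1
  funext r
  simp [Fin.sum_univ_three, qOneCoeff, cubeExponent]

lemma qTwo_eqOn (l : ℕ) (σ ρ : ℝ) : EqOn (qTwo l σ ρ)
    (fun r => ∑ j, qTwoCoeff σ j * besselExp l ((-cubeExponent σ ρ) j) r) (Ioi 0) := by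
  convert! besselD_eqOn_sum_cubeExponent l σ ρ (qTwoCoeff σ) using 1
  rw [qTwo]
  congr 1
  funext r
  simp [Fin.sum_univ_three, qTwoCoeff, cubeExponent]

lemma mem_momentSpace_iff_sum_eq_zero {μ α : Fin 3 → ℂ} {l : ℕ} (hl : l = 1 ∨ l = 2) :
    α ∈ momentSpace μ l ↔ α 0 + α 1 + α 2 = 0 := by
  rw [mem_momentSpace, ← Fin.sum_univ_three]
  constructor
  · intro h
    simpa using h 0 (by omega) (by decide)
  · intro h n hn he
    obtain rfl : n = 0 := by
      obtain ⟨k, rfl⟩ := he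
      omega
    simpa using h

section
variable {σ : ℝ}

lemma sum_qOneCoeff (hσ : σ = 1 ∨ σ = -1) :
    qOneCoeff σ 0 + qOneCoeff σ 1 + qOneCoeff σ 2 = 0 := by
  simp only [qOneCoeff, Matrix.cons_val, phase_two_pi_div_three hσ,
    phase_two_pi_div_three (neg_sign hσ)]
  push_cast
  ring

lemma sum_qTwoCoeff (hσ : σ = 1 ∨ σ = -1) :
    qTwoCoeff σ 0 + qTwoCoeff σ 1 + qTwoCoeff σ 2 = 0 := by
  simp only [qTwoCoeff, Matrix.cons_val, phase_five_pi_div_six hσ,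
    phase_five_pi_div_six (neg_sign hσ)]
  push_cast
  ring

/-- The minor equals `√3 - σ i`; multiplying by its conjugate gives `3 + 1`. Two coordinates
suffice, since both coefficient vectors have sum zero. -/
lemma qCoeff_det_mul (hσ : σ = 1 ∨ σ = -1) :
    (qOneCoeff σ 0 * qTwoCoeff σ 1 - qOneCoeff σ 1 * qTwoCoeff σ 0) *
      ((Real.sqrt 3 : ℂ) + σ * Complex.I) = 4 := by
  have hs := ofReal_sign_sq hσ
  have h3 := ofReal_sqrt_three_sq
  have hI := Complex.I_sq
  simp only [qOneCoeff, qTwoCoeff, Matrix.cons_val, phase_two_pi_div_three (neg_sign hσ),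
    phase_five_pi_div_six (neg_sign hσ)]
  push_cast
  have hd : (1 * (Real.sqrt 3 : ℂ) - (-1 / 2 + -(σ : ℂ) * (Real.sqrt 3 : ℂ) * Complex.I / 2) *
      (-(Real.sqrt 3 : ℂ) / 2 + -(σ : ℂ) * Complex.I / 2)) = (Real.sqrt 3 : ℂ) - σ * Complex.I := by
    linear_combination (-(1 / 4) * (σ : ℂ) * Complex.I) * h3 -
      1 / 4 * (Real.sqrt 3 : ℂ) * Complex.I ^ 2 * hs - 1 / 4 * (Real.sqrt 3 : ℂ) * hI
  rw [hd]
  linear_combination h3 - Complex.I ^ 2 * hs - hI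

lemma qCoeff_det_ne_zero (hσ : σ = 1 ∨ σ = -1) :
    qOneCoeff σ 0 * qTwoCoeff σ 1 - qOneCoeff σ 1 * qTwoCoeff σ 0 ≠ 0 := fun h => by
  have := qCoeff_det_mul hσ
  rw [h, zero_mul] at this
  norm_num at this

/-- The explicit description of the kernel for `l = 1, 2`. -/
lemma adjointKernel_eq_span_qOne_qTwo {l : ℕ} (hl : l = 1 ∨ l = 2) {ρ : ℝ} (hρ : 0 < ρ)
    (hσ : σ = 1 ∨ σ = -1) :
    ∃ (h₁ : MemLp (qOne l σ ρ) 2 halfLineMeasure) (h₂ : MemLp (qTwo l σ ρ) 2 halfLineMeasure),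
      LinearIndependent ℂ ![h₁.toLp, h₂.toLp] ∧
      adjointKernel (radialCube l) (σ * (Complex.I * (ρ : ℂ) ^ 6)) =
        Submodule.span ℂ {h₁.toLp, h₂.toLp} := by
  have h := isExponentTriple_cubeExponent hσ hρ
  have m1 : qOneCoeff σ ∈ momentSpace (cubeExponent σ ρ) l :=
    (mem_momentSpace_iff_sum_eq_zero hl).2 (sum_qOneCoeff hσ)
  have m2 : qTwoCoeff σ ∈ momentSpace (cubeExponent σ ρ) l :=
    (mem_momentSpace_iff_sum_eq_zero hl).2 (sum_qTwoCoeff hσ)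
  have e1 : qOne l σ ρ =ᵐ[halfLineMeasure] _ :=
    (ae_restrict_mem measurableSet_Ioi).mono fun r hr => qOne_eqOn l σ ρ hr
  have e2 : qTwo l σ ρ =ᵐ[halfLineMeasure] _ :=
    (ae_restrict_mem measurableSet_Ioi).mono fun r hr => qTwo_eqOn l σ ρ hr
  have h₁ := (memLp_congr_ae e1).2 (h.memLp m1)
  have h₂ := (memLp_congr_ae e2).2 (h.memLp m2)
  have k1 : h₁.toLp = h.solutionMap l ⟨_, m1⟩ :=
    Lp.ext (h₁.coeFn_toLp.trans (e1.trans (h.coeFn_solutionMap l ⟨_, m1⟩).symm))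
  have k2 : h₂.toLp = h.solutionMap l ⟨_, m2⟩ :=
    Lp.ext (h₂.coeFn_toLp.trans (e2.trans (h.coeFn_solutionMap l ⟨_, m2⟩).symm))
  have hdet := qCoeff_det_ne_zero hσ
  refine ⟨h₁, h₂, ?_, ?_⟩
  · rw [LinearIndependent.pair_iff]
    intro s t hst
    rw [k1, k2, ← map_smul, ← map_smul, ← map_add] at hst
    have hst' := congrArg Subtype.val ((map_eq_zero_iff _ (h.solutionMap_injective l)).1 hst)
    have c0 : s * qOneCoeff σ 0 + t * qTwoCoeff σ 0 = 0 := congrFun hst' 0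
    have c1 : s * qOneCoeff σ 1 + t * qTwoCoeff σ 1 = 0 := congrFun hst' 1
    constructor
    · refine (mul_eq_zero.1 ?_).resolve_right hdet
      linear_combination qTwoCoeff σ 1 * c0 - qTwoCoeff σ 0 * c1
    · refine (mul_eq_zero.1 ?_).resolve_right hdet
      linear_combination qOneCoeff σ 0 * c1 - qOneCoeff σ 1 * c0
  · rw [← h.range_solutionMap l, k1, k2]
    apply le_antisymm
    · rintro _ ⟨α, rfl⟩
      obtain ⟨α, hα⟩ := α
      have hα0 := (mem_momentSpace_iff_sum_eq_zero hl).1 hα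
      set d := qOneCoeff σ 0 * qTwoCoeff σ 1 - qOneCoeff σ 1 * qTwoCoeff σ 0 with hd
      -- Cramer's rule for the first two coordinates; the third follows as all three vectors have
      -- sum zero.
      refine Submodule.mem_span_pair.2 ⟨(α 0 * qTwoCoeff σ 1 - α 1 * qTwoCoeff σ 0) / d,
        (qOneCoeff σ 0 * α 1 - qOneCoeff σ 1 * α 0) / d, ?_⟩
      rw [← map_smul, ← map_smul, ← map_add]
      congr 1
      refine Subtype.ext (funext fun j => ?_)
      have g0 : (α 0 * qTwoCoeff σ 1 - α 1 * qTwoCoeff σ 0) / d * qOneCoeff σ 0 +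
          (qOneCoeff σ 0 * α 1 - qOneCoeff σ 1 * α 0) / d * qTwoCoeff σ 0 = α 0 := by
        field_simp
        rw [hd]
        ring
      have g1 : (α 0 * qTwoCoeff σ 1 - α 1 * qTwoCoeff σ 0) / d * qOneCoeff σ 1 +
          (qOneCoeff σ 0 * α 1 - qOneCoeff σ 1 * α 0) / d * qTwoCoeff σ 1 = α 1 := by
        field_simp
        rw [hd]
        ring
      have s1 := sum_qOneCoeff hσ
      have s2 := sum_qTwoCoeff hσ
      fin_cases j
      · exact g0
      · exact g1
      · change (α 0 * qTwoCoeff σ 1 - α 1 * qTwoCoeff σ 0) / d * qOneCoeff σ 2 +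
          (qOneCoeff σ 0 * α 1 - qOneCoeff σ 1 * α 0) / d * qTwoCoeff σ 2 = α 2
        linear_combination (α 0 * qTwoCoeff σ 1 - α 1 * qTwoCoeff σ 0) / d * s1 +
          (qOneCoeff σ 0 * α 1 - qOneCoeff σ 1 * α 0) / d * s2 - g0 - g1 - hα0
    · rw [Submodule.span_le]
      rintro _ (rfl | rfl)
      · exact ⟨_, rfl⟩
      · exact ⟨_, rfl⟩

end

/-! ### The deficiency indices -/

lemma rank_adjointKernel_eq_two {l : ℕ} (hl : l = 1 ∨ l = 2) {ρ σ : ℝ} (hρ : 0 < ρ)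
    (hσ : σ = 1 ∨ σ = -1) :
    Module.rank ℂ (adjointKernel (radialCube l) (σ * (Complex.I * (ρ : ℂ) ^ 6))) = 2 := by
  obtain ⟨h₁, h₂, hli, hk⟩ := adjointKernel_eq_span_qOne_qTwo hl hρ hσ
  have hs := finrank_span_eq_card hli
  rw [Matrix.range_cons_cons_empty, Fintype.card_fin] at hs
  have hfin := Module.Finite.span_of_finite ℂ
    (Set.toFinite ({h₁.toLp, h₂.toLp} : Set HalfLineL2))
  rw [hk, ← Module.finrank_eq_rank, hs, Nat.cast_two]

/-- The points `±i` are `σ i ρ⁶` with `ρ = 1` and `σ = ±1`. -/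
lemma hasDeficiencyIndices_radialCube_of_rank {l n : ℕ}
    (h : ∀ σ : ℝ, σ = 1 ∨ σ = -1 → Module.rank ℂ
      (adjointKernel (radialCube l) (σ * (Complex.I * ((1 : ℝ) : ℂ) ^ 6))) = n) :
    HasDeficiencyIndices (radialCube l) n n := by
  constructor
  · have h1 := h 1 (Or.inl rfl)
    rwa [Complex.ofReal_one, one_pow, one_mul, mul_one] at h1
  · have h1 := h (-1) (Or.inr rfl)
    rwa [Complex.ofReal_neg, Complex.ofReal_one, one_pow, mul_one, neg_one_mul] at h1

theorem mainTheorem2 :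
    (∀ l : ℕ, 1 ≤ l →
      ((radialCube l).domain : Set HalfLineL2) = sobolevW06 ∧
      Dense ((radialCube l).domain : Set HalfLineL2) ∧
      (radialCube l).IsFormalAdjoint (radialCube l)) ∧
    (∀ l : ℕ, l = 1 ∨ l = 2 →
      HasDeficiencyIndices (radialCube l) 2 2 ∧
      ∀ ρ : ℝ, 0 < ρ → ∀ σ : ℝ, σ = 1 ∨ σ = -1 →
        ∃ (h₁ : MemLp (qOne l σ ρ) 2 halfLineMeasure) (h₂ : MemLp (qTwo l σ ρ) 2 halfLineMeasure),
          LinearIndependent ℂ ![h₁.toLp, h₂.toLp] ∧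
          adjointKernel (radialCube l) (σ * (Complex.I * (ρ : ℂ) ^ 6)) =
            Submodule.span ℂ {h₁.toLp, h₂.toLp}) ∧
    (∀ l : ℕ, l = 3 ∨ l = 4 → HasDeficiencyIndices (radialCube l) 1 1) ∧
    (∀ l : ℕ, 5 ≤ l → HasDeficiencyIndices (radialCube l) 0 0) := by
  refine ⟨fun l _ => ⟨radialCube_domain l, radialCube_dense l, radialCube_isFormalAdjoint l⟩,
    fun l hl => ⟨?_, fun ρ hρ σ hσ => adjointKernel_eq_span_qOne_qTwo hl hρ hσ⟩,
    fun l hl => ?_, fun l hl => ?_⟩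
  · exact hasDeficiencyIndices_radialCube_of_rank fun σ hσ => by
      rw [rank_adjointKernel_eq_two hl one_pos hσ, Nat.cast_two]
  · exact hasDeficiencyIndices_radialCube_of_rank fun σ hσ => by
      rw [(isExponentTriple_cubeExponent hσ one_pos).rank_adjointKernel_eq_one hl, Nat.cast_one]
  · exact hasDeficiencyIndices_radialCube_of_rank fun σ hσ => by
      rw [(isExponentTriple_cubeExponent hσ one_pos).rank_adjointKernel_eq_zero hl, Nat.cast_zero]
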